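/- **Setting.** Let $D=[0,2\pi]^3$ with periodic boundary conditions, $d=3$; $\sum'_k$ denotes a sum over $k\in\mathbb Z^3\setminus\{0\}$, $f_k$ are the Fourier coefficients of $f=\sum_k f_k e^{ik\cdot x}$, $\mathsf P_{a,b}f=\sum_{a\le|k|<b}f_ke^{ik\cdot x}$, $\Delta^{-1}$ is the mean-zero inverse Laplacian, $\nabla^{-1}$ is the Fourier multiplier $|k|^{-1}$ on $k\ne0$, and $|f|_1:=\sum_k|f_k|$. Let $\mathbb Z^3_+=\{(l,m,n):n>0\}\cup\{(l,m,0):m>0\}\cup\{(l,0,0):l>0\}$. A complex random variable $Z$ is of class $\mathcal R_\varsigma$ with bound $\Xi$ if its law is invariant under rotations of $\mathbb C$, $\sup\{s:P(|Z|>s)>0\}=\Xi<\infty$, $\mathsf E|Z|^2=1$ and $\mathsf E|Z|^4=\varsigma$. *Velocity.* $u(x)=U\sum'_k|k|^\beta\,[e_kV_k+f_kW_k]\,e^{ik\cdot x}$ with $U\ge0$, $\beta<-2$, where $e_k=(k_y,-k_x,0)/|k_h|$, $f_k=(k_xk_z,k_yk_z,-|k_h|^2)/(|k||k_h|)$, $|k_h|^2=k_x^2+k_y^2$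 (for $k_h=0$: $e_k=(0,-\operatorname{sgn}k_z,0)$, $f_k=(1,0,0)$). The $V_k,W_k$ are of class $\mathcal R_\varsigma$ with bound $\Xi$, the family $(V_k)_{k\in\mathbb Z^3_+},(W_k)_{k\in\mathbb Z^3_+}$ is independent, and $u$ is real, i.e. $V_{-k}=-\overline{V_k}$, $W_{-k}=\overline{W_k}$ almost surely. *Source.* $\gamma_k\in\mathbb C$ with $\gamma_0=0$, $\gamma_{-k}=\overline{\gamma_k}$, and $|\gamma_k|\le c_g|k|^\alpha$ for $|k|\ge\kappa_g$, where $c_g\ge0$, $\kappa_g\ge16$ and $\alpha<2\min\{\beta,-3\}-1$. The source is either the deterministic $g$ with $\Delta^{-1}g=\sum'_k\gamma_ke^{ik\cdot x}$ (put $\Xi_g=1$), or the random $g_r$ with $\Delta^{-1}g_r=\sum'_k\gamma_kZ_ke^{ik\cdot x}$, where the $Z_k$ are of class $\mathcal R_\varrho$ with bound $\Xi_g$, $Z_{-k}=\overline{Z_k}$ almost surely, uncorrelated ($\mathsf EZ_jZ_k=0$, $\mathsf EZ_j\overline{Z_k}=\delta_{jk}$ for $j,k\in\mathbb Z^3_+$),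 and independent of $(V,W)$. In both cases $g$ in the norms below is the deterministic source with coefficients $\gamma_k$. *Smallness.* Let $K_\beta(s)=\min\{1,(2\kappa_g)^{-\beta}s^\beta\}$ and let $\varpi$ be a constant with $$\sum_{j\ne0,k}|k-j|^\beta|j|^{-1}K_\beta(|j|)\le\varpi K_\beta(|k|)\qquad\text{for all }k\ne0 .$$ Put $U_{\max}=1/(4\Xi\varpi)$ and $\varepsilon=U/U_{\max}=4U\Xi\varpi$. *Iteration.* For a source $G$ ($=g$ or $g_r$), $\theta^{(0)}=-\Delta^{-1}G$, $\theta^{(n+1)}=\Delta^{-1}(u\cdot\nabla\theta^{(n)}-G)$, $\vartheta=\theta^{(1)}-\theta^{(0)}$. **Theorem.** A constant $\varpi$ as above exists for all $\beta<-2$, $\kappa_g\ge16$. Assume $\varepsilon<1$. Then: 1. Almost surely, $u\cdot\nabla\theta=\Delta\theta+G$ has a unique mean-zero weak solution $\theta\in H^1$; it is real, the iterates lie in $H^1$ and converge to it in $H^1$, and $\theta=-\Delta^{-1}G+\vartheta+\delta\theta$ where, for all $\kappa\ge4\kappa_g^2$, $$\|\mathsf P_{\kappa,2\kappa}\delta\theta\|_{L^2}^2\le\varepsilon^2\,c(g,\alpha,\beta)\,U^2\,\Xi^2\,\Xi_g^2\,\kappa^{2\beta-1},$$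 with $c(g,\alpha,\beta)$ depending only on $\alpha,\beta,c_g,\kappa_g,(\gamma_k)$. 2. For all $\kappa\ge4\kappa_g^2$, $$\mathsf E\|\mathsf P_{\kappa,2\kappa}\vartheta\|_{L^2}^2=\kappa^{2\beta-1}\,\frac{8\pi U^2}{3}\,\frac{2^{2\beta-1}-1}{2\beta-1}\,\|\mathsf P_{1,\kappa^{1/2}}\nabla^{-1}g\|_{L^2}^2+\mathcal E(\kappa),$$ $$|\mathcal E(\kappa)|\le c_g^2U^2c(\alpha,\beta)\kappa^\alpha+c(\beta)U^2\|\nabla^{-1}g\|_{L^2}^2\,\kappa^{2\beta-3/2}.$$ 3. If the source is deterministic and $c_g=0$ (finitely many modes), then for every $\eta>0$ and all sufficiently large $\kappa$, $$\operatorname{var}\|\mathsf P_{\kappa,2\kappa}\vartheta\|_{L^2}^2\le(1+\eta)\,\kappa^{4\beta-5}\,16\pi U^4\,\frac{2^{4\beta-5}-1}{4\beta-5}\,\|\nabla^{-1}g\|_{L^2}^2\bigl\{16\pi^3|\nabla^{-1}g|_1^2+(\varsigma-1)\|\nabla^{-1}g\|_{L^2}^2\bigr\}.$$ -/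

import Mathlib

open MeasureTheory ProbabilityTheory Filter Topology UnitAddTorus
open scoped ComplexConjugate ENNReal

/-- The circle `ℝ / ℤ` carries its Haar probability measure (the normalisation under which
Mathlib develops multivariate Fourier series). -/
noncomputable local instance circleMeasureSpace : MeasureSpace UnitAddCircle := ⟨AddCircle.haarAddCircle⟩

local instance circleIsAddHaar : Measure.IsAddHaarMeasure (volume : Measure UnitAddCircle) :=
  inferInstanceAs (Measure.IsAddHaarMeasure AddCircle.haarAddCircle)

local instance circleIsProbability : IsProbabilityMeasure (volume : Measure UnitAddCircle) :=
  inferInstanceAs (IsProbabilityMeasure AddCircle.haarAddCircle)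

namespace BHT

noncomputable section

/-! ### The periodic box

A function of `x ∈ [0, 2π]³`, periodic in all directions, is written as a function of
`y = x / (2π)` on the unit torus, so that `exp (i k · x)` is `mFourier k y`. All differential
operators below are those of the variable `x`. -/

/-- Wave vectors. -/
abbrev Wave := Fin 3 → ℤ

/-- The unit torus `(ℝ / ℤ)³`. -/
abbrev Torus := UnitAddTorus (Fin 3)

/-- Square integrable complex functions on the torus. -/
abbrev L2 := Lp ℂ 2 (volume : Measure Torus)

/-- The Euclidean length `|k|`. -/
def len (k : Wave) : ℝ := √(∑ i, (k i : ℝ) ^ 2)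

/-- The length `|k_h|` of the horizontal part of `k`. -/
def lenH (k : Wave) : ℝ := √((k 0 : ℝ) ^ 2 + (k 1 : ℝ) ^ 2)

/-- The half space `ℤ³₊`. -/
def halfSpace : Set Wave :=
  {k | 0 < k 2 ∨ (k 2 = 0 ∧ 0 < k 1) ∨ (k 2 = 0 ∧ k 1 = 0 ∧ 0 < k 0)}

/-- The function `∑ₖ cₖ exp (i k · x)`, the series converging in `L²`. -/
def series (c : Wave → ℂ) : L2 := ∑' k, c k • mFourierLp 2 k

/-- The `k`-th Fourier coefficient. -/
def coeff (f : Torus → ℂ) (k : Wave) : ℂ := mFourierCoeff f k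

/-- The squared `L²` norm on the box `[0, 2π]³`, which has volume `(2π)³`. -/
def normSq (f : L2) : ℝ := (2 * Real.pi) ^ 3 * ‖f‖ ^ 2

/-- The spectral projection `P_{a,b}` onto the modes with `a ≤ |k| < b`. -/
def proj (a b : ℝ) (f : L2) : L2 :=
  series fun k => open Classical in if a ≤ len k ∧ len k < b then coeff f k else 0

/-- The mean-zero inverse Laplacian `Δ⁻¹ f` (of the mean-free part of `f`). -/
def invLap (f : Torus → ℂ) : L2 :=
  series fun k => if k = 0 then 0 else -(coeff f k / ((len k ^ 2 : ℝ) : ℂ))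

/-- `∇⁻¹ f`, the Fourier multiplier `|k|⁻¹` on the nonzero modes. -/
def invGrad (f : Torus → ℂ) : L2 :=
  series fun k => if k = 0 then 0 else coeff f k / ((len k : ℝ) : ℂ)

/-- The sum `∑ₖ |fₖ|` of the moduli of the Fourier coefficients. -/
def wienerNorm (f : L2) : ℝ := ∑' k, ‖coeff f k‖

/-- The Sobolev space `H¹`. -/
def MemH1 (f : L2) : Prop := Summable fun k => len k ^ 2 * ‖coeff f k‖ ^ 2

/-- The weak partial derivative `∂ᵢ f` (in the variable `x`) of a function `f ∈ H¹`. -/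
def partialD (i : Fin 3) (f : L2) : L2 := series fun k => Complex.I * (k i : ℂ) * coeff f k

/-- The advection term `u · ∇f`, a pointwise product. -/
def advect (u : Fin 3 → L2) (f : L2) : Torus → ℂ := fun x => ∑ i, u i x * partialD i f x

/-- Mean-zero weak solutions `θ ∈ H¹` of `u · ∇θ = Δθ + g`: the equation, in the sense of
distributions, is tested against all the functions `exp (-i k · x)`. -/
structure IsStaticSolution (u : Fin 3 → L2) (g θ : L2) : Prop where
  mean_zero : coeff θ 0 = 0
  memH1 : MemH1 θ
  eqn : ∀ k : Wave,
    coeff (advect u θ) k = -((len k ^ 2 : ℝ) : ℂ) * coeff θ k + coeff g k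

/-- The fixed-point iteration `θ⁽⁰⁾ = -Δ⁻¹g`, `θ⁽ⁿ⁺¹⁾ = Δ⁻¹ (u · ∇θ⁽ⁿ⁾ - g)`. -/
def iter (u : Fin 3 → L2) (g : L2) : ℕ → L2
  | 0 => -invLap g
  | n + 1 => invLap fun x => advect u (iter u g n) x - g x

/-- The first correction `ϑ = θ⁽¹⁾ - θ⁽⁰⁾`. -/
def firstCorr (u : Fin 3 → L2) (g : L2) : L2 := iter u g 1 - iter u g 0

/-! ### The Craya–Herring basis and the velocity -/

/-- The unit vector `e_k = (k_y, -k_x, 0) / |k_h|`. For vertical `k` it is the value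
`(sin φ, -cos φ, 0)` with azimuth `φ = 0` if `k_z > 0` and `φ = π` if `k_z < 0`, so that
`e_{-k} = -e_k` throughout. -/
def eVec (k : Wave) : Fin 3 → ℝ :=
  if k 0 = 0 ∧ k 1 = 0 then ![0, -((k 2).sign : ℝ), 0]
  else ![(k 1 : ℝ) / lenH k, -(k 0 : ℝ) / lenH k, 0]

/-- The unit vector `f_k = (k_x k_z, k_y k_z, -|k_h|²) / (|k| |k_h|)`, with the same convention
for vertical `k`, so that `f_{-k} = f_k` throughout. -/
def fVec (k : Wave) : Fin 3 → ℝ :=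
  if k 0 = 0 ∧ k 1 = 0 then ![1, 0, 0]
  else ![(k 0 : ℝ) * k 2 / (len k * lenH k), (k 1 : ℝ) * k 2 / (len k * lenH k),
    -(lenH k ^ 2) / (len k * lenH k)]

/-- The velocity `u(x) = ∑'ₖ |k|^β [U e_k V_k + U f_k W_k] exp (i k · x)`, for given values of the
modes `V_k`, `W_k`. -/
def velocity (β U : ℝ) (V W : Wave → ℂ) : Fin 3 → L2 := fun i =>
  series fun k => if k = 0 then 0 else
    ((len k ^ β : ℝ) : ℂ) * ((U : ℂ) * (eVec k i : ℂ) * V k + (U : ℂ) * (fVec k i : ℂ) * W k)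

/-- The source `g` with `Δ⁻¹g = ∑'ₖ γₖ exp (i k · x)`. -/
def source (γ : Wave → ℂ) : L2 :=
  series fun k => if k = 0 then 0 else -((len k ^ 2 : ℝ) : ℂ) * γ k

/-- Admissible coefficients of the (real, mean-free) source. -/
structure IsSourceCoeff (α cg κg : ℝ) (γ : Wave → ℂ) : Prop where
  zero : γ 0 = 0
  conj_symm : ∀ k, γ (-k) = conj (γ k)
  decay : ∀ k, κg ≤ len k → ‖γ k‖ ≤ cg * len k ^ α

/-! ### The random modes -/

section Probability

variable {Ω : Type*} [MeasurableSpace Ω]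

/-- Complex random variables of class `R_ς`: circular (the law is invariant under rotations, that
is, `Z = R exp (i ζ)` in law, with a uniform phase `ζ` independent of the modulus `R`), with
`sup {s : P (|Z| > s) > 0} = Ξ < ∞`, `E |Z|² = 1` and `E |Z|⁴ = ς`. -/
structure IsProper (P : Measure Ω) (Z : Ω → ℂ) (ς Ξ : ℝ) : Prop where
  measurable : Measurable Z
  circular : ∀ φ : ℝ, IdentDistrib (fun ω => Complex.exp (φ * Complex.I) * Z ω) Z P P
  bounded : IsLUB {s : ℝ | 0 < P {ω | s < ‖Z ω‖}} Ξ
  second : ∫ ω, ‖Z ω‖ ^ 2 ∂P = 1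
  fourth : ∫ ω, ‖Z ω‖ ^ 4 ∂P = ς

/-- The modes of the velocity: all of class `R_ς`, independent on the half space, and satisfying
the constraints that make the velocity real. As `e_{-k} = -e_k` and `f_{-k} = f_k`, these are
`V_{-k} = -conj V_k` and `W_{-k} = conj W_k`. -/
structure IsVelocityModes (P : Measure Ω) (V W : Wave → Ω → ℂ) (ς Ξ : ℝ) : Prop where
  properV : ∀ k ≠ 0, IsProper P (V k) ς Ξ
  properW : ∀ k ≠ 0, IsProper P (W k) ς Ξ
  realV : ∀ k ≠ 0, ∀ᵐ ω ∂P, V (-k) ω = -conj (V k ω)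
  realW : ∀ k ≠ 0, ∀ᵐ ω ∂P, W (-k) ω = conj (W k ω)
  indep : iIndepFun
    (Sum.elim (fun k : halfSpace => V k.1) (fun k : halfSpace => W k.1)) P

/-- The random factors of a random source: of class `R_ϱ`, hermitian, uncorrelated on the half
space, and independent of the velocity. -/
structure IsRandomSource (P : Measure Ω) (V W Z : Wave → Ω → ℂ) (ϱ Ξg : ℝ) : Prop where
  proper : ∀ k ≠ 0, IsProper P (Z k) ϱ Ξg
  real : ∀ k ≠ 0, ∀ᵐ ω ∂P, Z (-k) ω = conj (Z k ω)
  uncorr : ∀ j ∈ halfSpace, ∀ k ∈ halfSpace, ∫ ω, Z j ω * Z k ω ∂P = 0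
  uncorr_conj : ∀ j ∈ halfSpace, ∀ k ∈ halfSpace, j ≠ k → ∫ ω, Z j ω * conj (Z k ω) ∂P = 0
  indep : IndepFun
    (fun ω => (fun k : halfSpace => V k.1 ω, fun k : halfSpace => W k.1 ω))
    (fun ω => fun k : halfSpace => Z k.1 ω) P

end Probability

/-! ### The smallness condition -/

/-- `K_β(s) = min {1, (2 κ_g)^{-β} s^β}`. -/
def kWeight (β κg s : ℝ) : ℝ := min 1 ((2 * κg) ^ (-β) * s ^ β)

/-- The terms of the sum `∑'ⱼ |k - j|^β |j|⁻¹ K_β(|j|)`, over `j ≠ 0` (and `j ≠ k`, as the velocity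
has no mode `0`). -/
def convTerm (β κg : ℝ) (k j : Wave) : ℝ :=
  if j = 0 ∨ j = k then 0 else len (k - j) ^ β * (len j)⁻¹ * kWeight β κg (len j)

/-- `ϖ` is a constant with `∑'ⱼ |k - j|^β |j|⁻¹ K_β(|j|) ≤ ϖ K_β(|k|)` for all `k ≠ 0`. -/
def IsConvConst (β κg ϖ : ℝ) : Prop :=
  ∀ k : Wave, k ≠ 0 →
    Summable (convTerm β κg k) ∧ ∑' j, convTerm β κg k j ≤ ϖ * kWeight β κg (len k)

/-- `i₂(s) = (2^s - 1) / s`. -/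
def i₂ (s : ℝ) : ℝ := ((2 : ℝ) ^ s - 1) / s

end

end BHT

/-!
In Fourier variables the equation `u · ∇θ = Δθ + G` reads `θ = 𝒯 θ + θ⁽⁰⁾`, where
`(𝒯 c)_k = -|k|⁻² ∑ⱼ i (j · û_{k-j}) c_j` (`transport`). Incompressibility gives
`j · û_{k-j} = k · û_{k-j}`, so each term is at most `2 U Ξ |k - j|^β |k| |c_j|`.

*Existence and uniqueness.* In the sup norm with weight `K_β(|k|) |k|⁻¹` (`wgt`) the smallness
condition makes `𝒯` a contraction with factor `2 U Ξ ϖ = ε / 2 < 1 / 2`, which yields a fixed point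
and geometric convergence of the iteration (`exists_fixedPoint`); the weight is summable against
`|k|²`, whence convergence in `H¹`. Uniqueness holds in the larger class `H¹`
(`eq_zero_of_transport_eq`). The constant `ϖ` exists because the lattice sums
`∑ⱼ |k - j|^p |j|^q` decay like a power of `|k|` (`conv_rpow_le`). As `ϖ` is bounded below by a
positive constant, `U Ξ` is at most a constant multiple of `ε`; every application of `𝒯` to
coefficients of size `|k|^(β-2)` reproduces this decay with a factor `U Ξ` (`exists_decay`,
`exists_norm_transport_le_rpow`), so that `δθ`, which contains two applications, is of size
`(U Ξ)² |k|^(β-2)`. All of this is done for fixed bounded values of the modes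
(`exists_static_solution`).

*Expectation.* Independence and circularity make the joint law of the modes invariant under
rotations of each of them by a phase, the phases of opposite wave vectors being opposite
(`integral_phase`). Hence different modes are uncorrelated, and `E |ϑ_k|²` is the sum over `j` of
`U² |k|⁻⁴ |γ_j|² |k-j|^(2β)` times the squared projection of `j` orthogonally to `k - j`. For
`|j| < κ^(1/2)` the factor `|k - j|^(2β-2)` may be replaced by `|k|^(2β-2)`; the symmetry of the
shell under reflections and permutations of the coordinates turns `|j|²|k|² - (j · k)²` into
`(2/3) |j|²|k|²` (`sum_shell_dotW_sq`), and the sum over the shell is compared with an integral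
(`abs_sum_shell_rpow_sub_le`). The remaining `j` are controlled by the decay of the source.

*Variance.* For finitely many source modes the energy in a shell is a quadratic form
`∑ H_ab ξ_a ξ̄_b` in the velocity modes which, for `κ ≥ 2 κ_g`, does not couple opposite modes.
By phase invariance a centred product `ξ_a ξ̄_b` correlates only with itself and with the product of
the opposite modes, so the variance is at most `2 ∑_{a≠b} |H_ab|² + 2 (ς - 1) ∑_a |H_aa|²`
(`variance_quadForm_le`). The Cauchy-Schwarz inequality, with the weight `|γ_{k-m}| |k - m|` as a
measure in `k`, bounds both sums with the required constants.
-/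

namespace BHT

/-! ### Lengths of wave vectors -/

/-- A wave vector as a point of Euclidean space. -/
noncomputable def toE (k : Wave) : EuclideanSpace ℝ (Fin 3) := WithLp.toLp 2 fun i => (k i : ℝ)

lemma len_eq_norm (k : Wave) : len k = ‖toE k‖ := by
  simp [len, toE, EuclideanSpace.norm_eq]

lemma toE_add (j k : Wave) : toE (j + k) = toE j + toE k := by
  ext i; simp [toE]

lemma toE_injective : Function.Injective toE := by
  intro j k h
  funext i
  have := congrArg (fun v : EuclideanSpace ℝ (Fin 3) => v i) h
  simpa [toE] using this

lemma len_nonneg (k : Wave) : 0 ≤ len k := Real.sqrt_nonneg _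

lemma len_sq (k : Wave) : len k ^ 2 = ∑ i, (k i : ℝ) ^ 2 :=
  Real.sq_sqrt (Finset.sum_nonneg fun _ _ => sq_nonneg _)

lemma len_sq' (k : Wave) : len k ^ 2 = (k 0 : ℝ) ^ 2 + (k 1 : ℝ) ^ 2 + (k 2 : ℝ) ^ 2 := by
  rw [len_sq, Fin.sum_univ_three]

@[simp] lemma len_zero : len 0 = 0 := by simp [len]

@[simp] lemma len_neg (k : Wave) : len (-k) = len k := by simp [len]

lemma len_sub_comm (j k : Wave) : len (j - k) = len (k - j) := by
  rw [← len_neg, neg_sub]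

lemma len_add_le (j k : Wave) : len (j + k) ≤ len j + len k := by
  simp only [len_eq_norm, toE_add]; exact norm_add_le _ _

lemma len_le_add_sub (j k : Wave) : len k ≤ len j + len (k - j) := by
  simpa using len_add_le j (k - j)

lemma one_le_len {k : Wave} (hk : k ≠ 0) : 1 ≤ len k := by
  rw [len, Real.one_le_sqrt]
  obtain ⟨i, hi⟩ := Function.ne_iff.mp hk
  have h1 : (1 : ℝ) ≤ (k i : ℝ) ^ 2 := by
    have : (1 : ℤ) ≤ (k i) ^ 2 := by
      have : 0 < (k i) ^ 2 := sq_pos_of_ne_zero hi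
      omega
    exact_mod_cast this
  exact h1.trans (Finset.single_le_sum (f := fun i => (k i : ℝ) ^ 2)
    (fun _ _ => sq_nonneg _) (Finset.mem_univ i))

lemma len_pos {k : Wave} (hk : k ≠ 0) : 0 < len k := zero_lt_one.trans_le (one_le_len hk)

lemma abs_coord_le_len (k : Wave) (i : Fin 3) : |(k i : ℝ)| ≤ len k := by
  rw [len]
  apply Real.le_sqrt_of_sq_le
  rw [sq_abs]
  exact Finset.single_le_sum (f := fun i => (k i : ℝ) ^ 2)
    (fun _ _ => sq_nonneg _) (Finset.mem_univ i)

lemma finite_len_lt (b : ℝ) : {k : Wave | len k < b}.Finite := by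
  refine (Set.Finite.pi' (t := fun _ : Fin 3 => Set.Icc (-⌈b⌉) ⌈b⌉)
    fun _ => Set.finite_Icc _ _).subset ?_
  intro k hk i
  have h1 := (abs_coord_le_len k i).trans (le_of_lt hk)
  have h2 := abs_le.mp (h1.trans (Int.le_ceil b))
  constructor
  · exact_mod_cast h2.1
  · exact_mod_cast h2.2

/-- The finite set of the wave vectors with `a ≤ |k| < b`. -/
noncomputable def shell (a b : ℝ) : Finset Wave :=
  (Set.Finite.subset (finite_len_lt b) (t := {k : Wave | a ≤ len k ∧ len k < b})
    fun _ h => h.2).toFinset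

@[simp] lemma mem_shell {a b : ℝ} {k : Wave} : k ∈ shell a b ↔ a ≤ len k ∧ len k < b := by
  simp [shell]

lemma ne_zero_of_mem_shell {a b : ℝ} (ha : 0 < a) {k : Wave} (hk : k ∈ shell a b) : k ≠ 0 := by
  rintro rfl
  simp only [mem_shell, len_zero] at hk
  linarith [hk.1]

/-! ### Fourier series -/

lemma hasSum_series {c : Wave → ℂ} (hc : Summable fun k => ‖c k‖ ^ 2) :
    HasSum (fun k => c k • mFourierLp 2 k) (series c) ∧
      ∀ k, mFourierBasis.repr (series c) k = c k := by
  have hm : Memℓp c 2 := by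
    apply memℓp_gen
    simpa using hc
  have h := (mFourierBasis (d := Fin 3)).hasSum_repr_symm ⟨c, hm⟩
  simp only [coe_mFourierBasis] at h
  have h2 : series c = mFourierBasis.repr.symm (⟨c, hm⟩ : lp (fun _ : Wave => ℂ) 2) := h.tsum_eq
  refine ⟨?_, fun k => ?_⟩
  · rw [h2]; exact h
  · rw [h2, LinearIsometryEquiv.apply_symm_apply]

lemma coeff_series {c : Wave → ℂ} (hc : Summable fun k => ‖c k‖ ^ 2) (k : Wave) :
    coeff (series c) k = c k := by
  rw [coeff, ← mFourierBasis_repr, (hasSum_series hc).2]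

lemma coeff_eq_repr (f : L2) (k : Wave) : coeff f k = mFourierBasis.repr f k :=
  (mFourierBasis_repr f k).symm

lemma L2.ext_coeff {f g : L2} (h : ∀ k, coeff f k = coeff g k) : f = g := by
  apply (mFourierBasis (d := Fin 3)).repr.injective
  ext k
  simpa [coeff_eq_repr] using h k

lemma coeff_sub (f g : L2) (k : Wave) : coeff (f - g : L2) k = coeff f k - coeff g k := by
  rw [coeff_eq_repr, coeff_eq_repr, coeff_eq_repr, map_sub]; rfl

lemma coeff_neg (f : L2) (k : Wave) : coeff (-f : L2) k = -coeff f k := by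
  rw [coeff_eq_repr, coeff_eq_repr, map_neg]; rfl

lemma hasSum_norm_sq (f : L2) : HasSum (fun k => ‖coeff f k‖ ^ 2) (‖f‖ ^ 2) := by
  have h := lp.hasSum_norm (E := fun _ : Wave => ℂ) (p := 2) (by norm_num) (mFourierBasis.repr f)
  simpa [coeff_eq_repr] using h

lemma summable_coeff_sq (f : L2) : Summable fun k => ‖coeff f k‖ ^ 2 := (hasSum_norm_sq f).summable

lemma norm_sq_eq_tsum (f : L2) : ‖f‖ ^ 2 = ∑' k, ‖coeff f k‖ ^ 2 := (hasSum_norm_sq f).tsum_eq.symm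

lemma coeff_proj (a b : ℝ) (f : L2) (k : Wave) :
    coeff (proj a b f) k = if k ∈ shell a b then coeff f k else 0 := by
  classical
  rw [proj, coeff_series]
  · simp only [mem_shell]
  · refine (summable_coeff_sq f).of_nonneg_of_le (fun k => by positivity) fun k => ?_
    split_ifs
    · exact le_rfl
    · simp

lemma normSq_proj (a b : ℝ) (f : L2) :
    normSq (proj a b f) = (2 * Real.pi) ^ 3 * ∑ k ∈ shell a b, ‖coeff f k‖ ^ 2 := by
  rw [normSq, norm_sq_eq_tsum]
  congr 1
  simp only [coeff_proj]
  rw [tsum_eq_sum (s := shell a b)]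
  · exact Finset.sum_congr rfl fun k hk => by rw [if_pos hk]
  · intro k hk; simp [hk]

/-- The product of two square integrable functions has the convolution of the coefficients as
Fourier coefficients. -/
lemma hasSum_coeff_mul (f g : L2) (k : Wave) :
    HasSum (fun j => coeff f (k - j) * coeff g j) (coeff (fun x => f x * g x) k) := by
  have hmem : MemLp (fun x => mFourier k x * conj (f x)) 2 (volume : Measure Torus) := by
    have h1 : MemLp (fun x => conj (f x)) 2 (volume : Measure Torus) := (Lp.memLp f).star
    refine h1.of_le ?_ ?_
    · exact ((mFourier k).continuous.aestronglyMeasurable).mul h1.1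
    · refine Eventually.of_forall fun x => ?_
      rw [norm_mul]
      refine mul_le_of_le_one_left (norm_nonneg _) ?_
      exact ((mFourier k).norm_coe_le_norm x).trans mFourier_norm.le
  have h := hasSum_prod_mFourierCoeff (hmem.toLp _) g
  have hval : (∫ t, conj ((hmem.toLp _ : L2) t) * g t) = coeff (fun x => f x * g x) k := by
    rw [coeff, mFourierCoeff]
    apply integral_congr_ae
    filter_upwards [hmem.coeFn_toLp] with x hx
    rw [hx, mFourier_neg]
    simp [mul_assoc]
  rw [hval] at h
  refine h.congr_fun fun j => ?_
  congr 1
  rw [coeff, mFourierCoeff, mFourierCoeff, ← integral_conj]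
  apply integral_congr_ae
  filter_upwards [hmem.coeFn_toLp] with x hx
  simp only [smul_eq_mul, hx, map_mul, Complex.conj_conj]
  rw [← mul_assoc, ← mFourier_neg, neg_neg, neg_sub, sub_eq_add_neg, mFourier_add,
    mFourier_neg (n := k)]

lemma integrable_mul_L2 (f g : L2) : Integrable (fun x => f x * g x) (volume : Measure Torus) :=
  (Lp.memLp f).integrable_mul (Lp.memLp g)

lemma integrable_L2 (f : L2) : Integrable (fun x => f x) (volume : Measure Torus) :=
  (Lp.memLp f).integrable (by norm_num)

lemma integrable_fourier_mul {f : Torus → ℂ} (hf : Integrable f volume) (k : Wave) :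
    Integrable (fun x => mFourier k x • f x) volume := by
  refine hf.bdd_mul (c := 1) ((mFourier k).continuous.aestronglyMeasurable) ?_
  exact Eventually.of_forall fun x => ((mFourier k).norm_coe_le_norm x).trans mFourier_norm.le

lemma coeff_sum {ι : Type*} (s : Finset ι) {F : ι → Torus → ℂ}
    (hF : ∀ i ∈ s, Integrable (F i) volume) (k : Wave) :
    coeff (fun x => ∑ i ∈ s, F i x) k = ∑ i ∈ s, coeff (F i) k := by
  simp only [coeff, mFourierCoeff, Finset.smul_sum]
  exact integral_finsetSum _ fun i hi => integrable_fourier_mul (hF i hi) _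

lemma coeff_fun_sub {f g : Torus → ℂ} (hf : Integrable f volume) (hg : Integrable g volume)
    (k : Wave) : coeff (fun x => f x - g x) k = coeff f k - coeff g k := by
  simp only [coeff, mFourierCoeff, smul_sub]
  exact integral_sub (integrable_fourier_mul hf _) (integrable_fourier_mul hg _)

lemma integrable_advect (u : Fin 3 → L2) (f : L2) : Integrable (advect u f) volume :=
  integrable_finsetSum _ fun i _ => integrable_mul_L2 (u i) (partialD i f)

lemma summable_deriv_coeff {f : L2} (hf : MemH1 f) (i : Fin 3) :
    Summable fun k : Wave => ‖Complex.I * (k i : ℂ) * coeff f k‖ ^ 2 := by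
  refine Summable.of_nonneg_of_le (fun k => by positivity) (fun k => ?_) hf
  rw [norm_mul, norm_mul, Complex.norm_I, one_mul, mul_pow]
  refine mul_le_mul_of_nonneg_right ?_ (by positivity)
  rw [show ‖((k i : ℤ) : ℂ)‖ = |(k i : ℝ)| from by
    rw [← Complex.ofReal_intCast, Complex.norm_real, Real.norm_eq_abs]]
  exact pow_le_pow_left₀ (abs_nonneg _) (abs_coord_le_len k i) 2

lemma coeff_partialD {f : L2} (hf : MemH1 f) (i : Fin 3) (k : Wave) :
    coeff (partialD i f) k = Complex.I * (k i : ℂ) * coeff f k := by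
  rw [partialD, coeff_series (summable_deriv_coeff hf i)]

/-- The advection term in Fourier space. -/
lemma hasSum_coeff_advect (u : Fin 3 → L2) {f : L2} (hf : MemH1 f) (k : Wave) :
    HasSum (fun j => Complex.I * (∑ i, coeff (u i) (k - j) * (j i : ℂ)) * coeff f j)
      (coeff (advect u f) k) := by
  have h1 : coeff (advect u f) k = ∑ i, coeff (fun x => u i x * partialD i f x) k := by
    rw [← coeff_sum Finset.univ fun i _ => integrable_mul_L2 (u i) (partialD i f)]; rfl
  rw [h1]
  have h2 := hasSum_sum (s := (Finset.univ : Finset (Fin 3)))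
    fun i _ => hasSum_coeff_mul (u i) (partialD i f) k
  refine h2.congr_fun fun j => ?_
  simp only [coeff_partialD hf, Finset.mul_sum, Finset.sum_mul]
  exact Finset.sum_congr rfl fun i _ => by ring

end BHT

namespace BHT

/-! ### Sums over the lattice of wave vectors -/

lemma summable_len_rpow {s : ℝ} (hs : s < -3) : Summable fun k : Wave => len k ^ s := by
  let b := (EuclideanSpace.basisFun (Fin 3) ℝ).toBasis
  let L := Submodule.span ℤ (Set.range b)
  have hrank : Module.finrank ℤ L = 3 := by
    rw [ZLattice.rank ℝ L]; simp
  have h := ZLattice.summable_norm_rpow L s (by rw [hrank]; exact_mod_cast hs)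
  have hmem : ∀ k : Wave, toE k ∈ L := by
    intro k
    have : toE k = ∑ i, k i • b i := by
      ext i
      simp [toE, b, Finset.sum_apply, Pi.single_apply]
    rw [this]
    exact Submodule.sum_mem _ fun i _ => Submodule.smul_mem _ _ (Submodule.subset_span ⟨i, rfl⟩)
  have h2 := h.comp_injective (i := fun k : Wave => (⟨toE k, hmem k⟩ : L))
    (fun j k hjk => toE_injective (congrArg Subtype.val hjk))
  refine h2.congr fun k => ?_
  simp [len_eq_norm]

/-- The lattice sum `∑ₖ |k|^s`. -/
noncomputable def latSum (s : ℝ) : ℝ := ∑' k : Wave, len k ^ s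

lemma latSum_nonneg (s : ℝ) : 0 ≤ latSum s := tsum_nonneg fun k => Real.rpow_nonneg (len_nonneg k) _

lemma summable_len_sub_rpow {s : ℝ} (hs : s < -3) (k : Wave) :
    Summable fun j : Wave => len (k - j) ^ s :=
  (summable_len_rpow hs).comp_injective (i := fun j => k - j) fun _ _ h => sub_right_injective h

lemma tsum_len_sub_rpow (s : ℝ) (k : Wave) : ∑' j : Wave, len (k - j) ^ s = latSum s :=
  (Equiv.subLeft k).tsum_eq fun j => len j ^ s

lemma rpow_mul_rpow_le_max {x y p q r : ℝ} (hx : 1 ≤ x) (hy : 1 ≤ y) (hp : p ≤ r) (hq : q ≤ r) :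
    x ^ p * y ^ q ≤ max x y ^ r * (x ^ (p + q - r) + y ^ (p + q - r)) := by
  have hx0 : 0 < x := by linarith
  have hy0 : 0 < y := by linarith
  rcases le_total x y with h | h
  · rw [max_eq_right h]
    calc x ^ p * y ^ q = x ^ p * (y ^ r * y ^ (q - r)) := by
          rw [← Real.rpow_add hy0]; congr 2; ring
      _ ≤ x ^ p * (y ^ r * x ^ (q - r)) := by
          gcongr x ^ p * (y ^ r * ?_)
          exact Real.rpow_le_rpow_of_nonpos hx0 h (by linarith)
      _ = y ^ r * x ^ (p + q - r) := by
          rw [show p + q - r = p + (q - r) by ring, Real.rpow_add hx0]; ring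
      _ ≤ _ := by
          gcongr
          have := Real.rpow_nonneg hy0.le (p + q - r)
          linarith
  · rw [max_eq_left h]
    calc x ^ p * y ^ q = (x ^ r * x ^ (p - r)) * y ^ q := by
          rw [← Real.rpow_add hx0]; congr 2; ring
      _ ≤ (x ^ r * y ^ (p - r)) * y ^ q := by
          gcongr (x ^ r * ?_) * y ^ q
          exact Real.rpow_le_rpow_of_nonpos hy0 h (by linarith)
      _ = x ^ r * y ^ (p + q - r) := by
          rw [show p + q - r = (p - r) + q by ring, Real.rpow_add hy0]; ring
      _ ≤ _ := by
          gcongr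
          have := Real.rpow_nonneg hx0.le (p + q - r)
          linarith

lemma half_len_le_max (k j : Wave) : len k / 2 ≤ max (len (k - j)) (len j) := by
  have h := len_le_add_sub j k
  rcases le_total (len (k - j)) (len j) with h' | h'
  · rw [max_eq_right h']; linarith
  · rw [max_eq_left h']; linarith

/-- The convolution of two powers on the lattice decays like `|k|^r`. -/
lemma conv_rpow_le {p q r : ℝ} (hp : p ≤ r) (hq : q ≤ r) (hr : r < 0) (h : p + q - r < -3)
    {k : Wave} (hk : k ≠ 0) :
    Summable (fun j => len (k - j) ^ p * len j ^ q) ∧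
      ∑' j, len (k - j) ^ p * len j ^ q ≤ 2 ^ (-r) * (2 * latSum (p + q - r)) * len k ^ r := by
  have hs : HasSum (fun j => 2 ^ (-r) * len k ^ r *
      (len (k - j) ^ (p + q - r) + len j ^ (p + q - r)))
      (2 ^ (-r) * len k ^ r * (latSum (p + q - r) + latSum (p + q - r))) := by
    refine HasSum.mul_left _ (HasSum.add ?_ (summable_len_rpow h).hasSum)
    rw [← tsum_len_sub_rpow _ k]
    exact (summable_len_sub_rpow h k).hasSum
  have hle : ∀ j, len (k - j) ^ p * len j ^ q ≤ 2 ^ (-r) * len k ^ r *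
      (len (k - j) ^ (p + q - r) + len j ^ (p + q - r)) := by
    intro j
    have hR : 0 ≤ 2 ^ (-r) * len k ^ r * (len (k - j) ^ (p + q - r) + len j ^ (p + q - r)) := by
      have := len_nonneg k
      have := len_nonneg j
      have := len_nonneg (k - j)
      positivity
    by_cases hj : j = 0
    · subst hj
      rw [len_zero, Real.zero_rpow (by linarith), mul_zero]
      simpa [Real.zero_rpow (show p + q - r ≠ 0 by linarith)] using hR
    by_cases hjk : k - j = 0
    · rw [hjk, len_zero, Real.zero_rpow (by linarith), zero_mul]
      rwa [hjk, len_zero] at hR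
    refine (rpow_mul_rpow_le_max (one_le_len hjk) (one_le_len hj) hp hq).trans ?_
    have h1 : max (len (k - j)) (len j) ^ r ≤ 2 ^ (-r) * len k ^ r := by
      calc max (len (k - j)) (len j) ^ r ≤ (len k / 2) ^ r :=
            Real.rpow_le_rpow_of_nonpos (by have := len_pos hk; positivity)
              (half_len_le_max k j) hr.le
        _ = 2 ^ (-r) * len k ^ r := by
            rw [Real.div_rpow (len_nonneg k) (by norm_num), Real.rpow_neg (by norm_num)]
            field_simp
    refine mul_le_mul_of_nonneg_right h1 ?_
    have := len_nonneg j
    have := len_nonneg (k - j)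
    positivity
  have h0 : ∀ j, 0 ≤ len (k - j) ^ p * len j ^ q := fun j =>
    mul_nonneg (Real.rpow_nonneg (len_nonneg _) _) (Real.rpow_nonneg (len_nonneg _) _)
  have hsum := Summable.of_nonneg_of_le h0 hle hs.summable
  refine ⟨hsum, (hsum.tsum_le_tsum hle hs.summable).trans (le_of_eq ?_)⟩
  rw [hs.tsum_eq]; ring

/-! ### The smallness condition -/

lemma kWeight_le_one (β κg s : ℝ) : kWeight β κg s ≤ 1 := min_le_left _ _

lemma kWeight_pos {β κg s : ℝ} (hκ : 0 < κg) (hs : 0 < s) : 0 < kWeight β κg s := by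
  rw [kWeight]; positivity

lemma kWeight_nonneg {β κg s : ℝ} (hκ : 0 < κg) (hs : 0 ≤ s) : 0 ≤ kWeight β κg s := by
  rw [kWeight]; positivity

lemma rpow_le_kWeight {β κg s : ℝ} (hβ : β ≤ 0) (hκ : 1 ≤ κg) (hs : 1 ≤ s) :
    s ^ β ≤ kWeight β κg s := by
  rw [kWeight, le_min_iff]
  refine ⟨Real.rpow_le_one_of_one_le_of_nonpos hs hβ, ?_⟩
  refine le_mul_of_one_le_left (by positivity) ?_
  exact Real.one_le_rpow (by linarith) (by linarith)

lemma convTerm_eq {β : ℝ} (hβ : β < 0) (κg : ℝ) (k j : Wave) :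
    convTerm β κg k j = len (k - j) ^ β * (len j)⁻¹ * kWeight β κg (len j) := by
  rw [convTerm]
  split_ifs with h
  · rcases h with rfl | rfl
    · simp
    · simp [Real.zero_rpow hβ.ne]
  · rfl

lemma convTerm_nonneg {β κg : ℝ} (hκ : 0 < κg) (k j : Wave) : 0 ≤ convTerm β κg k j := by
  rw [convTerm]
  split_ifs
  · exact le_rfl
  · have := len_nonneg j
    have := len_nonneg (k - j)
    have := kWeight_nonneg (β := β) hκ (len_nonneg j)
    positivity

lemma exists_isConvConst {β κg : ℝ} (hβ : β < -2) (hκ : 16 ≤ κg) : ∃ ϖ, IsConvConst β κg ϖ := by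
  refine ⟨2 ^ (-β) * (2 * latSum (β - 1)), fun k hk => ?_⟩
  have hb : β - 1 < -3 := by linarith
  have hL := len_pos hk
  have hK := (kWeight_pos (β := β) (κg := κg) (by linarith) hL).le
  have hs : HasSum (fun j => 2 ^ (-β) * kWeight β κg (len k) *
      (len (k - j) ^ (β - 1) + len j ^ (β - 1)))
      (2 ^ (-β) * kWeight β κg (len k) * (latSum (β - 1) + latSum (β - 1))) := by
    refine HasSum.mul_left _ (HasSum.add ?_ (summable_len_rpow hb).hasSum)
    rw [← tsum_len_sub_rpow _ k]
    exact (summable_len_sub_rpow hb k).hasSum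
  have hle : ∀ j, convTerm β κg k j ≤ 2 ^ (-β) * kWeight β κg (len k) *
      (len (k - j) ^ (β - 1) + len j ^ (β - 1)) := by
    intro j
    have hR : 0 ≤ 2 ^ (-β) * kWeight β κg (len k) *
        (len (k - j) ^ (β - 1) + len j ^ (β - 1)) := by
      have := len_nonneg j
      have := len_nonneg (k - j)
      positivity
    rw [convTerm]
    split_ifs with h
    · exact hR
    push Not at h
    have hx := one_le_len (sub_ne_zero.mpr (Ne.symm h.2))
    have hy := one_le_len h.1
    set x := len (k - j) with hxdef
    set y := len j with hydef
    have htri : len k ≤ y + x := len_le_add_sub j k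
    have hx0 : 0 < x := by linarith
    have hy0 : 0 < y := by linarith
    have hB : x ^ β * y⁻¹ ≤ x ^ (β - 1) + y ^ (β - 1) := by
      have hX := Real.rpow_nonneg hx0.le (β - 1)
      have hY := Real.rpow_nonneg hy0.le (β - 1)
      rcases le_total x y with hxy | hxy
      · have : x ^ β * y⁻¹ ≤ x ^ β * x⁻¹ := by gcongr
        rw [← div_eq_mul_inv (x ^ β) x, ← Real.rpow_sub_one hx0.ne'] at this
        linarith
      · have : x ^ β * y⁻¹ ≤ y ^ β * y⁻¹ := by
          gcongr ?_ * _
          exact Real.rpow_le_rpow_of_nonpos hy0 hxy (by linarith)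
        rw [← div_eq_mul_inv (y ^ β) y, ← Real.rpow_sub_one hy0.ne'] at this
        linarith
    have h2 : (1 : ℝ) ≤ 2 ^ (-β) := Real.one_le_rpow (by norm_num) (by linarith)
    have hKy0 := (kWeight_pos (β := β) (κg := κg) (by linarith) hy0).le
    have hhalf : ∀ z, len k / 2 ≤ z → z ^ β ≤ 2 ^ (-β) * len k ^ β := by
      intro z hz
      calc z ^ β ≤ (len k / 2) ^ β :=
            Real.rpow_le_rpow_of_nonpos (by positivity) hz (by linarith)
        _ = 2 ^ (-β) * len k ^ β := by
            rw [Real.div_rpow hL.le (by norm_num), Real.rpow_neg (by norm_num)]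
            field_simp
    have hBnn : 0 ≤ x ^ (β - 1) + y ^ (β - 1) := by positivity
    by_cases hyk : len k / 2 ≤ y
    · have h3 : kWeight β κg y ≤ 2 ^ (-β) * kWeight β κg (len k) := by
        simp only [kWeight]
        rw [mul_min_of_nonneg _ _ (by positivity)]
        refine le_min ((min_le_left _ _).trans (by linarith)) ((min_le_right _ _).trans ?_)
        have := hhalf y hyk
        calc (2 * κg) ^ (-β) * y ^ β ≤ (2 * κg) ^ (-β) * (2 ^ (-β) * len k ^ β) := by gcongr
          _ = _ := by ring
      calc x ^ β * y⁻¹ * kWeight β κg y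
          ≤ (x ^ (β - 1) + y ^ (β - 1)) * (2 ^ (-β) * kWeight β κg (len k)) := by gcongr
        _ = _ := by ring
    · have hx2 : len k / 2 ≤ x := by linarith
      have h4 : x ^ β * y⁻¹ * kWeight β κg y ≤ 2 ^ (-β) * 1 * (x ^ (β - 1) + y ^ (β - 1)) := by
        calc x ^ β * y⁻¹ * kWeight β κg y ≤ (x ^ (β - 1) + y ^ (β - 1)) * 1 := by
              gcongr; exact kWeight_le_one _ _ _
          _ ≤ 2 ^ (-β) * (x ^ (β - 1) + y ^ (β - 1)) := by
              rw [mul_one]; exact le_mul_of_one_le_left hBnn h2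
          _ = _ := by ring
      have h5 : x ^ β * y⁻¹ * kWeight β κg y
          ≤ 2 ^ (-β) * ((2 * κg) ^ (-β) * len k ^ β) * (x ^ (β - 1) + y ^ (β - 1)) := by
        calc x ^ β * y⁻¹ * kWeight β κg y
            ≤ (2 ^ (-β) * len k ^ β) * y⁻¹ * ((2 * κg) ^ (-β) * y ^ β) := by
              gcongr
              · exact hhalf x hx2
              · exact min_le_right _ _
          _ = 2 ^ (-β) * ((2 * κg) ^ (-β) * len k ^ β) * y ^ (β - 1) := by
              rw [Real.rpow_sub_one hy0.ne']; ring
          _ ≤ _ := by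
              gcongr
              have := Real.rpow_nonneg hx0.le (β - 1)
              linarith
      rcases min_choice (1 : ℝ) ((2 * κg) ^ (-β) * len k ^ β) with hm | hm
      · rw [kWeight.eq_def β κg (len k), hm]; exact h4
      · rw [kWeight.eq_def β κg (len k), hm]; exact h5
  have hsum := Summable.of_nonneg_of_le (convTerm_nonneg (by linarith) k) hle hs.summable
  refine ⟨hsum, (hsum.tsum_le_tsum hle hs.summable).trans (le_of_eq ?_)⟩
  rw [hs.tsum_eq]; ring

/-- A constant `ϖ` is bounded below in terms of `β` and `κ_g` only. -/
lemma exists_convConst_lower {β κg : ℝ} (hβ : β < -2) (hκ : 16 ≤ κg) :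
    ∃ w > 0, ∀ ϖ, IsConvConst β κg ϖ → w ≤ ϖ := by
  let k₀ : Wave := fun _ => 1
  let j₀ : Wave := fun _ => 2
  have hk : k₀ ≠ 0 := fun h => by simpa [k₀] using congrFun h 0
  have hj : j₀ ≠ 0 := fun h => by simpa [j₀] using congrFun h 0
  have hkj : k₀ - j₀ ≠ 0 := fun h => by simpa [k₀, j₀] using congrFun h 0
  have h1 := len_pos hj
  have h2 := len_pos hkj
  have hKj := kWeight_pos (β := β) (κg := κg) (by linarith) h1
  have hKk := kWeight_pos (β := β) (κg := κg) (by linarith) (len_pos hk)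
  refine ⟨convTerm β κg k₀ j₀ / kWeight β κg (len k₀), ?_, fun ϖ hϖ => ?_⟩
  · rw [convTerm_eq (by linarith)]; positivity
  · rw [div_le_iff₀ hKk]
    obtain ⟨hs, hle⟩ := hϖ k₀ hk
    exact (hs.le_tsum j₀ fun j _ => convTerm_nonneg (by linarith) _ _).trans hle

end BHT

namespace BHT

/-! ### Radial sums over shells -/

lemma abs_rpow_sub_rpow_le {s m a b : ℝ} (hs : s ≤ 1) (hm : 0 < m) (ha : m ≤ a) (hb : m ≤ b) :
    |a ^ s - b ^ s| ≤ |s| * m ^ (s - 1) * |a - b| := by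
  have h := (convex_Ici m).norm_image_sub_le_of_norm_hasDerivWithin_le (f := fun x : ℝ => x ^ s)
    (f' := fun x => s * x ^ (s - 1)) (C := |s| * m ^ (s - 1)) (x := b) (y := a) ?_ ?_ hb ha
  · simpa using h
  · intro x hx
    exact (Real.hasDerivAt_rpow_const (Or.inl (hm.trans_le hx).ne')).hasDerivWithinAt
  · intro x hx
    rw [norm_mul, Real.norm_eq_abs, Real.norm_eq_abs,
      abs_of_nonneg (Real.rpow_nonneg (hm.le.trans hx) _)]
    exact mul_le_mul_of_nonneg_left (Real.rpow_le_rpow_of_nonpos hm hx (by linarith)) (abs_nonneg s)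

/-- The unit cube with lower corner `k`. -/
def cube (k : Wave) : Set (EuclideanSpace ℝ (Fin 3)) := {x | ∀ i, ⌊x i⌋ = k i}

lemma cube_eq_preimage (k : Wave) :
    cube k = WithLp.ofLp ⁻¹' (Set.univ.pi fun i => Set.Ico (k i : ℝ) (k i + 1)) := by
  ext x
  simp [cube, Int.floor_eq_iff]

lemma measurableSet_cube (k : Wave) : MeasurableSet (cube k) := by
  rw [cube_eq_preimage]
  exact (PiLp.volume_preserving_ofLp (Fin 3)).measurable
    (MeasurableSet.univ_pi fun i => measurableSet_Ico)

lemma volume_cube (k : Wave) : volume (cube k) = 1 := by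
  rw [cube_eq_preimage, (PiLp.volume_preserving_ofLp (Fin 3)).measure_preimage
    (MeasurableSet.univ_pi fun i => measurableSet_Ico).nullMeasurableSet, Real.volume_pi_Ico]
  simp

/-- The lower corner of the unit cube that contains `x`. -/
noncomputable def corner (x : EuclideanSpace ℝ (Fin 3)) : Wave := fun i => ⌊x i⌋

lemma mem_cube_iff {k : Wave} {x : EuclideanSpace ℝ (Fin 3)} : x ∈ cube k ↔ corner x = k := by
  simp [cube, corner, funext_iff]

lemma abs_len_corner_sub_norm_le (x : EuclideanSpace ℝ (Fin 3)) : |len (corner x) - ‖x‖| ≤ 2 := by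
  rw [len_eq_norm]
  refine (abs_norm_sub_norm_le _ _).trans ?_
  rw [EuclideanSpace.norm_eq, Real.sqrt_le_left (by norm_num)]
  calc ∑ i, ‖(toE (corner x) - x) i‖ ^ 2 ≤ ∑ _i : Fin 3, (1 : ℝ) := by
        refine Finset.sum_le_sum fun i _ => ?_
        have h1 := Int.floor_le (x i)
        have h2 := Int.lt_floor_add_one (x i)
        simp only [toE, corner, PiLp.sub_apply, Real.norm_eq_abs, sq_abs]
        nlinarith
    _ ≤ 2 ^ 2 := by simp; norm_num

lemma volume_real_ball {r : ℝ} (hr : 0 ≤ r) :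
    (volume : Measure (EuclideanSpace ℝ (Fin 3))).real (Metric.ball 0 r)
      = Real.pi * 4 / 3 * r ^ 3 := by
  rw [Measure.real, EuclideanSpace.volume_ball_fin_three, ENNReal.toReal_mul, ENNReal.toReal_pow,
    ENNReal.toReal_ofReal hr, ENNReal.toReal_ofReal (by positivity)]
  ring

lemma volume_real_closedBall_diff_ball {a b : ℝ} (ha : 0 ≤ a) (hab : a ≤ b) :
    (volume : Measure (EuclideanSpace ℝ (Fin 3))).real (Metric.closedBall 0 b \ Metric.ball 0 a)
      = Real.pi * 4 / 3 * (b ^ 3 - a ^ 3) := by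
  rw [measureReal_sdiff (Metric.ball_subset_closedBall.trans (Metric.closedBall_subset_closedBall hab))
    Metric.isOpen_ball.measurableSet measure_closedBall_lt_top.ne,
    Measure.addHaar_real_closedBall_eq_addHaar_real_ball,
    volume_real_ball ha, volume_real_ball (ha.trans hab)]
  ring

lemma integral_shell_rpow {s κ : ℝ} (hκ : 0 < κ) (hs : s ≠ -3) :
    Integrable (fun x : EuclideanSpace ℝ (Fin 3) =>
      (Set.Ico κ (2 * κ)).indicator (fun r => r ^ s) ‖x‖) ∧
    ∫ x : EuclideanSpace ℝ (Fin 3), (Set.Ico κ (2 * κ)).indicator (fun r => r ^ s) ‖x‖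
      = 4 * Real.pi * κ ^ (s + 3) * i₂ (s + 3) := by
  have hcont : ContinuousOn (fun r : ℝ => r ^ s) (Set.Icc κ (2 * κ)) := fun x hx =>
    (Real.continuousAt_rpow_const x s (Or.inl (hκ.trans_le hx.1).ne')).continuousWithinAt
  constructor
  · obtain ⟨C, hC⟩ := isCompact_Icc.exists_bound_of_continuousOn hcont
    have hmeas : Measurable (fun x : EuclideanSpace ℝ (Fin 3) =>
        (Set.Ico κ (2 * κ)).indicator (fun r => r ^ s) ‖x‖) :=
      ((measurable_id.pow_const s).indicator measurableSet_Ico).comp measurable_norm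
    have hI : Integrable ((Metric.ball (0 : EuclideanSpace ℝ (Fin 3)) (2 * κ)).indicator
        fun _ => C) := by
      refine (integrable_indicator_iff Metric.isOpen_ball.measurableSet).mpr ?_
      exact integrableOn_const (by finiteness) (by finiteness)
    refine hI.mono' hmeas.aestronglyMeasurable (Eventually.of_forall fun x => ?_)
    by_cases hx : ‖x‖ ∈ Set.Ico κ (2 * κ)
    · rw [Set.indicator_of_mem hx, Set.indicator_of_mem (by simpa using hx.2)]
      exact hC _ ⟨hx.1, hx.2.le⟩
    · rw [Set.indicator_of_notMem hx, norm_zero]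
      refine Set.indicator_nonneg (fun _ _ => ?_) _
      exact (norm_nonneg _).trans (hC κ ⟨le_rfl, by linarith⟩)
  · rw [integral_fun_norm_addHaar volume ((Set.Ico κ (2 * κ)).indicator fun r => r ^ s)]
    simp only [finrank_euclideanSpace, Fintype.card_fin]
    rw [volume_real_ball zero_le_one]
    have h1 : ∀ y : ℝ, y ^ (3 - 1) • (Set.Ico κ (2 * κ)).indicator (fun r => r ^ s) y
        = (Set.Ico κ (2 * κ)).indicator (fun r => r ^ (s + 2)) y := by
      intro y
      by_cases hy : y ∈ Set.Ico κ (2 * κ)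
      · rw [Set.indicator_of_mem hy, Set.indicator_of_mem hy,
          Real.rpow_add (hκ.trans_le hy.1)]
        simp [mul_comm]
      · simp [Set.indicator_of_notMem hy]
    simp only [h1]
    have h2 : Set.Ico κ (2 * κ) ⊆ Set.Ioi 0 := fun y hy => hκ.trans_le hy.1
    rw [setIntegral_indicator measurableSet_Ico, Set.inter_eq_self_of_subset_right h2,
      integral_Ico_eq_integral_Ioc,
      ← intervalIntegral.integral_of_le (by linarith), integral_rpow]
    · rw [i₂, show s + 2 + 1 = s + 3 by ring, Real.mul_rpow (by norm_num) hκ.le]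
      simp only [nsmul_eq_mul, smul_eq_mul]
      push_cast
      ring
    · right
      refine ⟨by contrapose! hs; linarith, ?_⟩
      rw [Set.uIcc_of_le (by linarith)]
      exact fun h => absurd h.1 (by linarith)

/-- Lattice points are equidistributed well enough for radial powers on a shell: the sum is the
integral up to a relative error `O(1/κ)`. -/
lemma abs_sum_shell_rpow_sub_le {s κ : ℝ} (hs : s < -3) (hκ : 2 ≤ κ) :
    |∑ k ∈ shell κ (2 * κ), len k ^ s - 4 * Real.pi * κ ^ (s + 3) * i₂ (s + 3)|
      ≤ Real.pi * 4 / 3 * (16 * |s| + 68) * κ ^ (s + 2) := by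
  have hκ0 : 0 < κ := by linarith
  obtain ⟨hint, hval⟩ := integral_shell_rpow hκ0 (s := s) (by linarith)
  set F : ℝ → ℝ := (Set.Ico κ (2 * κ)).indicator (fun r => r ^ s) with hF
  let G : EuclideanSpace ℝ (Fin 3) → ℝ := fun x =>
    ∑ k ∈ shell κ (2 * κ), (cube k).indicator (fun _ => len k ^ s) x
  have hGi : ∀ k ∈ shell κ (2 * κ),
      Integrable (fun x => (cube k).indicator (fun _ => len k ^ s) x) := fun k _ =>
    (integrable_indicator_iff (measurableSet_cube k)).mpr
      (integrableOn_const (by rw [volume_cube]; finiteness) (by finiteness))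
  have hG : Integrable G := integrable_finsetSum _ hGi
  have hGval : ∫ x, G x = ∑ k ∈ shell κ (2 * κ), len k ^ s := by
    rw [integral_finsetSum _ hGi]
    refine Finset.sum_congr rfl fun k _ => ?_
    rw [integral_indicator_const _ (measurableSet_cube k), Measure.real, volume_cube]
    simp
  have hGF : ∀ x, G x = F (len (corner x)) := by
    intro x
    have h0 : ∀ k ∈ shell κ (2 * κ), k ≠ corner x →
        (cube k).indicator (fun _ => len k ^ s) x = 0 := fun k _ hk =>
      Set.indicator_of_notMem (fun h => hk (mem_cube_iff.mp h).symm) _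
    by_cases hx : corner x ∈ shell κ (2 * κ)
    · rw [hF, Set.indicator_of_mem (show _ ∈ Set.Ico κ (2 * κ) from mem_shell.mp hx)]
      change ∑ k ∈ shell κ (2 * κ), _ = _
      rw [Finset.sum_eq_single_of_mem (corner x) hx h0, Set.indicator_of_mem (mem_cube_iff.mpr rfl)]
    · rw [hF, Set.indicator_of_notMem
        (show _ ∉ Set.Ico κ (2 * κ) from fun h => hx (mem_shell.mpr h))]
      exact Finset.sum_eq_zero fun k hk => h0 k hk fun h => hx (h ▸ hk)
  let A₀ : Set (EuclideanSpace ℝ (Fin 3)) := Metric.ball 0 (2 * κ)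
  let A₁ : Set (EuclideanSpace ℝ (Fin 3)) := Metric.closedBall 0 (κ + 2) \ Metric.ball 0 (κ - 2)
  let A₂ : Set (EuclideanSpace ℝ (Fin 3)) :=
    Metric.closedBall 0 (2 * κ + 2) \ Metric.ball 0 (2 * κ - 2)
  have mA₀ : MeasurableSet A₀ := Metric.isOpen_ball.measurableSet
  have mA₁ : MeasurableSet A₁ :=
    Metric.isClosed_closedBall.measurableSet.diff Metric.isOpen_ball.measurableSet
  have mA₂ : MeasurableSet A₂ :=
    Metric.isClosed_closedBall.measurableSet.diff Metric.isOpen_ball.measurableSet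
  let H : EuclideanSpace ℝ (Fin 3) → ℝ := fun x =>
    A₀.indicator (fun _ => |s| * κ ^ (s - 1) * 2) x + A₁.indicator (fun _ => κ ^ s) x
      + A₂.indicator (fun _ => κ ^ s) x
  have fin₁ : volume A₁ ≠ ∞ :=
    ((measure_mono Set.sdiff_subset).trans_lt measure_closedBall_lt_top).ne
  have fin₂ : volume A₂ ≠ ∞ :=
    ((measure_mono Set.sdiff_subset).trans_lt measure_closedBall_lt_top).ne
  have i₀ : Integrable (A₀.indicator fun _ => |s| * κ ^ (s - 1) * 2) :=
    (integrable_indicator_iff mA₀).mpr (integrableOn_const measure_ball_lt_top.ne (by finiteness))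
  have i₁ : Integrable (A₁.indicator fun _ => κ ^ s) :=
    (integrable_indicator_iff mA₁).mpr (integrableOn_const fin₁ (by finiteness))
  have i₂' : Integrable (A₂.indicator fun _ => κ ^ s) :=
    (integrable_indicator_iff mA₂).mpr (integrableOn_const fin₂ (by finiteness))
  have hHi : Integrable H := (i₀.add i₁).add i₂'
  have hHval : ∫ x, H x = Real.pi * 4 / 3 * (|s| * κ ^ (s - 1) * 2 * (2 * κ) ^ 3
      + κ ^ s * ((κ + 2) ^ 3 - (κ - 2) ^ 3) + κ ^ s * ((2 * κ + 2) ^ 3 - (2 * κ - 2) ^ 3)) := by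
    have e1 : ∫ x, H x = ∫ x, (A₀.indicator (fun _ => |s| * κ ^ (s - 1) * 2) x
      + A₁.indicator (fun _ => κ ^ s) x) + A₂.indicator (fun _ => κ ^ s) x := rfl
    have e2 := integral_add (i₀.add i₁) i₂'
    simp only [Pi.add_apply] at e2
    rw [e1, e2, integral_add i₀ i₁, integral_indicator_const _ mA₀,
      integral_indicator_const _ mA₁, integral_indicator_const _ mA₂,
      volume_real_ball (by linarith), volume_real_closedBall_diff_ball (by linarith) (by linarith),
      volume_real_closedBall_diff_ball (by linarith) (by linarith)]
    simp only [smul_eq_mul]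
    ring
  have hle : ∀ x, ‖G x - F ‖x‖‖ ≤ H x := by
    intro x
    rw [hGF, Real.norm_eq_abs]
    have hd := abs_le.mp (abs_len_corner_sub_norm_le x)
    set a := len (corner x)
    set b := ‖x‖ with hb
    have n₀ : 0 ≤ A₀.indicator (fun _ => |s| * κ ^ (s - 1) * 2) x :=
      Set.indicator_nonneg (fun _ _ => by positivity) _
    have n₁ : 0 ≤ A₁.indicator (fun _ => κ ^ s) x :=
      Set.indicator_nonneg (fun _ _ => by positivity) _
    have n₂ : 0 ≤ A₂.indicator (fun _ => κ ^ s) x :=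
      Set.indicator_nonneg (fun _ _ => by positivity) _
    have hpow : ∀ z, κ ≤ z → |z ^ s| ≤ κ ^ s := fun z hz => by
      rw [abs_of_nonneg (Real.rpow_nonneg (hκ0.le.trans hz) _)]
      exact Real.rpow_le_rpow_of_nonpos hκ0 hz (by linarith)
    -- `x` lies near the boundary of the shell if exactly one of `x` and its corner is in the shell
    have hnear : (b ≤ κ + 2 ∧ κ - 2 ≤ b) ∨ (b ≤ 2 * κ + 2 ∧ 2 * κ - 2 ≤ b) →
        κ ^ s ≤ H x := by
      rintro (h | h)
      · have : x ∈ A₁ := by simpa [A₁, hb] using h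
        have e := Set.indicator_of_mem this (fun _ => κ ^ s)
        simp only [H]; linarith
      · have : x ∈ A₂ := by simpa [A₂, hb] using h
        have e := Set.indicator_of_mem this (fun _ => κ ^ s)
        simp only [H]; linarith
    by_cases ha : a ∈ Set.Ico κ (2 * κ) <;> by_cases hbI : b ∈ Set.Ico κ (2 * κ)
    · rw [hF, Set.indicator_of_mem ha, Set.indicator_of_mem hbI]
      have h1 := abs_rpow_sub_rpow_le (s := s) (by linarith) hκ0 ha.1 hbI.1
      have h2 : |s| * κ ^ (s - 1) * |a - b| ≤ |s| * κ ^ (s - 1) * 2 := by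
        gcongr; exact abs_le.mpr hd
      have : x ∈ A₀ := by simpa [A₀, hb] using hbI.2
      have e := Set.indicator_of_mem this (fun _ => |s| * κ ^ (s - 1) * 2)
      simp only [H]; linarith
    · rw [hF, Set.indicator_of_mem ha, Set.indicator_of_notMem hbI, sub_zero]
      refine (hpow _ ha.1).trans (hnear ?_)
      simp only [Set.mem_Ico, not_and_or, not_le, not_lt] at hbI
      rcases hbI with h | h
      · left; constructor <;> linarith [ha.1]
      · right; constructor <;> linarith [ha.2]
    · rw [hF, Set.indicator_of_notMem ha, Set.indicator_of_mem hbI, zero_sub, abs_neg]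
      refine (hpow _ hbI.1).trans (hnear ?_)
      simp only [Set.mem_Ico, not_and_or, not_le, not_lt] at ha
      rcases ha with h | h
      · left; constructor <;> linarith [hbI.1]
      · right; constructor <;> linarith [hbI.2]
    · rw [hF, Set.indicator_of_notMem ha, Set.indicator_of_notMem hbI, sub_zero, abs_zero]
      simp only [H]; linarith
  rw [← hval, ← hGval, ← integral_sub hG hint, ← Real.norm_eq_abs]
  refine (norm_integral_le_of_norm_le hHi (Eventually.of_forall hle)).trans ?_
  rw [hHval, mul_assoc (Real.pi * 4 / 3)]
  refine mul_le_mul_of_nonneg_left ?_ (by positivity)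
  have e1 : κ ^ (s - 1) = κ ^ (s + 2) / κ ^ 3 := by
    rw [show s - 1 = s + 2 - (3 : ℕ) by push_cast; ring, Real.rpow_sub_natCast hκ0.ne']
  have e2 : κ ^ s = κ ^ (s + 2) / κ ^ 2 := by
    rw [show s = s + 2 - (2 : ℕ) by push_cast; ring, Real.rpow_sub_natCast hκ0.ne']
    ring_nf
  rw [e1, e2]
  have hp : 0 < κ ^ (s + 2) := by positivity
  have hκ2 : κ ^ 2 ≥ 4 := by nlinarith
  calc |s| * (κ ^ (s + 2) / κ ^ 3) * 2 * (2 * κ) ^ 3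
        + κ ^ (s + 2) / κ ^ 2 * ((κ + 2) ^ 3 - (κ - 2) ^ 3)
        + κ ^ (s + 2) / κ ^ 2 * ((2 * κ + 2) ^ 3 - (2 * κ - 2) ^ 3)
      = κ ^ (s + 2) * (16 * |s| + (60 + 32 / κ ^ 2)) := by field_simp; ring
    _ ≤ κ ^ (s + 2) * (16 * |s| + 68) := by
        gcongr
        have : 32 / κ ^ 2 ≤ 8 := by
          rw [div_le_iff₀ (by positivity)]; linarith
        linarith
    _ = _ := by ring

end BHT

namespace BHT

/-! ### Symmetry of the shells -/

/-- The inner product of two wave vectors. -/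
def dotW (j k : Wave) : ℝ := ∑ i, (j i : ℝ) * k i

lemma sum_shell_comp {a b : ℝ} (e : Wave ≃ Wave) (he : ∀ k, len (e k) = len k) (F : Wave → ℝ) :
    ∑ k ∈ shell a b, F (e k) = ∑ k ∈ shell a b, F k :=
  Finset.sum_equiv e (fun k => by simp [he]) fun _ _ => rfl

/-- The reflection of the `i`-th coordinate. -/
def reflect (i : Fin 3) : Wave ≃ Wave :=
  Function.Involutive.toPerm (fun k l => if l = i then -k l else k l) fun k => by
    funext l; by_cases h : l = i <;> simp [h]

lemma reflect_apply (i l : Fin 3) (k : Wave) : reflect i k l = if l = i then -k l else k l := rfl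

lemma len_reflect (i : Fin 3) (k : Wave) : len (reflect i k) = len k := by
  rw [len, len]
  congr 1
  refine Finset.sum_congr rfl fun l _ => ?_
  rw [reflect_apply]
  split_ifs <;> simp

lemma sum_shell_cross (a b : ℝ) (h : ℝ → ℝ) {i l : Fin 3} (hil : i ≠ l) :
    ∑ k ∈ shell a b, h (len k) * ((k i : ℝ) * k l) = 0 := by
  have := sum_shell_comp (a := a) (b := b) (reflect i) (len_reflect i)
    fun k => h (len k) * ((k i : ℝ) * k l)
  have e : ∀ k : Wave, h (len (reflect i k)) * ((reflect i k i : ℝ) * (reflect i k l : ℤ))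
      = -(h (len k) * ((k i : ℝ) * k l)) := by
    intro k
    rw [len_reflect, reflect_apply, reflect_apply, if_pos rfl, if_neg hil.symm]
    push_cast; ring
  simp only [e, Finset.sum_neg_distrib] at this
  linarith

lemma sum_shell_coord_sq (a b : ℝ) (h : ℝ → ℝ) (i l : Fin 3) :
    ∑ k ∈ shell a b, h (len k) * (k i : ℝ) ^ 2 = ∑ k ∈ shell a b, h (len k) * (k l : ℝ) ^ 2 := by
  have hlen : ∀ k : Wave, len ((Equiv.arrowCongr (Equiv.swap i l) (Equiv.refl ℤ)) k) = len k := by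
    intro k
    rw [len, len]
    congr 1
    exact Equiv.sum_comp (Equiv.swap i l).symm fun m => (k m : ℝ) ^ 2
  have := sum_shell_comp (a := a) (b := b) (Equiv.arrowCongr (Equiv.swap i l) (Equiv.refl ℤ))
    hlen fun k => h (len k) * (k l : ℝ) ^ 2
  rw [← this]
  refine Finset.sum_congr rfl fun k _ => ?_
  rw [hlen]
  simp [Equiv.arrowCongr]

/-- By the cubic symmetry of a shell, the quadratic form `(j · k)²` averages to `|j|² |k|² / 3`. -/
lemma sum_shell_dotW_sq (a b : ℝ) (h : ℝ → ℝ) (j : Wave) :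
    ∑ k ∈ shell a b, h (len k) * dotW j k ^ 2
      = len j ^ 2 / 3 * ∑ k ∈ shell a b, h (len k) * len k ^ 2 := by
  have c01 := sum_shell_cross a b h (show (0 : Fin 3) ≠ 1 by decide)
  have c02 := sum_shell_cross a b h (show (0 : Fin 3) ≠ 2 by decide)
  have c12 := sum_shell_cross a b h (show (1 : Fin 3) ≠ 2 by decide)
  have d01 := sum_shell_coord_sq a b h 0 1
  have d02 := sum_shell_coord_sq a b h 0 2
  have e1 : ∑ k ∈ shell a b, h (len k) * dotW j k ^ 2
      = (j 0 : ℝ) ^ 2 * ∑ k ∈ shell a b, h (len k) * (k 0 : ℝ) ^ 2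
        + (j 1 : ℝ) ^ 2 * ∑ k ∈ shell a b, h (len k) * (k 1 : ℝ) ^ 2
        + (j 2 : ℝ) ^ 2 * ∑ k ∈ shell a b, h (len k) * (k 2 : ℝ) ^ 2
        + 2 * (j 0 : ℝ) * j 1 * ∑ k ∈ shell a b, h (len k) * ((k 0 : ℝ) * k 1)
        + 2 * (j 0 : ℝ) * j 2 * ∑ k ∈ shell a b, h (len k) * ((k 0 : ℝ) * k 2)
        + 2 * (j 1 : ℝ) * j 2 * ∑ k ∈ shell a b, h (len k) * ((k 1 : ℝ) * k 2) := by
    simp only [Finset.mul_sum, ← Finset.sum_add_distrib]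
    refine Finset.sum_congr rfl fun k _ => ?_
    rw [dotW, Fin.sum_univ_three]; ring
  have e2 : ∑ k ∈ shell a b, h (len k) * len k ^ 2
      = ∑ k ∈ shell a b, h (len k) * (k 0 : ℝ) ^ 2 + ∑ k ∈ shell a b, h (len k) * (k 1 : ℝ) ^ 2
        + ∑ k ∈ shell a b, h (len k) * (k 2 : ℝ) ^ 2 := by
    simp only [← Finset.sum_add_distrib]
    refine Finset.sum_congr rfl fun k _ => ?_
    rw [len_sq']; ring
  rw [e1, e2, c01, c02, c12, ← d01, ← d02, len_sq']
  ring

/-! ### The Craya–Herring basis -/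

/-- `j · e_m`. -/
noncomputable def edot (j m : Wave) : ℝ := ∑ i, (j i : ℝ) * eVec m i

/-- `j · f_m`. -/
noncomputable def fdot (j m : Wave) : ℝ := ∑ i, (j i : ℝ) * fVec m i

lemma lenH_sq (k : Wave) : lenH k ^ 2 = (k 0 : ℝ) ^ 2 + (k 1 : ℝ) ^ 2 :=
  Real.sq_sqrt (by positivity)

lemma lenH_ne_zero {k : Wave} (h : ¬(k 0 = 0 ∧ k 1 = 0)) : lenH k ≠ 0 := by
  intro h0
  have h1 := lenH_sq k
  rw [h0] at h1
  apply h
  have a0 : (k 0 : ℝ) ^ 2 = 0 := by nlinarith [sq_nonneg (k 0 : ℝ), sq_nonneg (k 1 : ℝ)]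
  have a1 : (k 1 : ℝ) ^ 2 = 0 := by nlinarith [sq_nonneg (k 0 : ℝ), sq_nonneg (k 1 : ℝ)]
  exact ⟨by exact_mod_cast pow_eq_zero_iff (two_ne_zero) |>.mp a0,
    by exact_mod_cast pow_eq_zero_iff (two_ne_zero) |>.mp a1⟩

lemma edot_self (k : Wave) : edot k k = 0 := by
  rw [edot, Fin.sum_univ_three, eVec]
  split_ifs with h
  · simp [h.1, h.2]
  · simp; ring

lemma fdot_self (k : Wave) : fdot k k = 0 := by
  rw [fdot, Fin.sum_univ_three, fVec]
  split_ifs with h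
  · simp [h.1, h.2]
  · simp [lenH_sq]; ring

lemma edot_add (j k m : Wave) : edot (j + k) m = edot j m + edot k m := by
  simp [edot, add_mul, Finset.sum_add_distrib]

lemma fdot_add (j k m : Wave) : fdot (j + k) m = fdot j m + fdot k m := by
  simp [fdot, add_mul, Finset.sum_add_distrib]

lemma edot_neg_left (j m : Wave) : edot (-j) m = -edot j m := by simp [edot]

lemma fdot_neg_left (j m : Wave) : fdot (-j) m = -fdot j m := by simp [fdot]

lemma lenH_neg (k : Wave) : lenH (-k) = lenH k := by simp [lenH]

lemma eVec_neg (k : Wave) (i : Fin 3) : eVec (-k) i = -eVec k i := by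
  by_cases h : k 0 = 0 ∧ k 1 = 0
  · fin_cases i <;> simp [eVec, h, Int.sign_neg]
  · fin_cases i <;> simp [eVec, h, lenH_neg] <;> ring

lemma fVec_neg (k : Wave) (i : Fin 3) : fVec (-k) i = fVec k i := by
  by_cases h : k 0 = 0 ∧ k 1 = 0
  · fin_cases i <;> simp [fVec, h]
  · fin_cases i <;> simp [fVec, h, lenH_neg]

lemma edot_neg_right (j m : Wave) : edot j (-m) = -edot j m := by simp [edot, eVec_neg]

lemma fdot_neg_right (j m : Wave) : fdot j (-m) = fdot j m := by simp [fdot, fVec_neg]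

/-- `e_m`, `f_m` and `m / |m|` form an orthonormal basis. -/
lemma edot_sq_add_fdot_sq (j : Wave) {m : Wave} (hm : m ≠ 0) :
    (edot j m ^ 2 + fdot j m ^ 2) * len m ^ 2 = len j ^ 2 * len m ^ 2 - dotW j m ^ 2 := by
  by_cases h : m 0 = 0 ∧ m 1 = 0
  · have h2 : m 2 ≠ 0 := fun h2 => hm (by funext i; fin_cases i <;> simp [h.1, h.2, h2])
    have hs : ((m 2).sign : ℝ) ^ 2 = 1 := by
      rcases lt_or_gt_of_ne h2 with h3 | h3
      · rw [Int.sign_eq_neg_one_of_neg h3]; norm_num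
      · rw [Int.sign_eq_one_of_pos h3]; norm_num
    have he : edot j m ^ 2 = (j 1 : ℝ) ^ 2 := by
      rw [edot, Fin.sum_univ_three, eVec, if_pos h]
      simp [mul_pow, hs]
    have hf : fdot j m ^ 2 = (j 0 : ℝ) ^ 2 := by
      rw [fdot, Fin.sum_univ_three, fVec, if_pos h]
      simp
    rw [he, hf, len_sq', len_sq', dotW, Fin.sum_univ_three, h.1, h.2]
    simp; ring
  · have hH := lenH_ne_zero h
    have hL := (len_pos hm).ne'
    have he : edot j m = ((j 0 : ℝ) * m 1 - j 1 * m 0) / lenH m := by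
      rw [edot, Fin.sum_univ_three, eVec, if_neg h]
      simp; ring
    have hf : fdot j m = ((j 0 : ℝ) * m 0 * m 2 + j 1 * m 1 * m 2 - j 2 * lenH m ^ 2)
        / (len m * lenH m) := by
      rw [fdot, Fin.sum_univ_three, fVec, if_neg h]
      simp; ring
    rw [he, hf, div_pow, div_pow, mul_pow, add_mul, div_mul_eq_mul_div, div_mul_eq_mul_div,
      mul_comm (_ ^ 2) (len m ^ 2), mul_comm (_ ^ 2) (len m ^ 2),
      mul_div_mul_left _ _ (pow_ne_zero 2 hL), ← add_div, div_eq_iff (pow_ne_zero 2 hH)]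
    rw [lenH_sq, len_sq', len_sq', dotW, Fin.sum_univ_three]
    ring

lemma edot_fdot_sq_le (j : Wave) {m : Wave} (hm : m ≠ 0) :
    edot j m ^ 2 + fdot j m ^ 2 ≤ len j ^ 2 := by
  have h := edot_sq_add_fdot_sq j hm
  have hL : 0 < len m ^ 2 := pow_pos (len_pos hm) 2
  have : (edot j m ^ 2 + fdot j m ^ 2) * len m ^ 2 ≤ len j ^ 2 * len m ^ 2 := by
    rw [h]; nlinarith [sq_nonneg (dotW j m)]
  exact le_of_mul_le_mul_right this hL

lemma abs_edot_le (j : Wave) {m : Wave} (hm : m ≠ 0) : |edot j m| ≤ len j :=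
  abs_le_of_sq_le_sq (by nlinarith [edot_fdot_sq_le j hm, sq_nonneg (fdot j m)]) (len_nonneg j)

lemma abs_fdot_le (j : Wave) {m : Wave} (hm : m ≠ 0) : |fdot j m| ≤ len j :=
  abs_le_of_sq_le_sq (by nlinarith [edot_fdot_sq_le j hm, sq_nonneg (edot j m)]) (len_nonneg j)

/-! ### Advection in Fourier space -/

/-- `j · û_m`, the component along `j` of the velocity mode with wave vector `m`. It vanishes for
`m = 0`, as `0 ^ β = 0`. -/
noncomputable def modeAdv (β U : ℝ) (V W : Wave → ℂ) (j m : Wave) : ℂ :=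
  ((U * len m ^ β : ℝ) : ℂ) * ((edot j m : ℂ) * V m + (fdot j m : ℂ) * W m)

section Modes

variable {β U Ξ : ℝ} {V W : Wave → ℂ}

lemma modeAdv_zero (hβ : β < -2) (j : Wave) : modeAdv β U V W j 0 = 0 := by
  simp [modeAdv, Real.zero_rpow (show β ≠ 0 by linarith)]

/-- Incompressibility: `j · û_{k-j} = k · û_{k-j}`. -/
lemma modeAdv_sub (j k : Wave) : modeAdv β U V W j (k - j) = modeAdv β U V W k (k - j) := by
  have h : k = j + (k - j) := by abel
  conv_rhs => rw [modeAdv, h]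
  rw [add_sub_cancel_left, edot_add, fdot_add, edot_self, fdot_self, add_zero, add_zero, modeAdv]

lemma modeAdv_neg (hV : ∀ k ≠ 0, V (-k) = -conj (V k)) (hW : ∀ k ≠ 0, W (-k) = conj (W k))
    (hβ : β < -2) (j m : Wave) :
    modeAdv β U V W (-j) (-m) = -conj (modeAdv β U V W j m) := by
  by_cases hm : m = 0
  · subst hm; simp [modeAdv_zero hβ]
  · rw [modeAdv, modeAdv, hV m hm, hW m hm, len_neg, edot_neg_left, edot_neg_right, fdot_neg_left,
      fdot_neg_right]
    simp only [map_mul, map_add, Complex.conj_ofReal]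
    push_cast; ring

lemma norm_modeAdv_le (hβ : β < -2) (hU : 0 ≤ U) (hV : ∀ k ≠ 0, ‖V k‖ ≤ Ξ)
    (hW : ∀ k ≠ 0, ‖W k‖ ≤ Ξ) (j m : Wave) :
    ‖modeAdv β U V W j m‖ ≤ 2 * U * Ξ * len m ^ β * len j := by
  by_cases hm : m = 0
  · subst hm; simp [modeAdv_zero hβ, Real.zero_rpow (show β ≠ 0 by linarith)]
  · have hL := Real.rpow_nonneg (len_nonneg m) β
    have hj := len_nonneg j
    have hΞ : 0 ≤ Ξ := (norm_nonneg _).trans (hV m hm)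
    rw [modeAdv, norm_mul, Complex.norm_real, Real.norm_eq_abs, abs_of_nonneg (by positivity)]
    calc U * len m ^ β * ‖(edot j m : ℂ) * V m + (fdot j m : ℂ) * W m‖
        ≤ U * len m ^ β * (len j * Ξ + len j * Ξ) := by
          gcongr
          refine (norm_add_le _ _).trans (add_le_add ?_ ?_)
          · rw [norm_mul, Complex.norm_real, Real.norm_eq_abs]
            exact mul_le_mul (abs_edot_le j hm) (hV m hm) (norm_nonneg _) hj
          · rw [norm_mul, Complex.norm_real, Real.norm_eq_abs]
            exact mul_le_mul (abs_fdot_le j hm) (hW m hm) (norm_nonneg _) hj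
      _ = _ := by ring

lemma norm_modeAdv_sub_le (hβ : β < -2) (hU : 0 ≤ U) (hV : ∀ k ≠ 0, ‖V k‖ ≤ Ξ)
    (hW : ∀ k ≠ 0, ‖W k‖ ≤ Ξ) (j k : Wave) :
    ‖modeAdv β U V W j (k - j)‖ ≤ 2 * U * Ξ * len (k - j) ^ β * len k := by
  rw [modeAdv_sub]; exact norm_modeAdv_le hβ hU hV hW _ _

end Modes

end BHT

namespace BHT

/-! ### The transport operator -/

/-- Values of the velocity modes that are bounded by `Ξ` and make the velocity real. -/
structure IsBoundedModes (Ξ : ℝ) (V W : Wave → ℂ) : Prop where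
  boundV : ∀ k ≠ 0, ‖V k‖ ≤ Ξ
  boundW : ∀ k ≠ 0, ‖W k‖ ≤ Ξ
  realV : ∀ k ≠ 0, V (-k) = -conj (V k)
  realW : ∀ k ≠ 0, W (-k) = conj (W k)

lemma IsBoundedModes.nonneg {Ξ : ℝ} {V W : Wave → ℂ} (h : IsBoundedModes Ξ V W) : 0 ≤ Ξ := by
  have h1 : (fun _ => 1 : Wave) ≠ 0 := fun h => by simpa using congrFun h 0
  exact (norm_nonneg _).trans (h.boundV _ h1)

/-- The operator `θ ↦ Δ⁻¹ (u · ∇θ)` in Fourier space. -/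
noncomputable def transport (β U : ℝ) (V W : Wave → ℂ) (c : Wave → ℂ) (k : Wave) : ℂ :=
  if k = 0 then 0 else
    -((∑' j, Complex.I * modeAdv β U V W j (k - j) * c j) / ((len k ^ 2 : ℝ) : ℂ))

/-- The weight `K_β(|k|) / |k|`, which controls the solution; it vanishes at `k = 0`. -/
noncomputable def wgt (β κg : ℝ) (k : Wave) : ℝ := kWeight β κg (len k) * (len k)⁻¹

lemma wgt_nonneg {β κg : ℝ} (hκ : 16 ≤ κg) (k : Wave) : 0 ≤ wgt β κg k := by
  have := len_nonneg k
  have := kWeight_nonneg (β := β) (κg := κg) (by linarith) this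
  rw [wgt]; positivity

lemma wgt_le {β κg : ℝ} {k : Wave} (hk : k ≠ 0) :
    wgt β κg k ≤ (2 * κg) ^ (-β) * len k ^ (β - 1) := by
  have := len_pos hk
  rw [wgt, Real.rpow_sub_one this.ne', div_eq_mul_inv, ← mul_assoc]
  gcongr
  exact min_le_right _ _

section Transport

variable {β U Ξ κg ϖ : ℝ} {V W : Wave → ℂ}

lemma norm_transport_le_tsum {c : Wave → ℂ} {b : Wave → ℝ} {k : Wave} (hk : k ≠ 0)
    (hb : Summable b) (h : ∀ j, ‖Complex.I * modeAdv β U V W j (k - j) * c j‖ ≤ b j) :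
    ‖transport β U V W c k‖ ≤ (∑' j, b j) / len k ^ 2 := by
  rw [transport, if_neg hk, norm_neg, norm_div, Complex.norm_real, Real.norm_eq_abs,
    abs_of_nonneg (sq_nonneg _)]
  gcongr
  exact tsum_of_norm_bounded hb.hasSum h

lemma transport_term_le (hβ : β < -2) (hU : 0 ≤ U) (hM : IsBoundedModes Ξ V W) {c : Wave → ℂ}
    {N : ℝ} (hc : ∀ j, ‖c j‖ ≤ N * wgt β κg j) (k j : Wave) :
    ‖Complex.I * modeAdv β U V W j (k - j) * c j‖
      ≤ 2 * U * Ξ * N * len k * convTerm β κg k j := by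
  rw [norm_mul, norm_mul, Complex.norm_I, one_mul]
  have hΞ := hM.nonneg
  have h1 := len_nonneg k
  have h2 := Real.rpow_nonneg (len_nonneg (k - j)) β
  calc _ ≤ (2 * U * Ξ * len (k - j) ^ β * len k) * (N * wgt β κg j) :=
        mul_le_mul (norm_modeAdv_sub_le hβ hU hM.boundV hM.boundW j k) (hc j) (norm_nonneg _)
          (by positivity)
    _ = _ := by rw [convTerm_eq (by linarith), wgt]; ring

lemma summable_transport (hβ : β < -2) (hU : 0 ≤ U) (hM : IsBoundedModes Ξ V W)
    (hϖ : IsConvConst β κg ϖ) {c : Wave → ℂ} {N : ℝ} (hc : ∀ j, ‖c j‖ ≤ N * wgt β κg j)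
    {k : Wave} (hk : k ≠ 0) :
    Summable fun j => Complex.I * modeAdv β U V W j (k - j) * c j :=
  Summable.of_norm_bounded ((hϖ k hk).1.mul_left _) (transport_term_le hβ hU hM hc k)

/-- The smallness condition makes the transport operator a contraction in the weighted norm. -/
lemma norm_transport_le (hβ : β < -2) (hU : 0 ≤ U) (hM : IsBoundedModes Ξ V W)
    (hϖ : IsConvConst β κg ϖ) {c : Wave → ℂ} {N : ℝ} (hN : 0 ≤ N)
    (hc : ∀ j, ‖c j‖ ≤ N * wgt β κg j) (k : Wave) :
    ‖transport β U V W c k‖ ≤ (2 * U * Ξ * ϖ) * N * wgt β κg k := by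
  by_cases hk : k = 0
  · subst hk; simp [transport, wgt]
  have hL := len_pos hk
  have hΞ := hM.nonneg
  refine (norm_transport_le_tsum hk ((hϖ k hk).1.mul_left _)
    (transport_term_le hβ hU hM hc k)).trans ?_
  rw [tsum_mul_left, div_le_iff₀ (by positivity)]
  calc 2 * U * Ξ * N * len k * ∑' j, convTerm β κg k j
      ≤ 2 * U * Ξ * N * len k * (ϖ * kWeight β κg (len k)) := by
        gcongr; exact (hϖ k hk).2
    _ = _ := by rw [wgt]; field_simp

lemma transport_sub (hβ : β < -2) (hU : 0 ≤ U) (hM : IsBoundedModes Ξ V W)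
    (hϖ : IsConvConst β κg ϖ) {c d : Wave → ℂ} {N N' : ℝ} (hc : ∀ j, ‖c j‖ ≤ N * wgt β κg j)
    (hd : ∀ j, ‖d j‖ ≤ N' * wgt β κg j) (k : Wave) :
    transport β U V W (fun j => c j - d j) k
      = transport β U V W c k - transport β U V W d k := by
  by_cases hk : k = 0
  · simp [transport, hk]
  simp only [transport, if_neg hk, mul_sub]
  rw [(summable_transport hβ hU hM hϖ hc hk).tsum_sub (summable_transport hβ hU hM hϖ hd hk)]
  ring

lemma transport_neg (hβ : β < -2) (hM : IsBoundedModes Ξ V W) {c : Wave → ℂ}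
    (hc : ∀ k, c (-k) = conj (c k)) (k : Wave) :
    transport β U V W c (-k) = conj (transport β U V W c k) := by
  by_cases hk : k = 0
  · simp [transport, hk]
  rw [transport, transport, if_neg (neg_ne_zero.mpr hk), if_neg hk, map_neg, map_div₀,
    Complex.conj_ofReal, len_neg, Complex.conj_tsum]
  congr 2
  rw [← (Equiv.neg Wave).tsum_eq]
  refine tsum_congr fun j => ?_
  rw [Equiv.neg_apply, hc, show -k - -j = -(k - j) by abel, modeAdv_neg hM.realV hM.realW hβ]
  simp

/-- A second bound for the transport operator, which uses `j · û_{k-j}` instead of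
`k · û_{k-j}` and thereby gains two powers of `|k|` over the convolution. -/
lemma exists_norm_transport_le_rpow {β a r : ℝ} (hβ : β < -2) (h1 : β ≤ r) (h2 : a + 1 ≤ r)
    (hr : r < 0) (h3 : β + (a + 1) - r < -3) :
    ∃ C, 0 ≤ C ∧ ∀ (U Ξ : ℝ) (V W : Wave → ℂ), 0 ≤ U → IsBoundedModes Ξ V W →
      ∀ (c : Wave → ℂ) (N : ℝ), 0 ≤ N → c 0 = 0 → (∀ j ≠ 0, ‖c j‖ ≤ N * len j ^ a) →
      ∀ k ≠ 0, ‖transport β U V W c k‖ ≤ C * (U * Ξ) * N * len k ^ (r - 2) := by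
  refine ⟨2 * (2 ^ (-r) * (2 * latSum (β + (a + 1) - r))), ?_, ?_⟩
  · have := latSum_nonneg (β + (a + 1) - r)
    positivity
  intro U Ξ V W hU hM c N hN hc0 hc k hk
  have hL := len_pos hk
  have hΞ := hM.nonneg
  obtain ⟨hs, hle⟩ := conv_rpow_le h1 h2 hr h3 hk
  have hterm : ∀ j, ‖Complex.I * modeAdv β U V W j (k - j) * c j‖
      ≤ 2 * U * Ξ * N * (len (k - j) ^ β * len j ^ (a + 1)) := by
    intro j
    have e2 := Real.rpow_nonneg (len_nonneg (k - j)) β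
    by_cases hj : j = 0
    · subst hj
      rw [hc0, mul_zero, norm_zero, len_zero, Real.zero_rpow (by linarith)]
      simp
    have e1 := len_pos hj
    rw [norm_mul, norm_mul, Complex.norm_I, one_mul]
    calc _ ≤ (2 * U * Ξ * len (k - j) ^ β * len j) * (N * len j ^ a) :=
          mul_le_mul (norm_modeAdv_le hβ hU hM.boundV hM.boundW _ _) (hc j hj) (norm_nonneg _)
            (by positivity)
      _ = _ := by rw [Real.rpow_add_one e1.ne']; ring
  refine (norm_transport_le_tsum hk (hs.mul_left _) hterm).trans ?_
  rw [tsum_mul_left, div_le_iff₀ (by positivity)]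
  calc 2 * U * Ξ * N * ∑' j, len (k - j) ^ β * len j ^ (a + 1)
      ≤ 2 * U * Ξ * N * (2 ^ (-r) * (2 * latSum (β + (a + 1) - r)) * len k ^ r) := by gcongr
    _ = _ := by
        rw [show r - 2 = r - (2 : ℕ) by norm_num, Real.rpow_sub_natCast hL.ne']
        field_simp

end Transport

/-! ### The fixed-point iteration in Fourier space -/

/-- The Fourier coefficients of the iterates, `c₀` being those of `θ⁽⁰⁾`. -/
noncomputable def iterCoeff (β U : ℝ) (V W : Wave → ℂ) (c₀ : Wave → ℂ) : ℕ → Wave → ℂ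
  | 0 => c₀
  | n + 1 => fun k => transport β U V W (iterCoeff β U V W c₀ n) k + c₀ k

section Iteration

variable {β U Ξ κg ϖ N : ℝ} {V W c₀ : Wave → ℂ}

lemma norm_iterCoeff_le (hβ : β < -2) (hU : 0 ≤ U) (hM : IsBoundedModes Ξ V W) (hκ : 16 ≤ κg)
    (hϖ : IsConvConst β κg ϖ) (hq : 2 * U * Ξ * ϖ ≤ 1 / 2) (hN : 0 ≤ N)
    (hc₀ : ∀ j, ‖c₀ j‖ ≤ N * wgt β κg j) (n : ℕ) (k : Wave) :
    ‖iterCoeff β U V W c₀ n k‖ ≤ 2 * N * wgt β κg k := by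
  induction n generalizing k with
  | zero =>
    refine (hc₀ k).trans ?_
    have := wgt_nonneg (β := β) hκ k
    nlinarith [mul_nonneg hN this]
  | succ n ih =>
    have h1 := norm_transport_le hβ hU hM hϖ (by positivity) ih k
    have h2 : (2 * U * Ξ * ϖ) * (2 * N) * wgt β κg k ≤ 1 / 2 * (2 * N) * wgt β κg k := by
      have := wgt_nonneg (β := β) hκ k
      gcongr
    calc ‖transport β U V W (iterCoeff β U V W c₀ n) k + c₀ k‖
        ≤ 1 / 2 * (2 * N) * wgt β κg k + N * wgt β κg k :=
          (norm_add_le _ _).trans (add_le_add (h1.trans h2) (hc₀ k))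
      _ = _ := by ring

lemma norm_iterCoeff_succ_sub_le (hβ : β < -2) (hU : 0 ≤ U) (hM : IsBoundedModes Ξ V W)
    (hκ : 16 ≤ κg) (hϖ : IsConvConst β κg ϖ) (hq : 2 * U * Ξ * ϖ ≤ 1 / 2) (hN : 0 ≤ N)
    (hc₀ : ∀ j, ‖c₀ j‖ ≤ N * wgt β κg j) (n : ℕ) (k : Wave) :
    ‖iterCoeff β U V W c₀ (n + 1) k - iterCoeff β U V W c₀ n k‖
      ≤ N / 2 / 2 ^ n * wgt β κg k := by
  induction n generalizing k with
  | zero =>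
    have h1 := norm_transport_le hβ hU hM hϖ hN hc₀ k
    have hw := wgt_nonneg (β := β) hκ k
    simp only [iterCoeff, add_sub_cancel_right]
    refine h1.trans ?_
    calc _ ≤ 1 / 2 * N * wgt β κg k := by gcongr
      _ = _ := by ring
  | succ n ih =>
    have hw := wgt_nonneg (β := β) hκ k
    have hb := norm_iterCoeff_le hβ hU hM hκ hϖ hq hN hc₀
    have e : iterCoeff β U V W c₀ (n + 1 + 1) k - iterCoeff β U V W c₀ (n + 1) k
        = transport β U V W (fun j => iterCoeff β U V W c₀ (n + 1) j
            - iterCoeff β U V W c₀ n j) k := by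
      rw [transport_sub hβ hU hM hϖ (hb _) (hb _)]
      simp only [iterCoeff]; ring
    rw [e]
    refine (norm_transport_le hβ hU hM hϖ (by positivity) ih k).trans ?_
    calc _ ≤ 1 / 2 * (N / 2 / 2 ^ n) * wgt β κg k := by gcongr
      _ = _ := by rw [pow_succ]; ring

lemma iterCoeff_neg (hβ : β < -2) (hM : IsBoundedModes Ξ V W) (hc : ∀ k, c₀ (-k) = conj (c₀ k))
    (n : ℕ) (k : Wave) :
    iterCoeff β U V W c₀ n (-k) = conj (iterCoeff β U V W c₀ n k) := by
  induction n generalizing k with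
  | zero => exact hc k
  | succ n ih => simp only [iterCoeff, map_add, hc, transport_neg hβ hM ih]

/-- The iteration converges to a fixed point. -/
lemma exists_fixedPoint (hβ : β < -2) (hU : 0 ≤ U) (hM : IsBoundedModes Ξ V W)
    (hκ : 16 ≤ κg) (hϖ : IsConvConst β κg ϖ) (hq : 2 * U * Ξ * ϖ ≤ 1 / 2) (hN : 0 ≤ N)
    (hc₀ : ∀ j, ‖c₀ j‖ ≤ N * wgt β κg j) (hc : ∀ k, c₀ (-k) = conj (c₀ k)) :
    ∃ θ : Wave → ℂ, (∀ k, ‖θ k‖ ≤ 2 * N * wgt β κg k) ∧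
      (∀ k, θ k = transport β U V W θ k + c₀ k) ∧ (∀ k, θ (-k) = conj (θ k)) ∧
      ∀ n k, ‖iterCoeff β U V W c₀ n k - θ k‖ ≤ N / 2 ^ n * wgt β κg k := by
  have hdist : ∀ k n, dist (iterCoeff β U V W c₀ n k) (iterCoeff β U V W c₀ (n + 1) k)
      ≤ N * wgt β κg k / 2 / 2 ^ n := fun k n => by
    rw [dist_comm, dist_eq_norm]
    exact (norm_iterCoeff_succ_sub_le hβ hU hM hκ hϖ hq hN hc₀ n k).trans (le_of_eq (by ring))
  have hlim : ∀ k, ∃ t, Tendsto (fun n => iterCoeff β U V W c₀ n k) atTop (𝓝 t) := fun k =>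
    cauchySeq_tendsto_of_complete (cauchySeq_of_le_geometric_two (hdist k))
  choose θ hθ using hlim
  have hb := norm_iterCoeff_le hβ hU hM hκ hϖ hq hN hc₀
  have hconv : ∀ n k, ‖iterCoeff β U V W c₀ n k - θ k‖ ≤ N / 2 ^ n * wgt β κg k := fun n k => by
    rw [← dist_eq_norm]
    exact (dist_le_of_le_geometric_two_of_tendsto (hdist k) (hθ k) n).trans
      (le_of_eq (by ring))
  have hbθ : ∀ k, ‖θ k‖ ≤ 2 * N * wgt β κg k := fun k =>
    le_of_tendsto (hθ k).norm (Eventually.of_forall fun n => hb n k)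
  refine ⟨θ, hbθ, fun k => ?_, fun k => ?_, hconv⟩
  · have h1 : Tendsto (fun n => iterCoeff β U V W c₀ (n + 1) k) atTop
        (𝓝 (transport β U V W θ k + c₀ k)) := by
      simp only [iterCoeff]
      refine Tendsto.add_const _ ?_
      rw [tendsto_iff_norm_sub_tendsto_zero]
      refine squeeze_zero (fun _ => norm_nonneg _) (fun n => ?_)
        (g := fun n : ℕ => (2 * U * Ξ * ϖ) * (N / 2 ^ n) * wgt β κg k) ?_
      · rw [← transport_sub hβ hU hM hϖ (hb n) hbθ]
        exact norm_transport_le hβ hU hM hϖ (by positivity) (hconv n) k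
      · have : Tendsto (fun n : ℕ => (2 * U * Ξ * ϖ) * (N * (1 / 2) ^ n) * wgt β κg k) atTop
            (𝓝 ((2 * U * Ξ * ϖ) * (N * 0) * wgt β κg k)) :=
          ((tendsto_const_nhds.mul (tendsto_pow_atTop_nhds_zero_of_lt_one (by norm_num)
            (by norm_num))).const_mul _).mul_const _
        simpa [div_eq_mul_inv] using this
    exact tendsto_nhds_unique ((tendsto_add_atTop_iff_nat 1).mpr (hθ k)) h1
  · have h1 := hθ (-k)
    simp only [iterCoeff_neg hβ hM hc] at h1
    exact tendsto_nhds_unique h1 ((Complex.continuous_conj.tendsto _).comp (hθ k))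

end Iteration

/-! ### Decay of the solution -/

/-- Each use of the equation improves the decay of a solution, from `|k|^{β-1}` up to
`|k|^{β-2}`. -/
lemma exists_decay {β : ℝ} (hβ : β < -2) {A : ℝ} (hA : 0 ≤ A) :
    ∃ C, 0 ≤ C ∧ ∀ (U Ξ : ℝ) (V W : Wave → ℂ), 0 ≤ U → IsBoundedModes Ξ V W → U * Ξ ≤ A →
      ∀ (θ c₀ : Wave → ℂ) (N : ℝ), 0 ≤ N → θ 0 = 0 →
      (∀ k, θ k = transport β U V W θ k + c₀ k) →
      (∀ k ≠ 0, ‖c₀ k‖ ≤ N * len k ^ (β - 2)) → (∀ k ≠ 0, ‖θ k‖ ≤ N * len k ^ (β - 1)) →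
      ∀ k ≠ 0, ‖θ k‖ ≤ C * N * len k ^ (β - 2) := by
  set δ : ℝ := (-2 - β) / 2 with hδ
  have hδ0 : 0 < δ := by rw [hδ]; linarith
  have key : ∀ n : ℕ, ∃ C, 0 ≤ C ∧ ∀ (U Ξ : ℝ) (V W : Wave → ℂ), 0 ≤ U →
      IsBoundedModes Ξ V W → U * Ξ ≤ A →
      ∀ (θ c₀ : Wave → ℂ) (N : ℝ), 0 ≤ N → θ 0 = 0 →
      (∀ k, θ k = transport β U V W θ k + c₀ k) →
      (∀ k ≠ 0, ‖c₀ k‖ ≤ N * len k ^ (β - 2)) → (∀ k ≠ 0, ‖θ k‖ ≤ N * len k ^ (β - 1)) →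
      ∀ k ≠ 0, ‖θ k‖ ≤ C * N * len k ^ (max (β - 2) (β - 1 - n * δ)) := by
    intro n
    induction n with
    | zero =>
      refine ⟨1, zero_le_one, fun U Ξ V W _ _ _ θ c₀ N _ _ _ _ h k hk => ?_⟩
      rw [max_eq_right (by push_cast; linarith), one_mul]
      simpa using h k hk
    | succ n ih =>
      obtain ⟨C, hC, ih⟩ := ih
      set a := max (β - 2) (β - 1 - n * δ) with ha
      have han : a ≤ β - 1 := max_le (by linarith) (by
        have : 0 ≤ (n : ℝ) * δ := by positivity
        linarith)
      -- the exponent of the convolution is chosen with a margin `δ` in its summability condition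
      obtain ⟨C', hC', hT⟩ := exists_norm_transport_le_rpow (a := a)
        (r := max β (a + 4 + β + δ)) hβ (le_max_left _ _)
        ((by linarith : a + 1 ≤ β).trans (le_max_left _ _))
        (max_lt (by linarith) (by rw [hδ]; linarith))
        (by have := le_max_right β (a + 4 + β + δ); linarith)
      refine ⟨C' * A * C + 1, by positivity, ?_⟩
      intro U Ξ V W hU hM hUA θ c₀ N hN h0 hfix hc₀ hθ k hk
      have h1 := ih U Ξ V W hU hM hUA θ c₀ N hN h0 hfix hc₀ hθ
      have h2 := hT U Ξ V W hU hM θ (C * N) (by positivity) h0 h1 k hk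
      have hL := one_le_len hk
      have hL0 := len_pos hk
      have hexp : max β (a + 4 + β + δ) - 2 ≤ max (β - 2) (β - 1 - (n + 1 : ℕ) * δ) := by
        rw [← max_sub_sub_right]
        refine max_le (le_max_left _ _) ?_
        have e1 : a + 4 + β + δ - 2 = a - δ := by rw [hδ]; ring
        rw [e1, ha, ← max_sub_sub_right]
        refine max_le ((by linarith : β - 2 - δ ≤ β - 2).trans (le_max_left _ _))
          (le_trans (le_of_eq ?_) (le_max_right _ _))
        push_cast; ring
      have p1 : len k ^ (max β (a + 4 + β + δ) - 2)
          ≤ len k ^ (max (β - 2) (β - 1 - (n + 1 : ℕ) * δ)) :=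
        Real.rpow_le_rpow_of_exponent_le hL hexp
      have p2 : len k ^ (β - 2) ≤ len k ^ (max (β - 2) (β - 1 - (n + 1 : ℕ) * δ)) :=
        Real.rpow_le_rpow_of_exponent_le hL (le_max_left _ _)
      have hUΞ : 0 ≤ U * Ξ := mul_nonneg hU hM.nonneg
      rw [hfix k]
      calc ‖transport β U V W θ k + c₀ k‖
          ≤ C' * (U * Ξ) * (C * N) * len k ^ (max β (a + 4 + β + δ) - 2)
            + N * len k ^ (β - 2) := (norm_add_le _ _).trans (add_le_add h2 (hc₀ k hk))
        _ ≤ C' * A * (C * N) * len k ^ (max (β - 2) (β - 1 - (n + 1 : ℕ) * δ))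
            + N * len k ^ (max (β - 2) (β - 1 - (n + 1 : ℕ) * δ)) := by gcongr
        _ = _ := by ring
  obtain ⟨n, hn⟩ := exists_nat_ge (1 / δ)
  obtain ⟨C, hC, h⟩ := key n
  have hm : max (β - 2) (β - 1 - n * δ) = β - 2 := by
    refine max_eq_left ?_
    rw [div_le_iff₀ hδ0] at hn
    linarith
  rw [hm] at h
  exact ⟨C, hC, h⟩

end BHT

namespace BHT

/-! ### Uniqueness -/

/-- Schur's test for the symmetric kernel `|k - j|^β`, with the weight `K_β(|j|) / |j|` of the
smallness condition: a fixed point of the transport operator in `H¹` vanishes. -/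
lemma eq_zero_of_transport_eq {β U Ξ κg ϖ : ℝ} {V W : Wave → ℂ} (hβ : β < -2) (hU : 0 ≤ U)
    (hM : IsBoundedModes Ξ V W) (hκ : 16 ≤ κg) (hϖ : IsConvConst β κg ϖ)
    (hq : 2 * U * Ξ * ϖ < 1) {w : Wave → ℂ} (hw : Summable fun k => len k ^ 2 * ‖w k‖ ^ 2)
    (hfix : ∀ k, w k = transport β U V W w k) (k : Wave) : w k = 0 := by
  have hw0 : w 0 = 0 := by rw [hfix]; simp [transport]
  have hΞ := hM.nonneg
  obtain ⟨w₀, hw₀, hlow⟩ := exists_convConst_lower hβ hκ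
  have hϖ0 : 0 < ϖ := hw₀.trans_le (hlow ϖ hϖ)
  have hwgt : ∀ k : Wave, k ≠ 0 → 0 < wgt β κg k := fun k hk => by
    have := len_pos hk
    have := kWeight_pos (β := β) (κg := κg) (by linarith) this
    rw [wgt]; positivity
  have hwn : ∀ k, 0 ≤ wgt β κg k := wgt_nonneg hκ
  let y : Wave → ℝ≥0∞ := fun k => ENNReal.ofReal ‖w k‖
  let A : Wave → Wave → ℝ≥0∞ := fun k j => ENNReal.ofReal (len (k - j) ^ β)
  let R : Wave → Wave → ℝ≥0∞ := fun k j => ENNReal.ofReal (‖w k‖ ^ 2 * (wgt β κg j / wgt β κg k))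
  have hA : ∀ k j, A k j = A j k := fun k j => by simp only [A, len_sub_comm]
  have h1 : ∀ k, ENNReal.ofReal (len k) * y k
      ≤ ENNReal.ofReal (2 * U * Ξ) * ∑' j, A k j * y j := by
    intro k
    by_cases hk : k = 0
    · subst hk; simp
    have hL := len_pos hk
    have e1 : len k ^ 2 * ‖w k‖ = ‖∑' j, Complex.I * modeAdv β U V W j (k - j) * w j‖ := by
      have h := hfix k
      rw [transport, if_neg hk] at h
      rw [h, norm_neg, norm_div, Complex.norm_real, Real.norm_eq_abs, abs_of_nonneg (sq_nonneg _)]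
      field_simp
    have e2 : ENNReal.ofReal (len k ^ 2 * ‖w k‖)
        ≤ ∑' j, ENNReal.ofReal (2 * U * Ξ * len k) * (A k j * y j) := by
      rw [e1, ofReal_norm]
      refine enorm_tsum_le_tsum_enorm.trans (ENNReal.tsum_le_tsum fun j => ?_)
      have hp := Real.rpow_nonneg (len_nonneg (k - j)) β
      rw [← ofReal_norm, ← ENNReal.ofReal_mul hp, ← ENNReal.ofReal_mul (by positivity)]
      refine ENNReal.ofReal_le_ofReal ?_
      rw [norm_mul, norm_mul, Complex.norm_I, one_mul]
      calc _ ≤ (2 * U * Ξ * len (k - j) ^ β * len k) * ‖w j‖ := by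
            gcongr; exact norm_modeAdv_sub_le hβ hU hM.boundV hM.boundW j k
        _ = _ := by ring
    rw [ENNReal.tsum_mul_left, show len k ^ 2 * ‖w k‖ = len k * (len k * ‖w k‖) by ring,
      show 2 * U * Ξ * len k = len k * (2 * U * Ξ) by ring, ENNReal.ofReal_mul hL.le,
      ENNReal.ofReal_mul hL.le, ENNReal.ofReal_mul hL.le, mul_assoc] at e2
    have hL' : ENNReal.ofReal (len k) ≠ 0 := by simpa using hL
    exact (ENNReal.mul_le_mul_iff_right hL' ENNReal.ofReal_ne_top).mp e2
  have h2 : ∀ k j, 2 * (y k * y j) ≤ R k j + R j k := by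
    intro k j
    simp only [y, R]
    rw [← ENNReal.ofReal_mul (norm_nonneg _), ← ENNReal.ofReal_add
      (mul_nonneg (sq_nonneg _) (div_nonneg (hwn _) (hwn _)))
      (mul_nonneg (sq_nonneg _) (div_nonneg (hwn _) (hwn _))),
      show (2 : ℝ≥0∞) = ENNReal.ofReal 2 by simp, ← ENNReal.ofReal_mul (by norm_num)]
    refine ENNReal.ofReal_le_ofReal ?_
    by_cases hk : k = 0
    · subst hk
      rw [hw0, norm_zero, zero_mul, mul_zero]
      exact add_nonneg (mul_nonneg (sq_nonneg _) (div_nonneg (hwn _) (hwn _)))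
        (mul_nonneg (sq_nonneg _) (div_nonneg (hwn _) (hwn _)))
    by_cases hj : j = 0
    · subst hj
      rw [hw0, norm_zero, mul_zero, mul_zero]
      exact add_nonneg (mul_nonneg (sq_nonneg _) (div_nonneg (hwn _) (hwn _)))
        (mul_nonneg (sq_nonneg _) (div_nonneg (hwn _) (hwn _)))
    have a1 := hwgt k hk
    have a2 := hwgt j hj
    have e : ‖w k‖ ^ 2 * (wgt β κg j / wgt β κg k) + ‖w j‖ ^ 2 * (wgt β κg k / wgt β κg j)
        - 2 * (‖w k‖ * ‖w j‖)
        = (‖w k‖ * wgt β κg j - ‖w j‖ * wgt β κg k) ^ 2 / (wgt β κg k * wgt β κg j) := by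
      field_simp; ring
    have : 0 ≤ (‖w k‖ * wgt β κg j - ‖w j‖ * wgt β κg k) ^ 2 / (wgt β κg k * wgt β κg j) := by
      positivity
    linarith
  have h3 : ∀ k, ∑' j, A k j * R k j
      ≤ ENNReal.ofReal ϖ * (ENNReal.ofReal (len k) * (y k * y k)) := by
    intro k
    by_cases hk : k = 0
    · subst hk; simp [R, hw0]
    have a1 := hwgt k hk
    have hL := len_pos hk
    have e1 : ∀ j, A k j * R k j
        = ENNReal.ofReal (‖w k‖ ^ 2 / wgt β κg k * convTerm β κg k j) := by
      intro j
      have hp := Real.rpow_nonneg (len_nonneg (k - j)) β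
      rw [← ENNReal.ofReal_mul hp, convTerm_eq (by linarith), wgt, wgt]
      congr 1; ring
    simp only [e1]
    have hn : ∀ j, 0 ≤ ‖w k‖ ^ 2 / wgt β κg k * convTerm β κg k j := fun j =>
      mul_nonneg (by positivity) (convTerm_nonneg (by linarith) k j)
    rw [← ENNReal.ofReal_tsum_of_nonneg hn ((hϖ k hk).1.mul_left _), tsum_mul_left]
    simp only [y]
    rw [← ENNReal.ofReal_mul (norm_nonneg _), ← ENNReal.ofReal_mul hL.le,
      ← ENNReal.ofReal_mul hϖ0.le]
    refine ENNReal.ofReal_le_ofReal ?_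
    calc ‖w k‖ ^ 2 / wgt β κg k * ∑' j, convTerm β κg k j
        ≤ ‖w k‖ ^ 2 / wgt β κg k * (ϖ * kWeight β κg (len k)) := by
          gcongr; exact (hϖ k hk).2
      _ = _ := by
          have := kWeight_pos (β := β) (κg := κg) (by linarith) hL
          rw [wgt]; field_simp
  set S : ℝ≥0∞ := ∑' k, ENNReal.ofReal (len k) * (y k * y k) with hS
  have h4 : 2 * ∑' k, ∑' j, A k j * (y k * y j) ≤ 2 * (ENNReal.ofReal ϖ * S) := by
    calc 2 * ∑' k, ∑' j, A k j * (y k * y j)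
        = ∑' k, ∑' j, A k j * (2 * (y k * y j)) := by
          simp only [← ENNReal.tsum_mul_left]
          refine tsum_congr fun k => tsum_congr fun j => by ring
      _ ≤ ∑' k, ∑' j, (A k j * R k j + A k j * R j k) :=
          ENNReal.tsum_le_tsum fun k => ENNReal.tsum_le_tsum fun j => by
            rw [← mul_add]; gcongr; exact h2 k j
      _ = (∑' k, ∑' j, A k j * R k j) + ∑' k, ∑' j, A k j * R j k := by
          simp only [ENNReal.tsum_add]
      _ = (∑' k, ∑' j, A k j * R k j) + ∑' k, ∑' j, A k j * R k j := by
          congr 1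
          rw [ENNReal.tsum_comm]
          simp only [hA]
      _ = 2 * ∑' k, ∑' j, A k j * R k j := by rw [two_mul]
      _ ≤ 2 * (ENNReal.ofReal ϖ * S) := by
          rw [hS, ← ENNReal.tsum_mul_left (a := ENNReal.ofReal ϖ)]
          exact mul_le_mul' le_rfl (ENNReal.tsum_le_tsum h3)
  have h5 : S ≤ ENNReal.ofReal (2 * U * Ξ * ϖ) * S := by
    calc S ≤ ∑' k, ENNReal.ofReal (2 * U * Ξ) * ∑' j, A k j * (y k * y j) := by
          refine ENNReal.tsum_le_tsum fun k => ?_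
          calc _ = (ENNReal.ofReal (len k) * y k) * y k := by ring
            _ ≤ (ENNReal.ofReal (2 * U * Ξ) * ∑' j, A k j * y j) * y k := by
                exact mul_le_mul' (h1 k) le_rfl
            _ = _ := by
                rw [mul_assoc, ← ENNReal.tsum_mul_right]
                congr 1
                exact tsum_congr fun j => by ring
      _ = ENNReal.ofReal (2 * U * Ξ) * ∑' k, ∑' j, A k j * (y k * y j) := ENNReal.tsum_mul_left
      _ ≤ ENNReal.ofReal (2 * U * Ξ) * (ENNReal.ofReal ϖ * S) := by
          gcongr
          exact (ENNReal.mul_le_mul_iff_right (by norm_num) (by norm_num)).mp h4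
      _ = _ := by rw [← mul_assoc, ← ENNReal.ofReal_mul (by positivity)]
  have hSfin : S ≠ ∞ := by
    have : ∀ k, ENNReal.ofReal (len k) * (y k * y k) = ENNReal.ofReal (len k * ‖w k‖ ^ 2) :=
      fun k => by
        rw [ENNReal.ofReal_mul (len_nonneg k), sq, ENNReal.ofReal_mul (norm_nonneg _)]
    rw [hS]
    simp only [this]
    refine Summable.tsum_ofReal_ne_top (Summable.of_nonneg_of_le (fun k => ?_) (fun k => ?_) hw)
    · have := len_nonneg k; positivity
    · by_cases hk : k = 0
      · subst hk; simp
      · have := one_le_len hk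
        gcongr
        nlinarith
  have hS0 : S = 0 := by
    by_contra hne
    have : ENNReal.ofReal (2 * U * Ξ * ϖ) * S < 1 * S := by
      refine (ENNReal.mul_lt_mul_iff_left hne hSfin).mpr ?_
      rw [← ENNReal.ofReal_one]
      exact (ENNReal.ofReal_lt_ofReal_iff one_pos).mpr hq
    rw [one_mul] at this
    exact absurd h5 (not_le.mpr this)
  by_cases hk : k = 0
  · rw [hk, hw0]
  · have h6 := (ENNReal.tsum_eq_zero.mp hS0) k
    have hL := len_pos hk
    simpa [y, hL.not_ge] using h6

end BHT

namespace BHT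

/-! ### From Fourier coefficients to functions -/

lemma len_single (i : Fin 3) : len (Pi.single i 1) = 1 := by
  rw [len]
  fin_cases i <;> simp [Pi.single_apply]

lemma summable_sq_of_le {c : Wave → ℂ} {b : Wave → ℝ} {C s : ℝ} (hs : 2 * s < -3)
    (h : ∀ k, ‖c k‖ ≤ b k) (hb : ∀ k, b k ≤ C * len k ^ s) : Summable fun k => ‖c k‖ ^ 2 := by
  refine Summable.of_nonneg_of_le (fun k => by positivity) (fun k => ?_)
    ((summable_len_rpow hs).mul_left (C ^ 2))
  calc ‖c k‖ ^ 2 ≤ (C * len k ^ s) ^ 2 :=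
        pow_le_pow_left₀ (norm_nonneg _) ((h k).trans (hb k)) 2
    _ = C ^ 2 * len k ^ (2 * s) := by
        rw [mul_pow, ← Real.rpow_natCast (len k ^ s), ← Real.rpow_mul (len_nonneg k)]
        congr 2; push_cast; ring

section Velocity

variable {β U Ξ : ℝ} {V W : Wave → ℂ}

lemma coeff_velocity (hβ : β < -2) (hU : 0 ≤ U) (hM : IsBoundedModes Ξ V W) (i : Fin 3)
    (m : Wave) : coeff (velocity β U V W i) m = modeAdv β U V W (Pi.single i 1) m := by
  have e : velocity β U V W i = series fun m => modeAdv β U V W (Pi.single i 1) m := by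
    rw [velocity]
    congr 1
    funext k
    split_ifs with hk
    · rw [hk, modeAdv_zero hβ]
    · have h1 : edot (Pi.single i 1) k = eVec k i := by
        simp [edot, Pi.single_apply]
      have h2 : fdot (Pi.single i 1) k = fVec k i := by
        simp [fdot, Pi.single_apply]
      rw [modeAdv, h1, h2]
      push_cast; ring
  rw [e, coeff_series]
  refine summable_sq_of_le (s := β) (C := 2 * U * Ξ) (by linarith)
    (fun k => norm_modeAdv_le hβ hU hM.boundV hM.boundW _ _) fun k => ?_
  rw [len_single, mul_one]

lemma sum_modeAdv_single (j m : Wave) :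
    ∑ i, modeAdv β U V W (Pi.single i 1) m * (j i : ℂ) = modeAdv β U V W j m := by
  have h1 : ∀ i, edot (Pi.single i 1) m = eVec m i := fun i => by
    simp [edot, Pi.single_apply]
  have h2 : ∀ i, fdot (Pi.single i 1) m = fVec m i := fun i => by
    simp [fdot, Pi.single_apply]
  simp only [modeAdv, h1, h2]
  simp only [edot, fdot, Fin.sum_univ_three]
  push_cast; ring

lemma hasSum_advect_velocity (hβ : β < -2) (hU : 0 ≤ U) (hM : IsBoundedModes Ξ V W) {f : L2}
    (hf : MemH1 f) (k : Wave) :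
    HasSum (fun j => Complex.I * modeAdv β U V W j (k - j) * coeff f j)
      (coeff (advect (velocity β U V W) f) k) := by
  refine (hasSum_coeff_advect _ hf k).congr_fun fun j => ?_
  simp only [coeff_velocity hβ hU hM, sum_modeAdv_single]

lemma coeff_advect_zero (hβ : β < -2) (hU : 0 ≤ U) (hM : IsBoundedModes Ξ V W) {f : L2}
    (hf : MemH1 f) : coeff (advect (velocity β U V W) f) 0 = 0 := by
  refine (hasSum_advect_velocity hβ hU hM hf 0).unique ?_
  convert hasSum_zero using 2 with j
  rw [modeAdv_sub]
  simp [modeAdv, edot, fdot]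

lemma coeff_advect_eq (hβ : β < -2) (hU : 0 ≤ U) (hM : IsBoundedModes Ξ V W) {f : L2}
    (hf : MemH1 f) (k : Wave) :
    coeff (advect (velocity β U V W) f) k
      = -((len k ^ 2 : ℝ) : ℂ) * transport β U V W (fun j => coeff f j) k := by
  by_cases hk : k = 0
  · subst hk; rw [coeff_advect_zero hβ hU hM hf]; simp
  have hL : ((len k ^ 2 : ℝ) : ℂ) ≠ 0 := by
    exact_mod_cast (pow_pos (len_pos hk) 2).ne'
  rw [transport, if_neg hk, (hasSum_advect_velocity hβ hU hM hf k).tsum_eq]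
  field_simp

end Velocity

lemma len_mul_wgt_le {β κg : ℝ} (hβ : β < -2) (k : Wave) :
    len k * wgt β κg k ≤ (2 * κg) ^ (-β) * len k ^ β := by
  by_cases hk : k = 0
  · subst hk; simp [Real.zero_rpow (show β ≠ 0 by linarith)]
  have hL := len_pos hk
  rw [wgt, mul_comm, mul_assoc, inv_mul_cancel₀ hL.ne', mul_one]
  exact min_le_right _ _

lemma wgt_le_len_mul_wgt {β κg : ℝ} (hκ : 16 ≤ κg) (k : Wave) : wgt β κg k ≤ len k * wgt β κg k := by
  by_cases hk : k = 0
  · subst hk; simp [wgt]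
  exact le_mul_of_one_le_left (wgt_nonneg hκ k) (one_le_len hk)

lemma summable_len_mul_wgt {β κg : ℝ} (hβ : β < -2) (hκ : 16 ≤ κg) :
    Summable fun k : Wave => (len k * wgt β κg k) ^ 2 := by
  have hn : ∀ k : Wave, 0 ≤ len k * wgt β κg k := fun k =>
    mul_nonneg (len_nonneg k) (wgt_nonneg hκ k)
  have := summable_sq_of_le (c := fun k => ((len k * wgt β κg k : ℝ) : ℂ)) (s := β)
    (b := fun k => len k * wgt β κg k)
    (C := (2 * κg) ^ (-β)) (by linarith) (fun k => ?_) (len_mul_wgt_le hβ)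
  · refine this.congr fun k => ?_
    rw [Complex.norm_real, Real.norm_eq_abs, sq_abs]
  · rw [Complex.norm_real, Real.norm_eq_abs, abs_of_nonneg (hn k)]

section Weighted

variable {β κg : ℝ}

lemma memH1_of_le (hβ : β < -2) (hκ : 16 ≤ κg) {f : L2} {N : ℝ}
    (h : ∀ k, ‖coeff f k‖ ≤ N * wgt β κg k) : MemH1 f := by
  refine Summable.of_nonneg_of_le (fun k => by positivity) (fun k => ?_)
    ((summable_len_mul_wgt hβ hκ).mul_left (N ^ 2))
  calc len k ^ 2 * ‖coeff f k‖ ^ 2 ≤ len k ^ 2 * (N * wgt β κg k) ^ 2 := by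
        gcongr; exact h k
    _ = _ := by ring

lemma summable_sq_of_le_wgt (hβ : β < -2) (hκ : 16 ≤ κg) {c : Wave → ℂ} {N : ℝ}
    (h : ∀ k, ‖c k‖ ≤ N * wgt β κg k) : Summable fun k => ‖c k‖ ^ 2 := by
  refine Summable.of_nonneg_of_le (fun k => by positivity) (fun k => ?_)
    ((summable_len_mul_wgt hβ hκ).mul_left (N ^ 2))
  calc ‖c k‖ ^ 2 ≤ (N * wgt β κg k) ^ 2 := pow_le_pow_left₀ (norm_nonneg _) (h k) 2
    _ ≤ N ^ 2 * (len k * wgt β κg k) ^ 2 := by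
        rw [mul_pow]
        have := wgt_le_len_mul_wgt (β := β) hκ k
        have := wgt_nonneg (β := β) hκ k
        gcongr

/-- Coefficientwise geometric convergence implies convergence in `L²`. -/
lemma tendsto_of_coeff_le {f : ℕ → L2} {g : L2} {b : Wave → ℝ} {N : ℝ}
    (hb : Summable fun k => b k ^ 2)
    (h : ∀ n k, ‖coeff (f n) k - coeff g k‖ ≤ N / 2 ^ n * b k) : Tendsto f atTop (𝓝 g) := by
  rw [tendsto_iff_norm_sub_tendsto_zero]
  have h1 : ∀ n, ‖f n - g‖ ≤ |N| * √(∑' k, b k ^ 2) * (1 / 2) ^ n := by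
    intro n
    have hS : 0 ≤ ∑' k, b k ^ 2 := tsum_nonneg fun k => sq_nonneg _
    refine le_of_sq_le_sq ?_ (by positivity)
    rw [norm_sq_eq_tsum, mul_pow, mul_pow, Real.sq_sqrt hS, mul_right_comm, sq_abs,
      ← tsum_mul_left]
    refine Summable.tsum_le_tsum (fun k => ?_) (summable_coeff_sq _) (hb.mul_left _)
    rw [coeff_sub]
    refine (pow_le_pow_left₀ (norm_nonneg _) (h n k) 2).trans (le_of_eq ?_)
    rw [one_div, inv_pow]; ring
  refine squeeze_zero (fun _ => norm_nonneg _) h1 ?_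
  simpa using (tendsto_pow_atTop_nhds_zero_of_lt_one (r := (1 / 2 : ℝ)) (by norm_num)
    (by norm_num)).const_mul (|N| * √(∑' k, b k ^ 2))

end Weighted

/-- Hermitian Fourier coefficients belong to a real function. -/
lemma ae_im_eq_zero {f : L2} (h : ∀ k, coeff f (-k) = conj (coeff f k)) :
    ∀ᵐ x, (f x).im = 0 := by
  have hstar : MemLp (fun x => conj (f x)) 2 (volume : Measure Torus) := (Lp.memLp f).star
  have e : (hstar.toLp _ : L2) = f := by
    apply L2.ext_coeff
    intro k
    have h1 : coeff (hstar.toLp _ : L2) k = conj (coeff f (-k)) := by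
      rw [coeff, coeff, mFourierCoeff, mFourierCoeff, ← integral_conj]
      apply integral_congr_ae
      filter_upwards [hstar.coeFn_toLp] with x hx
      simp only [smul_eq_mul, hx, map_mul, neg_neg, mFourier_neg]
    rw [h1, h, Complex.conj_conj]
  have h2 := hstar.coeFn_toLp
  rw [e] at h2
  filter_upwards [h2] with x hx
  exact Complex.conj_eq_iff_im.mp hx.symm

/-! ### The source and the iterates -/

section Source

variable {α β κg N : ℝ} {a : Wave → ℂ}

lemma coeff_source (hα : 2 * (2 + α) < -3) (ha0 : a 0 = 0)
    (ha : ∀ k ≠ 0, ‖a k‖ ≤ N * len k ^ α) (k : Wave) :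
    coeff (source a) k = -((len k ^ 2 : ℝ) : ℂ) * a k := by
  have e : source a = series fun k => -((len k ^ 2 : ℝ) : ℂ) * a k := by
    rw [source]
    congr 1
    funext k
    split_ifs with h
    · simp [h]
    · rfl
  rw [e, coeff_series]
  refine summable_sq_of_le (s := 2 + α) (C := N) (b := fun k => N * len k ^ (2 + α)) hα
    (fun k => ?_) fun k => le_rfl
  by_cases hk : k = 0
  · subst hk
    rw [ha0, mul_zero, norm_zero, len_zero, Real.zero_rpow (by linarith), mul_zero]
  · rw [norm_mul, norm_neg, Complex.norm_real, Real.norm_eq_abs, abs_of_nonneg (sq_nonneg _)]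
    calc len k ^ 2 * ‖a k‖ ≤ len k ^ 2 * (N * len k ^ α) := by gcongr; exact ha k hk
      _ = _ := by rw [Real.rpow_add (len_pos hk), Real.rpow_two]; ring

lemma le_wgt (hβ : β < -2) (hα : α ≤ β - 1) (hκ : 16 ≤ κg) {k : Wave} (hk : k ≠ 0) :
    len k ^ α ≤ wgt β κg k := by
  have hL := one_le_len hk
  calc len k ^ α ≤ len k ^ (β - 1) := Real.rpow_le_rpow_of_exponent_le hL hα
    _ = len k ^ β * (len k)⁻¹ := by rw [Real.rpow_sub_one (len_pos hk).ne', div_eq_mul_inv]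
    _ ≤ _ := by
        rw [wgt]
        have := len_pos hk
        gcongr
        exact rpow_le_kWeight (by linarith) (by linarith) hL

lemma norm_neg_source_le (hβ : β < -2) (hα : α ≤ β - 1) (hκ : 16 ≤ κg) (hN : 0 ≤ N) (ha0 : a 0 = 0)
    (ha : ∀ k ≠ 0, ‖a k‖ ≤ N * len k ^ α) (k : Wave) : ‖-a k‖ ≤ N * wgt β κg k := by
  rw [norm_neg]
  by_cases hk : k = 0
  · subst hk; rw [ha0, norm_zero]; exact mul_nonneg hN (wgt_nonneg hκ _)
  · exact (ha k hk).trans (mul_le_mul_of_nonneg_left (le_wgt hβ hα hκ hk) hN)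

lemma coeff_invLap {f : Torus → ℂ} {c : Wave → ℂ} (h0 : c 0 = 0)
    (hc : Summable fun k => ‖c k‖ ^ 2)
    (h : ∀ k ≠ 0, coeff f k = -((len k ^ 2 : ℝ) : ℂ) * c k) (k : Wave) :
    coeff (invLap f) k = c k := by
  have e : invLap f = series c := by
    rw [invLap]
    congr 1
    funext k
    split_ifs with hk
    · rw [hk, h0]
    · have hL : ((len k ^ 2 : ℝ) : ℂ) ≠ 0 := by
        exact_mod_cast (pow_pos (len_pos hk) 2).ne'
      rw [h k hk]; field_simp
  rw [e, coeff_series hc]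

variable {U Ξ ϖ : ℝ} {V W : Wave → ℂ}

lemma coeff_iter (hβ : β < -2) (hα : α ≤ β - 1) (hα' : 2 * (2 + α) < -3) (hκ : 16 ≤ κg)
    (hU : 0 ≤ U) (hM : IsBoundedModes Ξ V W) (hϖ : IsConvConst β κg ϖ)
    (hq : 2 * U * Ξ * ϖ ≤ 1 / 2) (hN : 0 ≤ N) (ha0 : a 0 = 0)
    (ha : ∀ k ≠ 0, ‖a k‖ ≤ N * len k ^ α) (n : ℕ) :
    (∀ k, coeff (iter (velocity β U V W) (source a) n) k
      = iterCoeff β U V W (fun k => -a k) n k) ∧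
    MemH1 (iter (velocity β U V W) (source a) n) := by
  have hb := norm_iterCoeff_le hβ hU hM hκ hϖ hq hN (norm_neg_source_le hβ hα hκ hN ha0 ha)
  have hsum : ∀ n, Summable fun k => ‖iterCoeff β U V W (fun k => -a k) n k‖ ^ 2 := fun n =>
    summable_sq_of_le_wgt hβ hκ (hb n)
  suffices h : ∀ k, coeff (iter (velocity β U V W) (source a) n) k
      = iterCoeff β U V W (fun k => -a k) n k from
    ⟨h, memH1_of_le hβ hκ fun k => by rw [h]; exact hb n k⟩
  induction n with
  | zero =>
    intro k
    have h1 : Summable fun k => ‖a k‖ ^ 2 := (hsum 0).congr fun k => by simp [iterCoeff]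
    rw [iter, coeff_neg, coeff_invLap ha0 h1 fun k _ => coeff_source hα' ha0 ha k]
    rfl
  | succ n ih =>
    intro k
    have hH : MemH1 (iter (velocity β U V W) (source a) n) :=
      memH1_of_le hβ hκ fun k => by rw [ih]; exact hb n k
    rw [iter, coeff_invLap (c := iterCoeff β U V W (fun k => -a k) (n + 1)) ?_ (hsum _)
      fun k _ => ?_]
    · simp [iterCoeff, transport, ha0]
    · rw [coeff_fun_sub (integrable_advect _ _) (integrable_L2 _), coeff_source hα' ha0 ha,
        coeff_advect_eq hβ hU hM hH]
      simp only [ih]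
      rw [iterCoeff]
      ring

lemma coeff_firstCorr (hβ : β < -2) (hα : α ≤ β - 1) (hα' : 2 * (2 + α) < -3) (hκ : 16 ≤ κg)
    (hU : 0 ≤ U) (hM : IsBoundedModes Ξ V W) (hϖ : IsConvConst β κg ϖ)
    (hq : 2 * U * Ξ * ϖ ≤ 1 / 2) (hN : 0 ≤ N) (ha0 : a 0 = 0)
    (ha : ∀ k ≠ 0, ‖a k‖ ≤ N * len k ^ α) (k : Wave) :
    coeff (firstCorr (velocity β U V W) (source a)) k
      = transport β U V W (fun k => -a k) k := by
  have h := fun n => (coeff_iter hβ hα hα' hκ hU hM hϖ hq hN ha0 ha n).1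
  rw [firstCorr, coeff_sub, h, h]
  simp [iterCoeff]

end Source

lemma exists_source_bound {α cg κg : ℝ} {γ : Wave → ℂ} (hcg : 0 ≤ cg)
    (hγ : IsSourceCoeff α cg κg γ) : ∃ M, 0 ≤ M ∧ ∀ k ≠ 0, ‖γ k‖ ≤ M * len k ^ α := by
  have hn : ∀ k : Wave, 0 ≤ ‖γ k‖ / len k ^ α := fun k =>
    div_nonneg (norm_nonneg _) (Real.rpow_nonneg (len_nonneg k) _)
  have hS : 0 ≤ ∑ k ∈ shell 0 κg, ‖γ k‖ / len k ^ α := Finset.sum_nonneg fun k _ => hn k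
  refine ⟨cg + ∑ k ∈ shell 0 κg, ‖γ k‖ / len k ^ α, by positivity, fun k hk => ?_⟩
  have hp : 0 < len k ^ α := Real.rpow_pos_of_pos (len_pos hk) α
  by_cases h : κg ≤ len k
  · refine (hγ.decay k h).trans ?_
    gcongr
    linarith
  · rw [← div_le_iff₀ hp]
    have := Finset.single_le_sum (f := fun k => ‖γ k‖ / len k ^ α) (fun k _ => hn k)
      (mem_shell.mpr ⟨len_nonneg k, not_le.mp h⟩)
    linarith

/-- Existence, uniqueness and regularity of the solution, for given values of the modes. -/
theorem exists_static_solution {α β cg κg : ℝ} (hβ : β < -2) (hα : α < 2 * min β (-3) - 1)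
    (hcg : 0 ≤ cg) (hκ : 16 ≤ κg) {γ : Wave → ℂ} (hγ : IsSourceCoeff α cg κg γ) :
    ∃ C₃ : ℝ, ∀ (U Ξ ϖ ε : ℝ) (V W Z : Wave → ℂ) (Ξg : ℝ), 0 ≤ U → IsConvConst β κg ϖ →
      ε = 4 * U * Ξ * ϖ → ε < 1 → IsBoundedModes Ξ V W → (∀ k ≠ 0, ‖Z k‖ ≤ Ξg) →
      (∀ k ≠ 0, Z (-k) = conj (Z k)) →
      ∃ θ δθ : L2,
        IsStaticSolution (velocity β U V W) (source fun k => γ k * Z k) θ ∧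
        (∀ θ' : L2, IsStaticSolution (velocity β U V W) (source fun k => γ k * Z k) θ' →
          θ' = θ) ∧
        (∀ᵐ x, (θ x).im = 0) ∧
        (∀ n, MemH1 (iter (velocity β U V W) (source fun k => γ k * Z k) n)) ∧
        Tendsto (iter (velocity β U V W) (source fun k => γ k * Z k)) atTop (𝓝 θ) ∧
        (∀ i, Tendsto (fun n => partialD i
          (iter (velocity β U V W) (source fun k => γ k * Z k) n)) atTop (𝓝 (partialD i θ))) ∧
        θ = -invLap (source fun k => γ k * Z k)
          + firstCorr (velocity β U V W) (source fun k => γ k * Z k) + δθ ∧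
        ∀ κ : ℝ, 4 * κg ^ 2 ≤ κ →
          normSq (proj κ (2 * κ) δθ)
            ≤ ε ^ 2 * C₃ * U ^ 2 * Ξ ^ 2 * Ξg ^ 2 * κ ^ (2 * β - 1) := by
  have hα1 : α < 2 * β - 1 := hα.trans_le (by have := min_le_left β (-3); linarith)
  have hα2 : α < -7 := hα.trans_le (by have := min_le_right β (-3); linarith)
  obtain ⟨M, hM0, hγM⟩ := exists_source_bound hcg hγ
  obtain ⟨w, hw0, hlow⟩ := exists_convConst_lower hβ hκ
  obtain ⟨C₁, hC₁, hdecay⟩ := exists_decay hβ (A := 1 / (4 * w)) (by positivity)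
  obtain ⟨C₂, hC₂, htrans⟩ := exists_norm_transport_le_rpow (β := β) (a := β - 2) (r := β) hβ
    le_rfl (by linarith) (by linarith) (by linarith)
  set D : ℝ := 2 * (2 * κg) ^ (-β) with hD
  have hD1 : 1 ≤ D := by
    have : (1 : ℝ) ≤ (2 * κg) ^ (-β) := Real.one_le_rpow (by linarith) (by linarith)
    rw [hD]; linarith
  set C₄ : ℝ := C₂ * C₂ * C₁ * (D * M) with hC₄
  have hC₄0 : 0 ≤ C₄ := by positivity
  set C₅ : ℝ := 4 * Real.pi * |i₂ (2 * β - 4 + 3)| + Real.pi * 4 / 3 * (16 * |2 * β - 4| + 68)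
    with hC₅
  have hC₅0 : 0 ≤ C₅ := by positivity
  refine ⟨(2 * Real.pi) ^ 3 * C₄ ^ 2 * C₅ / (16 * w ^ 2), ?_⟩
  intro U Ξ ϖ ε V W Z Ξg hU hϖ hε hε1 hVW hZ hZr
  have hΞ := hVW.nonneg
  have hone : (fun _ => 1 : Wave) ≠ 0 := fun h => by simpa using congrFun h 0
  have hΞg : 0 ≤ Ξg := (norm_nonneg _).trans (hZ _ hone)
  have hwϖ := hlow ϖ hϖ
  have hq : 2 * U * Ξ * ϖ ≤ 1 / 2 := by linarith
  have hUΞ0 : 0 ≤ U * Ξ := mul_nonneg hU hΞ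
  have hUΞε : U * Ξ ≤ ε / (4 * w) := by
    rw [le_div_iff₀ (by positivity), hε]
    nlinarith [mul_le_mul_of_nonneg_left hwϖ hUΞ0]
  have hUΞ : U * Ξ ≤ 1 / (4 * w) := hUΞε.trans (by gcongr)
  set a : Wave → ℂ := fun k => γ k * Z k with ha
  set N : ℝ := M * Ξg with hN
  have hN0 : 0 ≤ N := by positivity
  have ha0 : a 0 = 0 := by simp [ha, hγ.zero]
  have haN : ∀ k ≠ 0, ‖a k‖ ≤ N * len k ^ α := fun k hk => by
    rw [ha, norm_mul]
    calc ‖γ k‖ * ‖Z k‖ ≤ (M * len k ^ α) * Ξg := by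
          have := Real.rpow_nonneg (len_nonneg k) α
          exact mul_le_mul (hγM k hk) (hZ k hk) (norm_nonneg _) (by positivity)
      _ = _ := by rw [hN]; ring
  have har : ∀ k, -a (-k) = conj (-a k) := fun k => by
    by_cases hk : k = 0
    · subst hk; simp [ha0]
    · simp [ha, hγ.conj_symm, hZr k hk]
  have hα3 : α ≤ β - 1 := by linarith
  have hα4 : 2 * (2 + α) < -3 := by linarith
  have hc₀ := norm_neg_source_le (κg := κg) hβ hα3 hκ hN0 ha0 haN
  obtain ⟨t, htb, htfix, htr, htconv⟩ :=
    exists_fixedPoint hβ hU hVW hκ hϖ hq hN0 hc₀ har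
  have hiter := coeff_iter hβ hα3 hα4 hκ hU hVW hϖ hq hN0 ha0 haN
  have hfirst := coeff_firstCorr hβ hα3 hα4 hκ hU hVW hϖ hq hN0 ha0 haN
  have hsrc := coeff_source hα4 ha0 haN
  have htc : ∀ k, coeff (series t) k = t k := coeff_series (summable_sq_of_le_wgt hβ hκ htb)
  have htH : MemH1 (series t) := memH1_of_le hβ hκ fun k => by rw [htc]; exact htb k
  have ht0 : t 0 = 0 := by simpa [wgt] using htb 0
  set u := velocity β U V W with hu
  have hsol : ∀ f : L2, MemH1 f → coeff f 0 = 0 →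
      ((∀ k, coeff (advect u f) k = -((len k ^ 2 : ℝ) : ℂ) * coeff f k + coeff (source a) k) ↔
        ∀ k, coeff f k = transport β U V W (fun j => coeff f j) k + -a k) := by
    intro f hf hf0
    refine forall_congr' fun k => ?_
    rw [coeff_advect_eq hβ hU hVW hf, hsrc]
    by_cases hk : k = 0
    · subst hk; simp [hf0, ha0, transport]
    have hL : -((len k ^ 2 : ℝ) : ℂ) ≠ 0 := by
      rw [neg_ne_zero]; exact_mod_cast (pow_pos (len_pos hk) 2).ne'
    rw [← mul_add, mul_right_inj' hL]
    constructor
    · intro h; rw [h]; ring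
    · intro h; rw [h]; ring
  refine ⟨series t, series t - (-invLap (source a)) - firstCorr u (source a), ⟨?_, htH, ?_⟩, ?_,
    ?_, fun n => (hiter n).2, ?_, ?_, ?_, ?_⟩
  · rw [htc, ht0]
  · rw [hsol _ htH (by rw [htc, ht0])]
    simp only [htc]
    exact htfix
  · intro f hf
    have h1 := (hsol f hf.memH1 hf.mean_zero).mp hf.eqn
    have hdH : MemH1 (f - series t : L2) := by
      have hA : Summable fun k => 2 * (len k ^ 2 * ‖coeff f k‖ ^ 2)
          + 2 * (len k ^ 2 * ‖coeff (series t) k‖ ^ 2) :=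
        (hf.memH1.mul_left 2).add (htH.mul_left 2)
      refine Summable.of_nonneg_of_le (fun k => by positivity) (fun k => ?_) hA
      rw [coeff_sub, ← mul_assoc, ← mul_assoc, mul_comm 2, mul_assoc, mul_assoc, ← mul_add]
      refine mul_le_mul_of_nonneg_left ?_ (sq_nonneg _)
      have := norm_sub_le (coeff f k) (coeff (series t) k)
      nlinarith [sq_nonneg (‖coeff f k‖ - ‖coeff (series t) k‖), norm_nonneg (coeff f k),
        norm_nonneg (coeff (series t) k),
        norm_nonneg (coeff f k - coeff (series t) k)]
    have hz : ∀ k, coeff (f - series t : L2) k = 0 := by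
      refine eq_zero_of_transport_eq hβ hU hVW hκ hϖ (by linarith) hdH fun k => ?_
      by_cases hk : k = 0
      · subst hk; rw [coeff_sub, hf.mean_zero, htc, ht0]; simp [transport]
      have e := coeff_advect_eq hβ hU hVW hdH k
      have s1 := hasSum_advect_velocity hβ hU hVW hf.memH1 k
      have s2 := hasSum_advect_velocity hβ hU hVW htH k
      have s3 := hasSum_advect_velocity hβ hU hVW hdH k
      have e2 : coeff (advect (velocity β U V W) (f - series t : L2)) k
          = coeff (advect (velocity β U V W) f) k
            - coeff (advect (velocity β U V W) (series t)) k := by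
        refine s3.unique ((s1.sub s2).congr_fun fun j => ?_)
        rw [coeff_sub]; ring
      rw [coeff_advect_eq hβ hU hVW hf.memH1, coeff_advect_eq hβ hU hVW htH, ← mul_sub] at e2
      rw [e2] at e
      have hL : -((len k ^ 2 : ℝ) : ℂ) ≠ 0 := by
        rw [neg_ne_zero]; exact_mod_cast (pow_pos (len_pos hk) 2).ne'
      rw [← mul_left_cancel₀ hL e, coeff_sub, h1 k, htc]
      have h2 := htfix k
      simp only [htc]
      linear_combination -h2
    refine L2.ext_coeff fun k => ?_
    have := hz k
    rwa [coeff_sub, sub_eq_zero] at this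
  · exact ae_im_eq_zero fun k => by rw [htc, htc]; exact htr k
  · refine tendsto_of_coeff_le (summable_len_mul_wgt hβ hκ) (N := N) fun n k => ?_
    rw [(hiter n).1, htc]
    refine (htconv n k).trans ?_
    gcongr
    exact wgt_le_len_mul_wgt hκ k
  · intro i
    refine tendsto_of_coeff_le (summable_len_mul_wgt hβ hκ) (N := N) fun n k => ?_
    rw [coeff_partialD (hiter n).2, coeff_partialD htH, (hiter n).1, htc, ← mul_sub, norm_mul,
      norm_mul, Complex.norm_I, one_mul, ← Complex.ofReal_intCast, Complex.norm_real,
      Real.norm_eq_abs]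
    calc |(k i : ℝ)| * ‖iterCoeff β U V W (fun k => -a k) n k - t k‖
        ≤ len k * (N / 2 ^ n * wgt β κg k) :=
          mul_le_mul (abs_coord_le_len k i) (htconv n k) (norm_nonneg _) (len_nonneg k)
      _ = _ := by ring
  · abel
  · intro κ hκκ
    have hκ1 : 2 ≤ κ := by nlinarith
    have hκ0 : 0 < κ := by linarith
    set ρ : Wave → ℂ := fun k => t k - -a k with hρ
    have hρfix : ∀ k, ρ k = transport β U V W t k := fun k => by
      have := htfix k
      simp only [hρ]; linear_combination this
    have hδ : ∀ k, coeff (series t - (-invLap (source a)) - firstCorr u (source a) : L2) k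
        = transport β U V W ρ k := by
      intro k
      have h0 : coeff (-invLap (source a) : L2) k = -a k := (hiter 0).1 k
      rw [coeff_sub, coeff_sub, htc, h0, hfirst, hρ, transport_sub hβ hU hVW hϖ htb hc₀]
      have := htfix k
      linear_combination this
    have hDN : 0 ≤ D * N := by positivity
    have hbt : ∀ k ≠ 0, ‖t k‖ ≤ C₁ * (D * N) * len k ^ (β - 2) := by
      refine hdecay U Ξ V W hU hVW hUΞ t (fun k => -a k) (D * N) hDN ht0 htfix ?_ ?_
      · intro k hk
        rw [norm_neg]
        refine (haN k hk).trans ?_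
        have p1 : len k ^ α ≤ len k ^ (β - 2) :=
          Real.rpow_le_rpow_of_exponent_le (one_le_len hk) (by linarith)
        have p2 := Real.rpow_nonneg (len_nonneg k) α
        calc N * len k ^ α ≤ (D * N) * len k ^ α := by
              gcongr; exact le_mul_of_one_le_left hN0 hD1
          _ ≤ _ := by gcongr
      · intro k hk
        refine (htb k).trans ?_
        calc 2 * N * wgt β κg k ≤ 2 * N * ((2 * κg) ^ (-β) * len k ^ (β - 1)) := by
              gcongr; exact wgt_le hk
          _ = _ := by rw [hD]; ring
    have hbρ : ∀ k ≠ 0, ‖ρ k‖ ≤ C₂ * (U * Ξ) * (C₁ * (D * N)) * len k ^ (β - 2) := fun k hk => by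
      rw [hρfix]
      exact htrans U Ξ V W hU hVW t _ (by positivity) ht0 hbt k hk
    have hρ0 : ρ 0 = 0 := by simp [hρ, ht0, ha0]
    have hbδ : ∀ k ≠ 0, ‖transport β U V W ρ k‖
        ≤ C₂ * (U * Ξ) * (C₂ * (U * Ξ) * (C₁ * (D * N))) * len k ^ (β - 2) := fun k hk =>
      htrans U Ξ V W hU hVW ρ _ (by positivity) hρ0 hbρ k hk
    have hsumS : ∑ k ∈ shell κ (2 * κ), len k ^ (2 * β - 4) ≤ C₅ * κ ^ (2 * β - 1) := by
      have h := (abs_le.mp (abs_sum_shell_rpow_sub_le (s := 2 * β - 4) (by linarith) hκ1)).2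
      have p1 : κ ^ (2 * β - 4 + 2) ≤ κ ^ (2 * β - 1) :=
        Real.rpow_le_rpow_of_exponent_le (by linarith) (by linarith)
      have e1 : κ ^ (2 * β - 4 + 3) = κ ^ (2 * β - 1) := by congr 1; ring
      have p2 : 4 * Real.pi * κ ^ (2 * β - 1) * i₂ (2 * β - 4 + 3)
          ≤ 4 * Real.pi * κ ^ (2 * β - 1) * |i₂ (2 * β - 4 + 3)| := by
        gcongr; exact le_abs_self _
      have p3 : Real.pi * 4 / 3 * (16 * |2 * β - 4| + 68) * κ ^ (2 * β - 4 + 2)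
          ≤ Real.pi * 4 / 3 * (16 * |2 * β - 4| + 68) * κ ^ (2 * β - 1) := by gcongr
      rw [e1] at h
      rw [hC₅]
      linarith
    rw [normSq_proj]
    calc (2 * Real.pi) ^ 3 * ∑ k ∈ shell κ (2 * κ), ‖coeff _ k‖ ^ 2
        ≤ (2 * Real.pi) ^ 3 * ∑ k ∈ shell κ (2 * κ),
          (C₄ * Ξg * (U * Ξ) ^ 2) ^ 2 * len k ^ (2 * β - 4) := by
          gcongr with k hk
          have hk0 := ne_zero_of_mem_shell hκ0 hk
          rw [hδ]
          calc ‖transport β U V W ρ k‖ ^ 2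
              ≤ (C₂ * (U * Ξ) * (C₂ * (U * Ξ) * (C₁ * (D * N))) * len k ^ (β - 2)) ^ 2 :=
                pow_le_pow_left₀ (norm_nonneg _) (hbδ k hk0) 2
            _ = _ := by
                rw [show 2 * β - 4 = (β - 2) * (2 : ℕ) by push_cast; ring,
                  Real.rpow_mul (len_nonneg k), Real.rpow_natCast, hC₄, hN]
                ring
      _ ≤ (2 * Real.pi) ^ 3 * ((C₄ * Ξg * (U * Ξ) ^ 2) ^ 2 * (C₅ * κ ^ (2 * β - 1))) := by
          rw [← Finset.mul_sum]
          gcongr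
      _ = (2 * Real.pi) ^ 3 * C₄ ^ 2 * C₅ * U ^ 2 * Ξ ^ 2 * Ξg ^ 2 * κ ^ (2 * β - 1)
            * (U * Ξ) ^ 2 := by ring
      _ ≤ (2 * Real.pi) ^ 3 * C₄ ^ 2 * C₅ * U ^ 2 * Ξ ^ 2 * Ξg ^ 2 * κ ^ (2 * β - 1)
            * (ε / (4 * w)) ^ 2 := by gcongr
      _ = _ := by ring

end BHT

namespace BHT

/-! ### The random modes -/

lemma mem_halfSpace_or {k : Wave} (hk : k ≠ 0) : k ∈ halfSpace ∨ -k ∈ halfSpace := by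
  simp only [halfSpace, Set.mem_ofPred_eq, Pi.neg_apply]
  by_contra! h
  apply hk
  funext i
  fin_cases i <;> simp <;> omega

lemma ne_zero_of_mem_halfSpace {k : Wave} (hk : k ∈ halfSpace) : k ≠ 0 := by
  rintro rfl
  simp [halfSpace] at hk

lemma ne_neg_self {k : Wave} (hk : k ≠ 0) : k ≠ -k := fun h => hk (by
  funext i
  have := congrFun h i
  simp only [Pi.neg_apply] at this
  simp only [Pi.zero_apply]
  omega)

section Probability

variable {Ω : Type*} [MeasurableSpace Ω] {P : Measure Ω}

lemma IsProper.ae_norm_le {Z : Ω → ℂ} {ς Ξ : ℝ} (h : IsProper P Z ς Ξ) :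
    ∀ᵐ ω ∂P, ‖Z ω‖ ≤ Ξ := by
  have h1 : ∀ n : ℕ, ∀ᵐ ω ∂P, ‖Z ω‖ ≤ Ξ + 1 / (n + 1 : ℝ) := by
    intro n
    rw [ae_iff]
    simp only [not_le]
    by_contra hne
    have h2 := h.bounded.1 (show Ξ + 1 / (n + 1 : ℝ) ∈ _ from pos_iff_ne_zero.mpr hne)
    have : (0 : ℝ) < 1 / (n + 1 : ℝ) := by positivity
    linarith
  filter_upwards [ae_all_iff.mpr h1] with ω hω
  refine le_of_forall_pos_le_add fun ε hε => ?_
  obtain ⟨n, hn⟩ := exists_nat_one_div_lt hε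
  exact (hω n).trans (by linarith)

variable {V W : Wave → Ω → ℂ} {ς Ξ : ℝ}

/-- Almost surely all the modes are bounded and hermitian. -/
lemma IsVelocityModes.ae_isBoundedModes (h : IsVelocityModes P V W ς Ξ) :
    ∀ᵐ ω ∂P, IsBoundedModes Ξ (fun k => V k ω) (fun k => W k ω) := by
  have h1 : ∀ᵐ ω ∂P, ∀ k : Wave, k ≠ 0 → ‖V k ω‖ ≤ Ξ ∧ ‖W k ω‖ ≤ Ξ ∧
      V (-k) ω = -conj (V k ω) ∧ W (-k) ω = conj (W k ω) := by
    rw [ae_all_iff]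
    intro k
    by_cases hk : k = 0
    · simp [hk]
    filter_upwards [(h.properV k hk).ae_norm_le, (h.properW k hk).ae_norm_le, h.realV k hk,
      h.realW k hk] with ω a b c d _
    exact ⟨a, b, c, d⟩
  filter_upwards [h1] with ω hω
  exact ⟨fun k hk => (hω k hk).1, fun k hk => (hω k hk).2.1, fun k hk => (hω k hk).2.2.1,
    fun k hk => (hω k hk).2.2.2⟩

/-- The velocity modes as one family, `(m, true)` standing for `V_m` and `(m, false)` for
`W_m`. -/
def modeVar (V W : Wave → Ω → ℂ) (a : Wave × Bool) (ω : Ω) : ℂ :=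
  if a.2 then V a.1 ω else W a.1 ω

/-- The independent modes, those on the half space. -/
def baseVar (V W : Wave → Ω → ℂ) : halfSpace ⊕ halfSpace → Ω → ℂ :=
  Sum.elim (fun k : halfSpace => V k.1) (fun k : halfSpace => W k.1)

open Classical in
/-- All the modes expressed by those on the half space. -/
noncomputable def extendModes (x : halfSpace ⊕ halfSpace → ℂ) (a : Wave × Bool) : ℂ :=
  if h : a.1 ∈ halfSpace then (if a.2 then x (.inl ⟨a.1, h⟩) else x (.inr ⟨a.1, h⟩))
  else if h : -a.1 ∈ halfSpace then
    (if a.2 then -conj (x (.inl ⟨-a.1, h⟩)) else conj (x (.inr ⟨-a.1, h⟩)))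
  else 0

lemma measurable_extendModes : Measurable extendModes := by
  rw [measurable_pi_iff]
  intro a
  unfold extendModes
  split_ifs <;> first
    | exact measurable_pi_apply _
    | exact (Complex.continuous_conj.measurable.comp (measurable_pi_apply _)).neg
    | exact Complex.continuous_conj.measurable.comp (measurable_pi_apply _)
    | exact measurable_const

lemma IsVelocityModes.ae_modeVar_eq (h : IsVelocityModes P V W ς Ξ) :
    ∀ᵐ ω ∂P, ∀ a : Wave × Bool, a.1 ≠ 0 →
      modeVar V W a ω = extendModes (fun p => baseVar V W p ω) a := by
  filter_upwards [h.ae_isBoundedModes] with ω hω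
  rintro ⟨m, b⟩ hm
  by_cases hH : m ∈ halfSpace
  · simp [modeVar, extendModes, baseVar, hH]
  · have hH' : -m ∈ halfSpace := (mem_halfSpace_or hm).resolve_left hH
    have hV := hω.realV m hm
    have hW := hω.realW m hm
    simp only [modeVar, extendModes, hH, hH', dite_true, dite_false, baseVar, Sum.elim_inl,
      Sum.elim_inr, hV, hW]
    simp

lemma measurable_baseVar (h : IsVelocityModes P V W ς Ξ) (p : halfSpace ⊕ halfSpace) :
    Measurable (baseVar V W p) := by
  rcases p with k | k
  · exact (h.properV k.1 (ne_zero_of_mem_halfSpace k.2)).measurable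
  · exact (h.properW k.1 (ne_zero_of_mem_halfSpace k.2)).measurable

/-- Independence and circularity make the joint law of all the modes invariant under a rotation of
each of them by a phase, if the phases of opposite wave vectors are opposite. -/
lemma IsVelocityModes.integral_phase [IsProbabilityMeasure P] (h : IsVelocityModes P V W ς Ξ)
    {s : Wave × Bool → ℝ} (hs : ∀ m b, s (-m, b) = -s (m, b)) {f : (Wave × Bool → ℂ) → ℂ}
    (hf : Measurable f) :
    ∫ ω, f (fun a => Complex.exp (s a * Complex.I) * extendModes (fun p => baseVar V W p ω) a) ∂P
      = ∫ ω, f (extendModes fun p => baseVar V W p ω) ∂P := by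
  let r : halfSpace ⊕ halfSpace → ℝ :=
    Sum.elim (fun k : halfSpace => s (k.1, true)) (fun k : halfSpace => s (k.1, false))
  have hm := measurable_baseVar h
  have hr : ∀ p, Measurable fun ω => Complex.exp (r p * Complex.I) * baseVar V W p ω :=
    fun p => (hm p).const_mul _
  have hind : iIndepFun (fun p ω => Complex.exp (r p * Complex.I) * baseVar V W p ω) P :=
    h.indep.comp (fun p z => Complex.exp (r p * Complex.I) * z) fun p => measurable_const_mul _
  have hlaw : P.map (fun ω p => Complex.exp (r p * Complex.I) * baseVar V W p ω)
      = P.map (fun ω p => baseVar V W p ω) := by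
    have h1 := hind.map_fun_eq_infinitePi_map hr
    have h2 := iIndepFun.map_fun_eq_infinitePi_map hm h.indep
    rw [h1, h2]
    congr 1
    funext p
    rcases p with k | k
    · exact ((h.properV k.1 (ne_zero_of_mem_halfSpace k.2)).circular _).map_eq
    · exact ((h.properW k.1 (ne_zero_of_mem_halfSpace k.2)).circular _).map_eq
  have hext : ∀ x : halfSpace ⊕ halfSpace → ℂ,
      (fun a => Complex.exp (s a * Complex.I) * extendModes x a)
        = extendModes fun p => Complex.exp (r p * Complex.I) * x p := by
    intro x
    funext a
    obtain ⟨m, b⟩ := a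
    have hconj : ∀ t : ℝ, conj (Complex.exp (t * Complex.I)) = Complex.exp (-t * Complex.I) := by
      intro t
      rw [← Complex.exp_conj]; simp
    have hsm : ∀ b, s (m, b) = -s (-m, b) := fun b => by rw [hs, neg_neg]
    simp only [extendModes, r]
    split_ifs with h1 h2 h3 h4
    · simp [h2]
    · simp [h2]
    · simp only [h4, Sum.elim_inl, map_mul, hconj, hsm]
      push_cast; ring
    · simp only [h4, Sum.elim_inr, map_mul, hconj, hsm]
      push_cast; ring
    · simp
  have hF : Measurable fun x : halfSpace ⊕ halfSpace → ℂ => f (extendModes x) :=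
    hf.comp measurable_extendModes
  simp only [hext]
  rw [← integral_map (φ := fun ω p => Complex.exp (r p * Complex.I) * baseVar V W p ω)
      (f := fun x => f (extendModes x)) (measurable_pi_iff.mpr hr).aemeasurable
      hF.aestronglyMeasurable, hlaw,
    integral_map (measurable_pi_iff.mpr hm).aemeasurable hF.aestronglyMeasurable]

/-- A fourth moment vanishes unless its phase is invariant. -/
lemma IsVelocityModes.moment_eq_zero [IsProbabilityMeasure P] (h : IsVelocityModes P V W ς Ξ)
    {s : Wave × Bool → ℝ} (hs : ∀ m b, s (-m, b) = -s (m, b)) {a b c d : Wave × Bool}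
    (ha : a.1 ≠ 0) (hb : b.1 ≠ 0) (hc : c.1 ≠ 0) (hd : d.1 ≠ 0)
    (hne : Complex.exp (((s a - s b - s c + s d : ℝ) : ℂ) * Complex.I) ≠ 1) :
    ∫ ω, modeVar V W a ω * conj (modeVar V W b ω)
      * (conj (modeVar V W c ω) * modeVar V W d ω) ∂P = 0 := by
  set f : (Wave × Bool → ℂ) → ℂ := fun x => x a * conj (x b) * (conj (x c) * x d) with hf
  have hfm : Measurable f := by
    have hc' : ∀ a : Wave × Bool, Measurable fun x : Wave × Bool → ℂ => conj (x a) := fun a =>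
      Complex.continuous_conj.measurable.comp (measurable_pi_apply a)
    exact ((measurable_pi_apply a).mul (hc' b)).mul ((hc' c).mul (measurable_pi_apply d))
  have e : ∫ ω, modeVar V W a ω * conj (modeVar V W b ω)
      * (conj (modeVar V W c ω) * modeVar V W d ω) ∂P
      = ∫ ω, f (extendModes fun p => baseVar V W p ω) ∂P := by
    apply integral_congr_ae
    filter_upwards [h.ae_modeVar_eq] with ω hω
    rw [hf, hω a ha, hω b hb, hω c hc, hω d hd]
  have h1 := h.integral_phase hs hfm
  have h2 : ∀ ω, f (fun a => Complex.exp (s a * Complex.I)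
      * extendModes (fun p => baseVar V W p ω) a)
      = Complex.exp (((s a - s b - s c + s d : ℝ) : ℂ) * Complex.I)
        * f (extendModes fun p => baseVar V W p ω) := by
    intro ω
    have hconj : ∀ t : ℝ, conj (Complex.exp (t * Complex.I)) = Complex.exp (-t * Complex.I) := by
      intro t
      rw [← Complex.exp_conj]; simp
    have he : Complex.exp (((s a - s b - s c + s d : ℝ) : ℂ) * Complex.I)
        = Complex.exp (s a * Complex.I) * Complex.exp (-s b * Complex.I)
          * (Complex.exp (-s c * Complex.I) * Complex.exp (s d * Complex.I)) := by
      rw [← Complex.exp_add, ← Complex.exp_add, ← Complex.exp_add]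
      congr 1; push_cast; ring
    simp only [hf, map_mul, hconj, he]
    ring
  simp only [h2] at h1
  rw [integral_const_mul] at h1
  rw [e]
  have h3 : (Complex.exp (((s a - s b - s c + s d : ℝ) : ℂ) * Complex.I) - 1)
      * ∫ ω, f (extendModes fun p => baseVar V W p ω) ∂P = 0 := by
    rw [sub_mul, one_mul, h1, sub_self]
  exact (mul_eq_zero.mp h3).resolve_left (sub_ne_zero.mpr hne)

/-- The mode with the opposite wave vector; it is determined by the original mode. -/
def flipMode (a : Wave × Bool) : Wave × Bool := (-a.1, a.2)

@[simp] lemma flipMode_flipMode (a : Wave × Bool) : flipMode (flipMode a) = a := by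
  simp [flipMode]

lemma ne_flipMode {a : Wave × Bool} (ha : a.1 ≠ 0) : a ≠ flipMode a := fun h =>
  ne_neg_self ha (congrArg Prod.fst h)

open Classical in
/-- The phases that rotate the mode `a` by `π / 2`, its opposite by `-π / 2`, and no other mode. -/
noncomputable def phaseAt (a c : Wave × Bool) : ℝ :=
  Real.pi / 2 * ((if c = a then 1 else 0) - (if c = flipMode a then 1 else 0))

lemma phaseAt_neg (a : Wave × Bool) (m : Wave) (b : Bool) :
    phaseAt a (-m, b) = -phaseAt a (m, b) := by
  have h1 : ((-m, b) = a) ↔ ((m, b) = flipMode a) := by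
    constructor
    · rintro rfl; simp [flipMode]
    · intro h; rw [← flipMode_flipMode a, ← h]; rfl
  have h2 : ((-m, b) = flipMode a) ↔ ((m, b) = a) := by
    constructor
    · intro h; rw [← flipMode_flipMode a, ← h]; simp [flipMode]
    · rintro rfl; rfl
  simp only [phaseAt, h1, h2]
  ring

lemma phaseAt_self {a : Wave × Bool} (ha : a.1 ≠ 0) : phaseAt a a = Real.pi / 2 := by
  simp [phaseAt, ne_flipMode ha]

lemma phaseAt_flip {a : Wave × Bool} (ha : a.1 ≠ 0) : phaseAt a (flipMode a) = -(Real.pi / 2) := by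
  simp [phaseAt, (ne_flipMode ha).symm]

lemma phaseAt_of_ne {a c : Wave × Bool} (h1 : c ≠ a) (h2 : c ≠ flipMode a) : phaseAt a c = 0 := by
  simp [phaseAt, h1, h2]

lemma exp_half_pi_ne : Complex.exp (((Real.pi / 2 : ℝ) : ℂ) * Complex.I) ≠ 1 := by
  push_cast
  rw [Complex.exp_pi_div_two_mul_I]
  intro h
  simpa using congrArg Complex.im h

lemma exp_neg_half_pi_ne : Complex.exp (((-(Real.pi / 2) : ℝ) : ℂ) * Complex.I) ≠ 1 := by
  push_cast
  rw [neg_mul, Complex.exp_neg, Complex.exp_pi_div_two_mul_I]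
  intro h
  simpa using congrArg Complex.im h

lemma exp_pi_ne : Complex.exp ((Real.pi : ℂ) * Complex.I) ≠ 1 := by
  rw [Complex.exp_pi_mul_I]; norm_num

lemma exp_neg_pi_ne : Complex.exp (((-Real.pi : ℝ) : ℂ) * Complex.I) ≠ 1 := by
  push_cast
  rw [neg_mul, Complex.exp_neg, Complex.exp_pi_mul_I]; norm_num

/-- Two modes other than `a` or its opposite do not compensate the phase of `a`. -/
lemma IsVelocityModes.moment_eq_zero_of_ne [IsProbabilityMeasure P]
    (h : IsVelocityModes P V W ς Ξ) {a b c d : Wave × Bool}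
    (ha : a.1 ≠ 0) (hb : b.1 ≠ 0) (hc : c.1 ≠ 0) (hd : d.1 ≠ 0) (hab : a ≠ b)
    (hab' : a ≠ flipMode b) (hcd : c ≠ d) (hcd' : c ≠ flipMode d)
    (h1 : ¬(c = a ∧ d = b)) (h2 : ¬(c = flipMode b ∧ d = flipMode a)) :
    ∫ ω, modeVar V W a ω * conj (modeVar V W b ω)
      * (conj (modeVar V W c ω) * modeVar V W d ω) ∂P = 0 := by
  have hba' : b ≠ flipMode a := fun e => hab' (by rw [e, flipMode_flipMode])
  have hdc' : d ≠ flipMode c := fun e => hcd' (by rw [e, flipMode_flipMode])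
  by_cases hA : c = a ∨ d = flipMode a
  -- the phase of `b` is not compensated
  · have hB : c ≠ flipMode b ∧ d ≠ b := by
      rcases hA with rfl | rfl
      · exact ⟨hab', fun e => h1 ⟨rfl, e⟩⟩
      · exact ⟨fun e => h2 ⟨e, rfl⟩, fun e => hab' (by rw [← e, flipMode_flipMode])⟩
    refine h.moment_eq_zero (phaseAt_neg b) ha hb hc hd ?_
    rw [phaseAt_self hb, phaseAt_of_ne hab hab']
    by_cases hcb : c = b
    · subst hcb
      rw [phaseAt_self hb, phaseAt_of_ne hcd.symm hdc']
      convert exp_neg_pi_ne using 4; ring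
    rw [phaseAt_of_ne hcb hB.1]
    by_cases hdb : d = flipMode b
    · subst hdb
      rw [phaseAt_flip hb]
      convert exp_neg_pi_ne using 4; ring
    rw [phaseAt_of_ne hB.2 hdb]
    convert exp_neg_half_pi_ne using 4; ring
  · push Not at hA
    refine h.moment_eq_zero (phaseAt_neg a) ha hb hc hd ?_
    rw [phaseAt_self ha, phaseAt_of_ne hab.symm hba']
    by_cases hca : c = flipMode a
    · subst hca
      have hda : d ≠ a := fun e => hdc' (by rw [e, flipMode_flipMode])
      rw [phaseAt_flip ha, phaseAt_of_ne hda hA.2]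
      convert exp_pi_ne using 4; ring
    rw [phaseAt_of_ne hA.1 hca]
    by_cases hda : d = a
    · subst hda
      rw [phaseAt_self ha]
      convert exp_pi_ne using 4; ring
    rw [phaseAt_of_ne hda hA.2]
    convert exp_half_pi_ne using 4; ring

lemma IsVelocityModes.moment_diag_eq_zero [IsProbabilityMeasure P]
    (h : IsVelocityModes P V W ς Ξ) {a b c : Wave × Bool}
    (ha : a.1 ≠ 0) (hb : b.1 ≠ 0) (hc : c.1 ≠ 0) (hab : a ≠ b) (hab' : a ≠ flipMode b) :
    ∫ ω, modeVar V W a ω * conj (modeVar V W b ω)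
      * (conj (modeVar V W c ω) * modeVar V W c ω) ∂P = 0 := by
  have hba' : b ≠ flipMode a := fun e => hab' (by rw [e, flipMode_flipMode])
  refine h.moment_eq_zero (phaseAt_neg a) ha hb hc hc ?_
  rw [phaseAt_self ha, phaseAt_of_ne hab.symm hba']
  convert exp_half_pi_ne using 4; ring

lemma IsVelocityModes.covariance_eq_zero [IsProbabilityMeasure P]
    (h : IsVelocityModes P V W ς Ξ) {a b : Wave × Bool} (ha : a.1 ≠ 0) (hb : b.1 ≠ 0)
    (hab : a ≠ b) : ∫ ω, modeVar V W a ω * conj (modeVar V W b ω) ∂P = 0 := by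
  set f : (Wave × Bool → ℂ) → ℂ := fun x => x a * conj (x b) with hf
  have hfm : Measurable f :=
    (measurable_pi_apply a).mul (Complex.continuous_conj.measurable.comp (measurable_pi_apply b))
  have e : ∫ ω, modeVar V W a ω * conj (modeVar V W b ω) ∂P
      = ∫ ω, f (extendModes fun p => baseVar V W p ω) ∂P := by
    apply integral_congr_ae
    filter_upwards [h.ae_modeVar_eq] with ω hω
    rw [hf, hω a ha, hω b hb]
  have h1 := h.integral_phase (phaseAt_neg a) hfm
  have h2 : ∀ ω, f (fun c => Complex.exp (phaseAt a c * Complex.I)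
      * extendModes (fun p => baseVar V W p ω) c)
      = Complex.exp (((phaseAt a a - phaseAt a b : ℝ) : ℂ) * Complex.I)
        * f (extendModes fun p => baseVar V W p ω) := by
    intro ω
    have he : Complex.exp (((phaseAt a a - phaseAt a b : ℝ) : ℂ) * Complex.I)
        = Complex.exp (phaseAt a a * Complex.I) * conj (Complex.exp (phaseAt a b * Complex.I)) := by
      rw [← Complex.exp_conj, ← Complex.exp_add]
      congr 1; simp; ring
    simp only [hf, map_mul, he]
    ring
  simp only [h2] at h1
  rw [integral_const_mul] at h1
  have hne : Complex.exp (((phaseAt a a - phaseAt a b : ℝ) : ℂ) * Complex.I) ≠ 1 := by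
    rw [phaseAt_self ha]
    by_cases hba : b = flipMode a
    · rw [hba, phaseAt_flip ha]
      convert exp_pi_ne using 4; ring
    · rw [phaseAt_of_ne hab.symm hba]
      convert exp_half_pi_ne using 4; ring
  rw [e]
  have h3 : (Complex.exp (((phaseAt a a - phaseAt a b : ℝ) : ℂ) * Complex.I) - 1)
      * ∫ ω, f (extendModes fun p => baseVar V W p ω) ∂P = 0 := by
    rw [sub_mul, one_mul, h1, sub_self]
  exact (mul_eq_zero.mp h3).resolve_left (sub_ne_zero.mpr hne)

lemma IsVelocityModes.isProper_modeVar (h : IsVelocityModes P V W ς Ξ) {a : Wave × Bool}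
    (ha : a.1 ≠ 0) : IsProper P (modeVar V W a) ς Ξ := by
  obtain ⟨m, b⟩ := a
  cases b
  · exact h.properW m ha
  · exact h.properV m ha

lemma IsVelocityModes.ae_norm_flip (h : IsVelocityModes P V W ς Ξ) {a : Wave × Bool}
    (ha : a.1 ≠ 0) : ∀ᵐ ω ∂P, ‖modeVar V W (flipMode a) ω‖ = ‖modeVar V W a ω‖ := by
  filter_upwards [h.ae_isBoundedModes] with ω hω
  obtain ⟨m, b⟩ := a
  cases b
  · simp [modeVar, flipMode, hω.realW m ha]
  · simp [modeVar, flipMode, hω.realV m ha]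

/-- Modes that are neither equal nor opposite have independent moduli. -/
lemma IsVelocityModes.integral_norm_sq_mul [IsProbabilityMeasure P]
    (h : IsVelocityModes P V W ς Ξ) {a b : Wave × Bool} (ha : a.1 ≠ 0) (hb : b.1 ≠ 0)
    (hab : a ≠ b) (hab' : a ≠ flipMode b) :
    ∫ ω, ‖modeVar V W a ω‖ ^ 2 * ‖modeVar V W b ω‖ ^ 2 ∂P = 1 := by
  have hba' : b ≠ flipMode a := fun e => hab' (by rw [e, flipMode_flipMode])
  have key : ∀ a b : Wave × Bool, a.1 ∈ halfSpace → b.1 ∈ halfSpace → a ≠ b →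
      ∫ ω, ‖modeVar V W a ω‖ ^ 2 * ‖modeVar V W b ω‖ ^ 2 ∂P = 1 := by
    intro a b ha hb hab
    let idx : ∀ a : Wave × Bool, a.1 ∈ halfSpace → halfSpace ⊕ halfSpace :=
      fun a ha => if a.2 then .inl ⟨a.1, ha⟩ else .inr ⟨a.1, ha⟩
    have hidx : ∀ (a : Wave × Bool) (ha : a.1 ∈ halfSpace),
        baseVar V W (idx a ha) = modeVar V W a := by
      rintro ⟨m, s⟩ ha
      cases s <;> rfl
    have hinj : idx a ha ≠ idx b hb := by
      obtain ⟨m, s⟩ := a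
      obtain ⟨n, t⟩ := b
      cases s <;> cases t <;> simp_all [idx]
    have hi : IndepFun (modeVar V W a) (modeVar V W b) P := by
      rw [← hidx a ha, ← hidx b hb]
      exact h.indep.indepFun hinj
    have pa := h.isProper_modeVar (ne_zero_of_mem_halfSpace ha)
    have pb := h.isProper_modeVar (ne_zero_of_mem_halfSpace hb)
    have hm : Measurable fun z : ℂ => ‖z‖ ^ 2 := measurable_norm.pow_const 2
    have hi2 := hi.comp hm hm
    have := hi2.integral_mul_eq_mul_integral (hm.comp pa.measurable).aestronglyMeasurable
      (hm.comp pb.measurable).aestronglyMeasurable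
    simp only [Pi.mul_apply, Function.comp_apply, pa.second, pb.second, mul_one] at this
    exact this
  have hflip := fun {a : Wave × Bool} (ha : a.1 ≠ 0) => h.ae_norm_flip ha
  rcases mem_halfSpace_or ha with h1 | h1 <;> rcases mem_halfSpace_or hb with h2 | h2
  · exact key a b h1 h2 hab
  · rw [← key a (flipMode b) h1 h2 hab']
    apply integral_congr_ae
    filter_upwards [hflip hb] with ω e; rw [e]
  · rw [← key (flipMode a) b h1 h2 hba'.symm]
    apply integral_congr_ae
    filter_upwards [hflip ha] with ω e; rw [e]
  · rw [← key (flipMode a) (flipMode b) h1 h2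
      fun e => hab (by rw [← flipMode_flipMode a, e, flipMode_flipMode])]
    apply integral_congr_ae
    filter_upwards [hflip ha, hflip hb] with ω e e'; rw [e, e']

end Probability

end BHT

namespace BHT

/-! ### Second moments of the first correction -/

section Orthogonal

variable {Ω : Type*} [MeasurableSpace Ω] {P : Measure Ω} [IsProbabilityMeasure P]

/-- The Pythagorean theorem in expectation for a summably bounded orthogonal family. -/
lemma integral_norm_sq_tsum {ι : Type*} [Countable ι] {X : ι → Ω → ℂ} {b : ι → ℝ}
    (hX : ∀ i, AEStronglyMeasurable (X i) P) (hb : Summable b)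
    (hXb : ∀ᵐ ω ∂P, ∀ i, ‖X i ω‖ ≤ b i)
    (horth : ∀ i j, i ≠ j → ∫ ω, X i ω * conj (X j ω) ∂P = 0) :
    Integrable (fun ω => ‖∑' i, X i ω‖ ^ 2) P ∧
      HasSum (fun i => ∫ ω, ‖X i ω‖ ^ 2 ∂P) (∫ ω, ‖∑' i, X i ω‖ ^ 2 ∂P) := by
  have hb0 : ∀ i, 0 ≤ b i := by
    obtain ⟨ω, hω⟩ := hXb.exists
    exact fun i => (norm_nonneg _).trans (hω i)
  have hFm : ∀ p : ι × ι, AEStronglyMeasurable (fun ω => X p.1 ω * conj (X p.2 ω)) P := fun p =>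
    (hX p.1).mul (Complex.continuous_conj.comp_aestronglyMeasurable (hX p.2))
  have hFb : ∀ p : ι × ι, ∀ᵐ ω ∂P, ‖X p.1 ω * conj (X p.2 ω)‖ ≤ b p.1 * b p.2 := fun p => by
    filter_upwards [hXb] with ω hω
    rw [norm_mul, RCLike.norm_conj]
    exact mul_le_mul (hω _) (hω _) (norm_nonneg _) (hb0 _)
  have hFi : ∀ p : ι × ι, Integrable (fun ω => X p.1 ω * conj (X p.2 ω)) P := fun p =>
    Integrable.of_bound (hFm p) _ (hFb p)
  have hbb : Summable fun p : ι × ι => b p.1 * b p.2 := hb.mul_of_nonneg hb hb0 hb0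
  have hsum : Summable fun p : ι × ι => ∫ ω, ‖X p.1 ω * conj (X p.2 ω)‖ ∂P := by
    refine Summable.of_nonneg_of_le (fun p => integral_nonneg fun ω => norm_nonneg _) (fun p => ?_)
      hbb
    have := integral_mono_ae (hFi p).norm (integrable_const (b p.1 * b p.2)) (hFb p)
    simpa using this
  have hS := hasSum_integral_of_summable_integral_norm hFi hsum
  have hval : ∀ᵐ ω ∂P, ∑' p : ι × ι, X p.1 ω * conj (X p.2 ω)
      = ((‖∑' i, X i ω‖ ^ 2 : ℝ) : ℂ) := by
    filter_upwards [hXb] with ω hω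
    have h1 : Summable fun i => ‖X i ω‖ := Summable.of_nonneg_of_le (fun i => norm_nonneg _) hω hb
    have h2 : Summable fun i => ‖conj (X i ω)‖ := by simpa using h1
    rw [← tsum_mul_tsum_of_summable_norm h1 h2, ← Complex.conj_tsum, Complex.mul_conj,
      Complex.normSq_eq_norm_sq]
  rw [integral_congr_ae hval, integral_complex_ofReal] at hS
  have hdiag : ∀ i, ∫ ω, X i ω * conj (X i ω) ∂P = ((∫ ω, ‖X i ω‖ ^ 2 ∂P : ℝ) : ℂ) := by
    intro i
    rw [← integral_complex_ofReal]
    refine integral_congr_ae (Eventually.of_forall fun ω => ?_)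
    simp only [Complex.mul_conj, Complex.normSq_eq_norm_sq]
  constructor
  · refine Integrable.of_bound (C := (∑' i, b i) ^ 2) ?_ ?_
    · have : AEMeasurable (fun ω => ∑' i, X i ω) P := AEMeasurable.tsum fun i => (hX i).aemeasurable
      exact (this.norm.pow_const 2).aestronglyMeasurable
    · filter_upwards [hXb] with ω hω
      rw [Real.norm_eq_abs, abs_of_nonneg (sq_nonneg _)]
      exact pow_le_pow_left₀ (norm_nonneg _) (tsum_of_norm_bounded hb.hasSum hω) 2
  · have hinj : Function.Injective fun i : ι => (i, i) := fun i j h => (Prod.mk.inj h).1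
    have h3 := (hinj.hasSum_iff (f := fun p : ι × ι => ∫ ω, X p.1 ω * conj (X p.2 ω) ∂P)
      (fun p hp => horth p.1 p.2 fun h => hp ⟨p.1, Prod.ext rfl h⟩)).mpr hS
    simp only [Function.comp_def, hdiag] at h3
    exact_mod_cast h3

end Orthogonal

section FirstCorrection

variable {Ω : Type*} [MeasurableSpace Ω] {P : Measure Ω} {V W Z : Wave → Ω → ℂ}
  {ς Ξ Ξg β U : ℝ}

/-- The facts about the random factors of the source that both the deterministic and the random
source satisfy. -/
structure IsSourceFactor (P : Measure Ω) (V W Z : Wave → Ω → ℂ) (Ξg : ℝ) : Prop where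
  measurable : ∀ k ≠ 0, Measurable (Z k)
  bound : ∀ᵐ ω ∂P, ∀ k ≠ 0, ‖Z k ω‖ ≤ Ξg
  real : ∀ᵐ ω ∂P, ∀ k ≠ 0, Z (-k) ω = conj (Z k ω)
  second : ∀ k ≠ 0, ∫ ω, ‖Z k ω‖ ^ 2 ∂P = 1
  indep : IndepFun (fun ω => (fun k : halfSpace => V k.1 ω, fun k : halfSpace => W k.1 ω))
    (fun ω => fun k : halfSpace => Z k.1 ω) P

lemma isSourceFactor_of [IsProbabilityMeasure P]
    (h : (∀ k ω, Z k ω = 1) ∧ Ξg = 1 ∨ ∃ ϱ : ℝ, IsRandomSource P V W Z ϱ Ξg) :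
    IsSourceFactor P V W Z Ξg := by
  rcases h with ⟨h1, rfl⟩ | ⟨ϱ, h⟩
  · have hZ : ∀ k, Z k = fun _ => 1 := fun k => funext (h1 k)
    refine ⟨fun k _ => ?_, ?_, ?_, fun k _ => ?_, ?_⟩
    · rw [hZ]; exact measurable_const
    · exact Eventually.of_forall fun ω k _ => by simp [h1]
    · exact Eventually.of_forall fun ω k _ => by simp [h1]
    · simp [hZ]
    · simp only [h1]
      exact indepFun_const_right _ _
  · refine ⟨fun k hk => (h.proper k hk).measurable, ?_, ?_, fun k hk => (h.proper k hk).second,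
      h.indep⟩
    · rw [ae_all_iff]
      intro k
      by_cases hk : k = 0
      · simp [hk]
      · filter_upwards [(h.proper k hk).ae_norm_le] with ω hω _ using hω
    · rw [ae_all_iff]
      intro k
      by_cases hk : k = 0
      · simp [hk]
      · filter_upwards [h.real k hk] with ω hω _ using hω

open Classical in
/-- The factors of a random source expressed by those on the half space. -/
noncomputable def extendSource (z : halfSpace → ℂ) (k : Wave) : ℂ :=
  if h : k ∈ halfSpace then z ⟨k, h⟩
  else if h : -k ∈ halfSpace then conj (z ⟨-k, h⟩) else 0

lemma measurable_extendSource (k : Wave) : Measurable fun z => extendSource z k := by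
  unfold extendSource
  split_ifs
  · exact measurable_pi_apply _
  · exact Complex.continuous_conj.measurable.comp (measurable_pi_apply _)
  · exact measurable_const

lemma IsSourceFactor.ae_eq (h : IsSourceFactor P V W Z Ξg) :
    ∀ᵐ ω ∂P, ∀ k ≠ 0, Z k ω = extendSource (fun l : halfSpace => Z l.1 ω) k := by
  filter_upwards [h.real] with ω hω k hk
  by_cases hH : k ∈ halfSpace
  · simp [extendSource, hH]
  · have hH' : -k ∈ halfSpace := (mem_halfSpace_or hk).resolve_left hH
    simp [extendSource, hH, hH', hω k hk]

/-- A second moment of the velocity modes factors out of an expectation with the source. -/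
lemma integral_mode_mul_source [IsProbabilityMeasure P] (h : IsVelocityModes P V W ς Ξ)
    (hZ : IsSourceFactor P V W Z Ξg) {a b : Wave × Bool} {i j : Wave} (ha : a.1 ≠ 0)
    (hb : b.1 ≠ 0) (hi : i ≠ 0) (hj : j ≠ 0) :
    ∫ ω, modeVar V W a ω * conj (modeVar V W b ω) * (Z i ω * conj (Z j ω)) ∂P
      = (∫ ω, modeVar V W a ω * conj (modeVar V W b ω) ∂P) * ∫ ω, Z i ω * conj (Z j ω) ∂P := by
  let f : (halfSpace → ℂ) × (halfSpace → ℂ) → ℂ := fun x =>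
    extendModes (Sum.elim x.1 x.2) a * conj (extendModes (Sum.elim x.1 x.2) b)
  let g : (halfSpace → ℂ) → ℂ := fun z => extendSource z i * conj (extendSource z j)
  have hconj := Complex.continuous_conj.measurable
  have helim : Measurable fun x : (halfSpace → ℂ) × (halfSpace → ℂ) => Sum.elim x.1 x.2 := by
    rw [measurable_pi_iff]
    rintro (k | k)
    · exact (measurable_pi_apply k).comp measurable_fst
    · exact (measurable_pi_apply k).comp measurable_snd
  have hx : ∀ a : Wave × Bool, Measurable fun x : (halfSpace → ℂ) × (halfSpace → ℂ) =>
      extendModes (Sum.elim x.1 x.2) a := fun a =>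
    ((measurable_pi_apply a).comp measurable_extendModes).comp helim
  have hf : Measurable f := (hx a).mul (hconj.comp (hx b))
  have hg : Measurable g :=
    (measurable_extendSource i).mul (hconj.comp (measurable_extendSource j))
  have hVW : Measurable fun ω => (fun k : halfSpace => V k.1 ω, fun k : halfSpace => W k.1 ω) := by
    refine Measurable.prodMk ?_ ?_ <;> rw [measurable_pi_iff] <;> intro k
    · exact (h.properV k.1 (ne_zero_of_mem_halfSpace k.2)).measurable
    · exact (h.properW k.1 (ne_zero_of_mem_halfSpace k.2)).measurable
  have hZm : Measurable fun ω => fun k : halfSpace => Z k.1 ω :=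
    measurable_pi_iff.mpr fun k => hZ.measurable k.1 (ne_zero_of_mem_halfSpace k.2)
  have hind := hZ.indep.comp hf hg
  have := hind.integral_mul_eq_mul_integral (hf.comp hVW).aestronglyMeasurable
    (hg.comp hZm).aestronglyMeasurable
  have hbase : ∀ ω, Sum.elim (fun k : halfSpace => V k.1 ω) (fun k : halfSpace => W k.1 ω)
      = fun p => baseVar V W p ω := fun ω => by
    funext p; rcases p with k | k <;> rfl
  have e1 : ∀ᵐ ω ∂P, modeVar V W a ω * conj (modeVar V W b ω)
      = f (fun k : halfSpace => V k.1 ω, fun k : halfSpace => W k.1 ω) := by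
    filter_upwards [h.ae_modeVar_eq] with ω hω
    simp only [f, hbase, hω a ha, hω b hb]
  have e2 : ∀ᵐ ω ∂P, Z i ω * conj (Z j ω) = g (fun k : halfSpace => Z k.1 ω) := by
    filter_upwards [hZ.ae_eq] with ω hω
    simp only [g, hω i hi, hω j hj]
  rw [integral_congr_ae e1, integral_congr_ae e2]
  refine Eq.trans ?_ this
  apply integral_congr_ae
  filter_upwards [e1, e2] with ω h1 h2
  rw [h1, h2]; rfl

lemma modeAdv_eq {Ω' : Type*} (V W : Wave → Ω' → ℂ) (j m : Wave) (ω : Ω') :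
    modeAdv β U (fun k => V k ω) (fun k => W k ω) j m
      = ((U * len m ^ β * edot j m : ℝ) : ℂ) * modeVar V W (m, true) ω
        + ((U * len m ^ β * fdot j m : ℝ) : ℂ) * modeVar V W (m, false) ω := by
  simp only [modeAdv, modeVar]
  push_cast; ring

lemma measurable_modeAdv (hβ : β < -2) (h : IsVelocityModes P V W ς Ξ) (j m : Wave) :
    Measurable fun ω => modeAdv β U (fun k => V k ω) (fun k => W k ω) j m := by
  by_cases hm : m = 0
  · simp only [hm, modeAdv_zero hβ]; exact measurable_const
  · simp only [modeAdv_eq]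
    exact ((h.isProper_modeVar (a := (m, true)) hm).measurable.const_mul _).add
      ((h.isProper_modeVar (a := (m, false)) hm).measurable.const_mul _)

/-- The variance of `j · û_m` per unit amplitude. -/
noncomputable def advVar (β : ℝ) (j m : Wave) : ℝ :=
  len m ^ (2 * β) * (edot j m ^ 2 + fdot j m ^ 2)

lemma advVar_nonneg (β : ℝ) (j m : Wave) : 0 ≤ advVar β j m :=
  mul_nonneg (Real.rpow_nonneg (len_nonneg m) _) (by positivity)

lemma advVar_le (hβ : β < -2) (j m : Wave) : advVar β j m ≤ len m ^ (2 * β) * len j ^ 2 := by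
  by_cases hm : m = 0
  · subst hm; simp [advVar, Real.zero_rpow (show 2 * β ≠ 0 by linarith)]
  · exact mul_le_mul_of_nonneg_left (edot_fdot_sq_le j hm) (Real.rpow_nonneg (len_nonneg m) _)

lemma advVar_sub (j k : Wave) : advVar β j (k - j) = advVar β k (k - j) := by
  have h : k = j + (k - j) := by abel
  conv_rhs => rw [advVar, h]
  rw [add_sub_cancel_left, edot_add, fdot_add, edot_self, fdot_self, add_zero, add_zero, advVar]

lemma rpow_sq_eq (m : Wave) (β : ℝ) : (len m ^ β) ^ 2 = len m ^ (2 * β) := by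
  rw [← Real.rpow_natCast (len m ^ β), ← Real.rpow_mul (len_nonneg m)]
  congr 1; push_cast; ring

/-- Expansion of a second moment of the advection modes. -/
lemma integral_adv_mul_source [IsProbabilityMeasure P]
    (h : IsVelocityModes P V W ς Ξ) (hZ : IsSourceFactor P V W Z Ξg) {i j m n : Wave}
    (hi : i ≠ 0) (hj : j ≠ 0) (hm : m ≠ 0) (hn : n ≠ 0) :
    ∫ ω, (modeAdv β U (fun k => V k ω) (fun k => W k ω) i m
        * conj (modeAdv β U (fun k => V k ω) (fun k => W k ω) j n)) * (Z i ω * conj (Z j ω)) ∂P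
      = if m = n then
          ((U ^ 2 * len m ^ (2 * β) * (edot i m * edot j m + fdot i m * fdot j m) : ℝ) : ℂ)
            * ∫ ω, Z i ω * conj (Z j ω) ∂P
        else 0 := by
  have hint : ∀ s t : Bool, Integrable (fun ω => modeVar V W (m, s) ω
      * conj (modeVar V W (n, t) ω) * (Z i ω * conj (Z j ω))) P := by
    intro s t
    have hc := Complex.continuous_conj.measurable
    have p1 := h.isProper_modeVar (a := (m, s)) hm
    have p2 := h.isProper_modeVar (a := (n, t)) hn
    refine Integrable.of_bound (C := Ξ * Ξ * (Ξg * Ξg)) (((p1.measurable.mul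
      (hc.comp p2.measurable)).mul ((hZ.measurable i hi).mul
      (hc.comp (hZ.measurable j hj)))).aestronglyMeasurable) ?_
    filter_upwards [p1.ae_norm_le, p2.ae_norm_le, hZ.bound] with ω h1 h2 h3
    have h0 := (norm_nonneg _).trans h1
    have h0' := (norm_nonneg _).trans (h3 i hi)
    rw [norm_mul, norm_mul, norm_mul, RCLike.norm_conj, RCLike.norm_conj]
    exact mul_le_mul (mul_le_mul h1 h2 (norm_nonneg _) h0)
      (mul_le_mul (h3 i hi) (h3 j hj) (norm_nonneg _) h0') (by positivity) (by positivity)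
  have hexp : ∀ ω, (modeAdv β U (fun k => V k ω) (fun k => W k ω) i m
        * conj (modeAdv β U (fun k => V k ω) (fun k => W k ω) j n)) * (Z i ω * conj (Z j ω))
      = ((U * len m ^ β * edot i m * (U * len n ^ β * edot j n) : ℝ) : ℂ)
          * (modeVar V W (m, true) ω * conj (modeVar V W (n, true) ω) * (Z i ω * conj (Z j ω)))
        + ((U * len m ^ β * edot i m * (U * len n ^ β * fdot j n) : ℝ) : ℂ)
          * (modeVar V W (m, true) ω * conj (modeVar V W (n, false) ω) * (Z i ω * conj (Z j ω)))
        + (((U * len m ^ β * fdot i m * (U * len n ^ β * edot j n) : ℝ) : ℂ)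
          * (modeVar V W (m, false) ω * conj (modeVar V W (n, true) ω) * (Z i ω * conj (Z j ω)))
        + ((U * len m ^ β * fdot i m * (U * len n ^ β * fdot j n) : ℝ) : ℂ)
          * (modeVar V W (m, false) ω * conj (modeVar V W (n, false) ω)
            * (Z i ω * conj (Z j ω)))) := by
    intro ω
    rw [modeAdv_eq, modeAdv_eq]
    simp only [map_add, map_mul, Complex.conj_ofReal]
    push_cast; ring
  simp only [hexp]
  have I := fun s t (c : ℂ) => (hint s t).const_mul c
  rw [integral_add (f := fun ω => _ + _) (g := fun ω => _ + _) ((I _ _ _).add (I _ _ _))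
      ((I _ _ _).add (I _ _ _)),
    integral_add (I _ _ _) (I _ _ _), integral_add (I _ _ _) (I _ _ _)]
  simp only [integral_const_mul]
  rw [integral_mode_mul_source h hZ (a := (m, true)) (b := (n, true)) hm hn hi hj,
    integral_mode_mul_source h hZ (a := (m, true)) (b := (n, false)) hm hn hi hj,
    integral_mode_mul_source h hZ (a := (m, false)) (b := (n, true)) hm hn hi hj,
    integral_mode_mul_source h hZ (a := (m, false)) (b := (n, false)) hm hn hi hj,
    h.covariance_eq_zero (a := (m, true)) (b := (n, false)) hm hn (by simp),
    h.covariance_eq_zero (a := (m, false)) (b := (n, true)) hm hn (by simp)]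
  split_ifs with hmn
  · subst hmn
    have hone : ∀ s : Bool, ∫ ω, modeVar V W (m, s) ω * conj (modeVar V W (m, s) ω) ∂P = 1 := by
      intro s
      have e : ∀ ω, modeVar V W (m, s) ω * conj (modeVar V W (m, s) ω)
          = ((‖modeVar V W (m, s) ω‖ ^ 2 : ℝ) : ℂ) := fun ω => by
        rw [Complex.mul_conj, Complex.normSq_eq_norm_sq]
      simp only [e]
      rw [integral_complex_ofReal, (h.isProper_modeVar (a := (m, s)) hm).second]
      simp
    rw [hone, hone, ← rpow_sq_eq]
    push_cast; ring
  · rw [h.covariance_eq_zero (a := (m, true)) (b := (n, true)) hm hn (by simp [hmn]),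
      h.covariance_eq_zero (a := (m, false)) (b := (n, false)) hm hn (by simp [hmn])]
    simp

/-- The second moment of a Fourier mode of the first correction. -/
lemma integral_norm_transport_sq [IsProbabilityMeasure P] (hβ : β < -2) (hU : 0 ≤ U)
    (h : IsVelocityModes P V W ς Ξ) (hZ : IsSourceFactor P V W Z Ξg) {γ : Wave → ℂ} {M α : ℝ}
    (hα : α < -3) (hγ0 : γ 0 = 0) (hM : 0 ≤ M) (hγ : ∀ k ≠ 0, ‖γ k‖ ≤ M * len k ^ α)
    {k : Wave} (hk : k ≠ 0) :
    Integrable (fun ω => ‖transport β U (fun k => V k ω) (fun k => W k ω)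
        (fun j => -(γ j * Z j ω)) k‖ ^ 2) P ∧
      HasSum (fun j => U ^ 2 * ((len k ^ 4)⁻¹ * (‖γ j‖ ^ 2 * advVar β j (k - j))))
        (∫ ω, ‖transport β U (fun k => V k ω) (fun k => W k ω)
          (fun j => -(γ j * Z j ω)) k‖ ^ 2 ∂P) := by
  have hL := len_pos hk
  have hconj := Complex.continuous_conj.measurable
  set X : Wave → Ω → ℂ := fun j ω =>
    modeAdv β U (fun k => V k ω) (fun k => W k ω) j (k - j) * (γ j * Z j ω) with hX
  have hXzero : ∀ j, (j = 0 ∨ k - j = 0) → ∀ ω, X j ω = 0 := by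
    rintro j (rfl | hj) ω
    · simp [hX, hγ0]
    · simp [hX, hj, modeAdv_zero hβ]
  have hXm : ∀ j, AEStronglyMeasurable (X j) P := by
    intro j
    by_cases hj : j = 0
    · have : X j = fun _ => 0 := funext (hXzero j (Or.inl hj))
      rw [this]; exact aestronglyMeasurable_const
    · exact ((measurable_modeAdv hβ h j (k - j)).mul
        ((hZ.measurable j hj).const_mul _)).aestronglyMeasurable
  have hXb : ∀ᵐ ω ∂P, ∀ j, ‖X j ω‖ ≤ 2 * U * Ξ * len k * (M * Ξg) * len j ^ α := by
    filter_upwards [h.ae_isBoundedModes, hZ.bound] with ω hω hω' j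
    have hΞ := hω.nonneg
    by_cases hj : j = 0
    · subst hj
      rw [hXzero 0 (Or.inl rfl), norm_zero, len_zero, Real.zero_rpow (by linarith), mul_zero]
    by_cases hkj : k - j = 0
    · rw [hXzero j (Or.inr hkj), norm_zero]
      have := len_nonneg j
      have := (norm_nonneg _).trans (hω' j hj)
      positivity
    have h1 := norm_modeAdv_sub_le hβ hU hω.boundV hω.boundW j k
    have h2 : len (k - j) ^ β ≤ 1 :=
      Real.rpow_le_one_of_one_le_of_nonpos (one_le_len hkj) (by linarith)
    have h3 := Real.rpow_nonneg (len_nonneg j) α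
    rw [hX, norm_mul, norm_mul]
    calc _ ≤ (2 * U * Ξ * 1 * len k) * ((M * len j ^ α) * Ξg) := by
          refine mul_le_mul (h1.trans ?_) (mul_le_mul (hγ j hj) (hω' j hj) (norm_nonneg _)
            (by positivity)) (by positivity) (by positivity)
          gcongr
      _ = _ := by ring
  have hXX : ∀ i j ω, X i ω * conj (X j ω) = (γ i * conj (γ j)) *
      ((modeAdv β U (fun k => V k ω) (fun k => W k ω) i (k - i)
        * conj (modeAdv β U (fun k => V k ω) (fun k => W k ω) j (k - j)))
        * (Z i ω * conj (Z j ω))) := by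
    intro i j ω
    simp only [hX, map_mul]; ring
  have horth : ∀ i j, i ≠ j → ∫ ω, X i ω * conj (X j ω) ∂P = 0 := by
    intro i j hij
    by_cases hi : i = 0 ∨ k - i = 0
    · simp [hXzero i hi]
    by_cases hj : j = 0 ∨ k - j = 0
    · simp [hXzero j hj]
    push Not at hi hj
    simp only [hXX]
    rw [integral_const_mul, integral_adv_mul_source h hZ hi.1 hj.1 hi.2 hj.2, if_neg, mul_zero]
    exact fun e => hij (sub_right_injective e)
  have hsq : ∀ j, ∫ ω, ‖X j ω‖ ^ 2 ∂P = U ^ 2 * (‖γ j‖ ^ 2 * advVar β j (k - j)) := by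
    intro j
    by_cases hj : j = 0 ∨ k - j = 0
    · simp only [hXzero j hj]
      rcases hj with rfl | hj
      · simp [hγ0]
      · simp [hj, advVar, Real.zero_rpow (show 2 * β ≠ 0 by linarith)]
    push Not at hj
    have e1 : ((∫ ω, ‖X j ω‖ ^ 2 ∂P : ℝ) : ℂ) = ∫ ω, X j ω * conj (X j ω) ∂P := by
      rw [← integral_complex_ofReal]
      refine integral_congr_ae (Eventually.of_forall fun ω => ?_)
      simp only [Complex.mul_conj, Complex.normSq_eq_norm_sq]
    have e2 : ∫ ω, Z j ω * conj (Z j ω) ∂P = 1 := by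
      have e : ∀ ω, Z j ω * conj (Z j ω) = ((‖Z j ω‖ ^ 2 : ℝ) : ℂ) := fun ω => by
        rw [Complex.mul_conj, Complex.normSq_eq_norm_sq]
      simp only [e]
      rw [integral_complex_ofReal, hZ.second j hj.1]
      simp
    simp only [hXX] at e1
    rw [integral_const_mul, integral_adv_mul_source h hZ hj.1 hj.1 hj.2 hj.2, if_pos rfl, e2,
      Complex.mul_conj, Complex.normSq_eq_norm_sq] at e1
    have e3 : ∫ ω, ‖X j ω‖ ^ 2 ∂P = ‖γ j‖ ^ 2 * (U ^ 2 * len (k - j) ^ (2 * β)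
        * (edot j (k - j) * edot j (k - j) + fdot j (k - j) * fdot j (k - j))) := by
      apply Complex.ofReal_injective
      rw [e1]; push_cast; ring
    rw [e3, advVar]; ring
  obtain ⟨hint, hsum⟩ := integral_norm_sq_tsum hXm
    ((summable_len_rpow hα).mul_left (2 * U * Ξ * len k * (M * Ξg))) hXb horth
  have hT : ∀ ω, ‖transport β U (fun k => V k ω) (fun k => W k ω) (fun j => -(γ j * Z j ω)) k‖ ^ 2
      = (len k ^ 4)⁻¹ * ‖∑' j, X j ω‖ ^ 2 := by
    intro ω
    have e : ∑' j, Complex.I * modeAdv β U (fun k => V k ω) (fun k => W k ω) j (k - j)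
        * -(γ j * Z j ω) = -Complex.I * ∑' j, X j ω := by
      rw [← tsum_mul_left]
      exact tsum_congr fun j => by simp only [hX]; ring
    rw [transport, if_neg hk, e, norm_neg, norm_div, norm_mul, norm_neg, Complex.norm_I, one_mul,
      Complex.norm_real, Real.norm_eq_abs, abs_of_nonneg (sq_nonneg _), div_pow]
    rw [← pow_mul, inv_mul_eq_div]
  simp only [hT]
  refine ⟨hint.const_mul _, ?_⟩
  rw [integral_const_mul]
  refine (hsum.mul_left _).congr_fun fun j => ?_
  rw [hsq]; ring

end FirstCorrection

end BHT

namespace BHT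

/-! ### The expected spectrum of the first correction -/

lemma exists_sum_shell_rpow_le {s : ℝ} (hs : s < -3) :
    ∃ C, 0 ≤ C ∧ ∀ κ : ℝ, 2 ≤ κ → ∑ k ∈ shell κ (2 * κ), len k ^ s ≤ C * κ ^ (s + 3) := by
  refine ⟨4 * Real.pi * |i₂ (s + 3)| + Real.pi * 4 / 3 * (16 * |s| + 68), by positivity,
    fun κ hκ => ?_⟩
  have h := (abs_le.mp (abs_sum_shell_rpow_sub_le hs hκ)).2
  have p1 : κ ^ (s + 2) ≤ κ ^ (s + 3) :=
    Real.rpow_le_rpow_of_exponent_le (by linarith) (by linarith)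
  have p2 : 4 * Real.pi * κ ^ (s + 3) * i₂ (s + 3)
      ≤ 4 * Real.pi * κ ^ (s + 3) * |i₂ (s + 3)| := by
    gcongr; exact le_abs_self _
  have p3 : Real.pi * 4 / 3 * (16 * |s| + 68) * κ ^ (s + 2)
      ≤ Real.pi * 4 / 3 * (16 * |s| + 68) * κ ^ (s + 3) := by gcongr
  linarith

/-- Lagrange's identity, for two wave vectors and their difference. -/
lemma len_sq_mul_sub_dotW_sq (j k : Wave) :
    len j ^ 2 * len (k - j) ^ 2 - dotW j (k - j) ^ 2 = len j ^ 2 * len k ^ 2 - dotW j k ^ 2 := by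
  simp only [len_sq', dotW, Fin.sum_univ_three, Pi.sub_apply]
  push_cast; ring

lemma advVar_eq {β : ℝ} {j k : Wave} (h : k - j ≠ 0) :
    advVar β j (k - j)
      = len (k - j) ^ (2 * β - 2) * (len j ^ 2 * len k ^ 2 - dotW j k ^ 2) := by
  have hL := len_pos h
  rw [← len_sq_mul_sub_dotW_sq, ← edot_sq_add_fdot_sq j h, advVar, Real.rpow_sub hL,
    Real.rpow_two]
  field_simp

lemma dotW_sq_le (j k : Wave) : dotW j k ^ 2 ≤ len j ^ 2 * len k ^ 2 := by
  have h : 0 ≤ len j ^ 2 * len k ^ 2 - dotW j k ^ 2 := by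
    simp only [len_sq', dotW, Fin.sum_univ_three]
    nlinarith [sq_nonneg ((j 0 : ℝ) * k 1 - j 1 * k 0), sq_nonneg ((j 0 : ℝ) * k 2 - j 2 * k 0),
      sq_nonneg ((j 1 : ℝ) * k 2 - j 2 * k 1)]
  linarith

lemma half_le_len_sub {κ : ℝ} {j k : Wave} (hj : len j ≤ κ / 2) (hk : κ ≤ len k) :
    κ / 2 ≤ len (k - j) := by
  have := len_le_add_sub j k
  linarith

/-- The contribution to the spectrum on `[κ, 2κ)` of a source mode `j` much longer in wavelength:
the isotropic average of `|j|² |k|² - (j · k)²` is `(2 / 3) |j|² |k|²`. -/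
lemma exists_abs_sum_advVar_sub_le {β : ℝ} (hβ : β < -2) :
    ∃ C, 0 ≤ C ∧ ∀ κ : ℝ, 4 ≤ κ → ∀ j : Wave, len j ≤ κ ^ (1 / 2 : ℝ) →
      |∑ k ∈ shell κ (2 * κ), (len k ^ 4)⁻¹ * advVar β j (k - j)
          - 8 * Real.pi / 3 * κ ^ (2 * β - 1) * i₂ (2 * β - 1) * len j ^ 2|
        ≤ C * len j ^ 2 * κ ^ (2 * β - 3 / 2) := by
  obtain ⟨C', hC', hsum⟩ := exists_sum_shell_rpow_le (s := -4) (by norm_num)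
  set R : ℝ := Real.pi * 4 / 3 * (16 * |2 * β - 4| + 68) with hR
  have hR0 : 0 ≤ R := by positivity
  refine ⟨|2 * β - 2| * (2 : ℝ) ^ (-(2 * β - 3)) * 4 * C' + 2 / 3 * R, by positivity,
    fun κ hκ j hj => ?_⟩
  have hκ0 : 0 < κ := by linarith
  have hsqrt : κ ^ (1 / 2 : ℝ) ≤ κ / 2 := by
    rw [← Real.sqrt_eq_rpow]
    rw [Real.sqrt_le_left (by linarith)]
    nlinarith
  have hj2 : len j ≤ κ / 2 := hj.trans hsqrt
  set Q : Wave → ℝ := fun k => len j ^ 2 * len k ^ 2 - dotW j k ^ 2 with hQ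
  -- the sum in which `|k - j|` is replaced by `|k|`, evaluated by the symmetry of the shell
  have hfrozen : ∑ k ∈ shell κ (2 * κ), len k ^ (2 * β - 6) * Q k
      = 2 / 3 * len j ^ 2 * ∑ k ∈ shell κ (2 * κ), len k ^ (2 * β - 4) := by
    have e1 := sum_shell_dotW_sq κ (2 * κ) (fun r => r ^ (2 * β - 6)) j
    have e2 : ∑ k ∈ shell κ (2 * κ), len k ^ (2 * β - 6) * len k ^ 2
        = ∑ k ∈ shell κ (2 * κ), len k ^ (2 * β - 4) := by
      refine Finset.sum_congr rfl fun k hk => ?_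
      rw [← Real.rpow_two, ← Real.rpow_add (len_pos (ne_zero_of_mem_shell hκ0 hk))]
      congr 1; ring
    simp only [hQ, mul_sub, Finset.sum_sub_distrib]
    rw [e1, e2, ← e2, Finset.mul_sum, Finset.mul_sum, ← Finset.sum_sub_distrib]
    refine Finset.sum_congr rfl fun k _ => ?_
    ring
  have hfreeze : |∑ k ∈ shell κ (2 * κ), (len k ^ 4)⁻¹ * advVar β j (k - j)
      - ∑ k ∈ shell κ (2 * κ), len k ^ (2 * β - 6) * Q k|
      ≤ |2 * β - 2| * (2 : ℝ) ^ (-(2 * β - 3)) * 4 * C' * len j ^ 2 * κ ^ (2 * β - 3 / 2) := by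
    rw [← Finset.sum_sub_distrib]
    refine (Finset.abs_sum_le_sum_abs _ _).trans ?_
    have hterm : ∀ k ∈ shell κ (2 * κ), |(len k ^ 4)⁻¹ * advVar β j (k - j)
        - len k ^ (2 * β - 6) * Q k|
        ≤ |2 * β - 2| * (κ / 2) ^ (2 * β - 3) * κ ^ (1 / 2 : ℝ) * len j ^ 2 * (4 * κ ^ 2)
          * len k ^ (-4 : ℝ) := by
      intro k hk
      obtain ⟨hk1, hk2⟩ := mem_shell.mp hk
      have hL : 0 < len k := hκ0.trans_le hk1
      have hm := half_le_len_sub hj2 hk1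
      have hm0 : k - j ≠ 0 := by
        intro h; rw [h, len_zero] at hm; linarith
      have hQ0 : 0 ≤ Q k := sub_nonneg.mpr (dotW_sq_le j k)
      have hQ1 : Q k ≤ len j ^ 2 * (4 * κ ^ 2) := by
        have : len k ^ 2 ≤ 4 * κ ^ 2 := by nlinarith
        have h2 := mul_le_mul_of_nonneg_left this (sq_nonneg (len j))
        have h3 := sq_nonneg (dotW j k)
        simp only [hQ]; linarith
      have e : len k ^ (2 * β - 6) = len k ^ (2 * β - 2) * len k ^ (-4 : ℝ) := by
        rw [← Real.rpow_add hL]; congr 1; ring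
      have e4 : (len k ^ 4)⁻¹ = len k ^ (-4 : ℝ) := by
        rw [Real.rpow_neg hL.le]; norm_cast
      have hd : |len (k - j) ^ (2 * β - 2) - len k ^ (2 * β - 2)|
          ≤ |2 * β - 2| * (κ / 2) ^ (2 * β - 3) * κ ^ (1 / 2 : ℝ) := by
        have h1 := abs_rpow_sub_rpow_le (s := 2 * β - 2) (by linarith)
          (show 0 < κ / 2 by linarith) hm (show κ / 2 ≤ len k by linarith)
        have h2 : |len (k - j) - len k| ≤ κ ^ (1 / 2 : ℝ) := by
          refine le_trans ?_ hj
          rw [abs_le]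
          have a1 := len_le_add_sub j k
          have a2 := len_le_add_sub k j
          have a3 : len (k - j) ≤ len k + len j := by
            have := len_add_le k (-j)
            rwa [← sub_eq_add_neg, len_neg] at this
          constructor <;> linarith
        rw [show (2 * β - 2 - 1) = 2 * β - 3 by ring] at h1
        exact h1.trans (by gcongr)
      rw [advVar_eq hm0, e, e4]
      have e5 : len k ^ (-4 : ℝ) * (len (k - j) ^ (2 * β - 2) * (len j ^ 2 * len k ^ 2
          - dotW j k ^ 2)) - len k ^ (2 * β - 2) * len k ^ (-4 : ℝ) * Q k
          = (len (k - j) ^ (2 * β - 2) - len k ^ (2 * β - 2)) * Q k * len k ^ (-4 : ℝ) := by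
        simp only [hQ]; ring
      have h4 := Real.rpow_nonneg hL.le (-4)
      rw [e5, abs_mul, abs_mul, abs_of_nonneg hQ0, abs_of_nonneg h4]
      calc _ ≤ (|2 * β - 2| * (κ / 2) ^ (2 * β - 3) * κ ^ (1 / 2 : ℝ)) * (len j ^ 2 * (4 * κ ^ 2))
            * len k ^ (-4 : ℝ) := by gcongr
        _ = _ := by ring
    refine (Finset.sum_le_sum hterm).trans ?_
    rw [← Finset.mul_sum]
    calc _ ≤ |2 * β - 2| * (κ / 2) ^ (2 * β - 3) * κ ^ (1 / 2 : ℝ) * len j ^ 2 * (4 * κ ^ 2)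
          * (C' * κ ^ (-4 + 3 : ℝ)) := by
          gcongr
          exact hsum κ (by linarith)
      _ = |2 * β - 2| * (2 : ℝ) ^ (-(2 * β - 3)) * 4 * C' * len j ^ 2
          * (κ ^ (2 * β - 3) * κ ^ (1 / 2 : ℝ) * κ ^ (2 : ℝ) * κ ^ (-4 + 3 : ℝ)) := by
          rw [Real.div_rpow hκ0.le zero_le_two, Real.rpow_neg zero_le_two, Real.rpow_two]
          ring
      _ = _ := by
          rw [← Real.rpow_add hκ0, ← Real.rpow_add hκ0, ← Real.rpow_add hκ0]
          congr 2; ring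
  have hmain := abs_sum_shell_rpow_sub_le (s := 2 * β - 4) (by linarith)
    (show 2 ≤ κ by linarith)
  rw [show 2 * β - 4 + 3 = 2 * β - 1 by ring, show 2 * β - 4 + 2 = 2 * β - 2 by ring, ← hR]
    at hmain
  have hp : κ ^ (2 * β - 2) ≤ κ ^ (2 * β - 3 / 2) :=
    Real.rpow_le_rpow_of_exponent_le (by linarith) (by linarith)
  set S := ∑ k ∈ shell κ (2 * κ), len k ^ (2 * β - 4)
  have h5 : |2 / 3 * len j ^ 2 * S
      - 8 * Real.pi / 3 * κ ^ (2 * β - 1) * i₂ (2 * β - 1) * len j ^ 2|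
      ≤ 2 / 3 * R * len j ^ 2 * κ ^ (2 * β - 3 / 2) := by
    rw [show 2 / 3 * len j ^ 2 * S - 8 * Real.pi / 3 * κ ^ (2 * β - 1) * i₂ (2 * β - 1) * len j ^ 2
      = 2 / 3 * len j ^ 2 * (S - 4 * Real.pi * κ ^ (2 * β - 1) * i₂ (2 * β - 1)) by ring, abs_mul,
      abs_of_nonneg (by positivity)]
    calc _ ≤ 2 / 3 * len j ^ 2 * (R * κ ^ (2 * β - 3 / 2)) := by
          gcongr; exact hmain.trans (by gcongr)
      _ = _ := by ring
  rw [hfrozen] at hfreeze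
  refine (abs_sub_le _ (2 / 3 * len j ^ 2 * S) _).trans ((add_le_add hfreeze h5).trans ?_)
  rw [← add_mul, ← add_mul]

/-- The contribution of a source mode of any length is bounded through the amplitude of the
velocity alone. -/
lemma sum_advVar_le {β κ : ℝ} (hβ : β < -2) (hκ : 0 < κ) (j : Wave) :
    ∑ k ∈ shell κ (2 * κ), (len k ^ 4)⁻¹ * advVar β j (k - j) ≤ κ ^ (-2 : ℝ) * latSum (2 * β) := by
  have hs : 2 * β < -3 := by linarith
  calc _ ≤ ∑ k ∈ shell κ (2 * κ), κ ^ (-2 : ℝ) * len (k - j) ^ (2 * β) := by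
        refine Finset.sum_le_sum fun k hk => ?_
        obtain ⟨hk1, _⟩ := mem_shell.mp hk
        have hL : 0 < len k := hκ.trans_le hk1
        have h0 := Real.rpow_nonneg (len_nonneg (k - j)) (2 * β)
        rw [advVar_sub]
        calc _ ≤ (len k ^ 4)⁻¹ * (len (k - j) ^ (2 * β) * len k ^ 2) := by
              gcongr; exact advVar_le hβ _ _
          _ = (len k ^ 2)⁻¹ * len (k - j) ^ (2 * β) := by field_simp
          _ ≤ (κ ^ 2)⁻¹ * len (k - j) ^ (2 * β) := by gcongr
          _ = _ := by rw [Real.rpow_neg hκ.le, Real.rpow_two]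
    _ ≤ _ := by
        rw [← Finset.mul_sum]
        gcongr
        have e : ∀ k : Wave, len (k - j) ^ (2 * β) = len (j - k) ^ (2 * β) := fun k => by
          rw [len_sub_comm]
        simp only [e]
        rw [← tsum_len_sub_rpow (2 * β) j]
        exact (summable_len_sub_rpow hs j).sum_le_tsum _
          fun k _ => Real.rpow_nonneg (len_nonneg _) _

lemma coeff_invGrad_source {γ : Wave → ℂ} {M α : ℝ} (hα : α < -4) (hM : 0 ≤ M) (hγ0 : γ 0 = 0)
    (hγ : ∀ k ≠ 0, ‖γ k‖ ≤ M * len k ^ α) (k : Wave) :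
    coeff (invGrad (source γ)) k = -(len k : ℂ) * γ k := by
  have e : invGrad (source γ) = series fun k => -(len k : ℂ) * γ k := by
    rw [invGrad]
    congr 1
    funext k
    split_ifs with hk
    · simp [hk, hγ0]
    · have hL : (len k : ℂ) ≠ 0 := by exact_mod_cast (len_pos hk).ne'
      rw [coeff_source (by linarith) hγ0 hγ]
      push_cast; field_simp
  rw [e, coeff_series]
  refine summable_sq_of_le (b := fun k => M * len k ^ (1 + α)) (s := 1 + α) (by linarith)
    (fun k => ?_) fun k => le_rfl
  by_cases hk : k = 0
  · subst hk; simp [hγ0]; positivity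
  · rw [norm_mul, norm_neg, Complex.norm_real, Real.norm_eq_abs, abs_of_nonneg (len_nonneg k),
      Real.rpow_add (len_pos hk), Real.rpow_one]
    nlinarith [mul_le_mul_of_nonneg_left (hγ k hk) (len_nonneg k)]

section Spectrum

variable {α β cg κg : ℝ} {γ : Wave → ℂ}

lemma hasSum_normSq_invGrad {M : ℝ} (hα : α < -4) (hM : 0 ≤ M) (hγ0 : γ 0 = 0)
    (hγ : ∀ k ≠ 0, ‖γ k‖ ≤ M * len k ^ α) :
    HasSum (fun k => (2 * Real.pi) ^ 3 * (len k ^ 2 * ‖γ k‖ ^ 2))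
      (normSq (invGrad (source γ))) := by
  refine ((hasSum_norm_sq (invGrad (source γ))).mul_left _).congr_fun fun k => ?_
  rw [coeff_invGrad_source hα hM hγ0 hγ, norm_mul, norm_neg, Complex.norm_real, Real.norm_eq_abs,
    abs_of_nonneg (len_nonneg k), mul_pow (len k)]

/-- The sum over all source modes of the contributions to the spectrum on `[κ, 2κ)`. -/
lemma exists_abs_tsum_sub_le (hβ : β < -2) :
    ∃ C, 0 ≤ C ∧ ∀ (α : ℝ), α < -7 → ∀ (cg κg : ℝ) (γ : Wave → ℂ), 0 ≤ cg → 16 ≤ κg →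
      IsSourceCoeff α cg κg γ → ∀ κ : ℝ, 4 * κg ^ 2 ≤ κ →
      |∑' j, ‖γ j‖ ^ 2 * ∑ k ∈ shell κ (2 * κ), (len k ^ 4)⁻¹ * advVar β j (k - j)
          - 8 * Real.pi / 3 * κ ^ (2 * β - 1) * i₂ (2 * β - 1)
            * ∑ j ∈ shell 1 (κ ^ (1 / 2 : ℝ)), len j ^ 2 * ‖γ j‖ ^ 2|
        ≤ cg ^ 2 * (latSum (2 * β) * latSum (-4)) * κ ^ α
          + C * (∑' j, len j ^ 2 * ‖γ j‖ ^ 2) * κ ^ (2 * β - 3 / 2) := by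
  obtain ⟨C, hC, hmain⟩ := exists_abs_sum_advVar_sub_le hβ
  refine ⟨C, hC, fun α hα cg κg γ hcg hκg hγ κ hκ => ?_⟩
  have hκ4 : 4 ≤ κ := by nlinarith
  have hκ0 : 0 < κ := by linarith
  have hroot : κg ≤ κ ^ (1 / 2 : ℝ) := by
    rw [← Real.sqrt_eq_rpow]
    exact Real.le_sqrt_of_sq_le (by nlinarith)
  have hroot0 : 0 < κ ^ (1 / 2 : ℝ) := by linarith
  obtain ⟨M, hM, hγM⟩ := exists_source_bound hcg hγ
  set A : ℝ := 8 * Real.pi / 3 * κ ^ (2 * β - 1) * i₂ (2 * β - 1) with hA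
  set T : Wave → ℝ := fun j => ∑ k ∈ shell κ (2 * κ), (len k ^ 4)⁻¹ * advVar β j (k - j) with hT
  set L : ℝ := latSum (2 * β) with hL
  have hL0 : 0 ≤ L := latSum_nonneg _
  have hT0 : ∀ j, 0 ≤ T j := fun j => Finset.sum_nonneg fun k _ =>
    mul_nonneg (by have := len_nonneg k; positivity) (advVar_nonneg _ _ _)
  have hTle : ∀ j, T j ≤ κ ^ (-2 : ℝ) * L := sum_advVar_le hβ hκ0
  have hs2 : Summable fun j => len j ^ 2 * ‖γ j‖ ^ 2 := by
    have h := (hasSum_normSq_invGrad (by linarith) hM hγ.zero hγM).summable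
    exact (summable_mul_left_iff (by positivity)).mp h
  have hs0 : Summable fun j => ‖γ j‖ ^ 2 := by
    refine Summable.of_nonneg_of_le (fun j => by positivity) (fun j => ?_) hs2
    by_cases hj : j = 0
    · simp [hj, hγ.zero]
    · have := one_le_len hj
      exact le_mul_of_one_le_left (by positivity) (one_le_pow₀ this)
  have hsT : Summable fun j => ‖γ j‖ ^ 2 * T j :=
    Summable.of_nonneg_of_le (fun j => mul_nonneg (by positivity) (hT0 j))
      (fun j => mul_le_mul_of_nonneg_left (hTle j) (by positivity))
      (hs0.mul_right (κ ^ (-2 : ℝ) * L))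
  have hs4 : Summable fun j : Wave => len j ^ (-4 : ℝ) := summable_len_rpow (by norm_num)
  set B : Wave → ℝ := fun j =>
    if j ∈ shell 1 (κ ^ (1 / 2 : ℝ)) then A * (len j ^ 2 * ‖γ j‖ ^ 2) else 0 with hB
  have hBs : HasSum B (A * ∑ j ∈ shell 1 (κ ^ (1 / 2 : ℝ)), len j ^ 2 * ‖γ j‖ ^ 2) := by
    have h : HasSum B (∑ j ∈ shell 1 (κ ^ (1 / 2 : ℝ)), B j) :=
      hasSum_sum_of_ne_finset_zero fun j hj => by simp only [hB, if_neg hj]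
    rw [Finset.mul_sum]
    convert h using 1
    exact Finset.sum_congr rfl fun j hj => by simp only [hB, if_pos hj]
  have hbound : ∀ j, ‖‖γ j‖ ^ 2 * T j - B j‖
      ≤ cg ^ 2 * L * κ ^ α * len j ^ (-4 : ℝ)
        + C * κ ^ (2 * β - 3 / 2) * (len j ^ 2 * ‖γ j‖ ^ 2) := by
    intro j
    have p4 := Real.rpow_nonneg (len_nonneg j) (-4)
    by_cases hj : j = 0
    · have : j ∉ shell 1 (κ ^ (1 / 2 : ℝ)) := by
        rw [mem_shell, hj, len_zero]; intro h; linarith [h.1]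
      simp only [hB, if_neg this]
      rw [hj, hγ.zero]
      simp only [norm_zero]
      rw [hj] at p4
      have : 0 ≤ cg ^ 2 * L * κ ^ α * len 0 ^ (-4 : ℝ) := by positivity
      simp only [ne_eq, OfNat.ofNat_ne_zero, not_false_eq_true, zero_pow, zero_mul, sub_zero,
        norm_zero, mul_zero, add_zero]
      exact this
    have h1 := one_le_len hj
    have hj0 := len_pos hj
    by_cases hjs : len j < κ ^ (1 / 2 : ℝ)
    · have h := hmain κ hκ4 j hjs.le
      simp only [hB, if_pos (mem_shell.mpr ⟨h1, hjs⟩)]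
      have e : ‖γ j‖ ^ 2 * T j - A * (len j ^ 2 * ‖γ j‖ ^ 2)
          = ‖γ j‖ ^ 2 * (T j - A * len j ^ 2) := by ring
      rw [e, norm_mul, Real.norm_eq_abs, Real.norm_eq_abs, abs_of_nonneg (by positivity)]
      have h2 := mul_le_mul_of_nonneg_left h (sq_nonneg ‖γ j‖)
      have h3 : 0 ≤ cg ^ 2 * L * κ ^ α * len j ^ (-4 : ℝ) := by positivity
      calc _ ≤ _ := h2
        _ = C * κ ^ (2 * β - 3 / 2) * (len j ^ 2 * ‖γ j‖ ^ 2) := by ring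
        _ ≤ _ := by linarith
    -- the decay of the source at short wavelengths
    · have hjn : j ∉ shell 1 (κ ^ (1 / 2 : ℝ)) := fun h => hjs (mem_shell.mp h).2
      simp only [hB, if_neg hjn, sub_zero]
      rw [Real.norm_eq_abs, abs_of_nonneg (mul_nonneg (by positivity) (hT0 j))]
      have hjl := not_lt.mp hjs
      have hd := hγ.decay j (hroot.trans hjl)
      have h2 : ‖γ j‖ ^ 2 ≤ cg ^ 2 * (len j ^ (-4 : ℝ) * κ ^ (α + 2)) := by
        calc ‖γ j‖ ^ 2 ≤ (cg * len j ^ α) ^ 2 := pow_le_pow_left₀ (norm_nonneg _) hd 2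
          _ = cg ^ 2 * (len j ^ (-4 : ℝ) * len j ^ (2 * α + 4)) := by
              rw [← Real.rpow_add hj0, mul_pow, rpow_sq_eq]; congr 2; ring
          _ ≤ cg ^ 2 * (len j ^ (-4 : ℝ) * (κ ^ (1 / 2 : ℝ)) ^ (2 * α + 4)) := by
              exact mul_le_mul_of_nonneg_left (mul_le_mul_of_nonneg_left
                (Real.rpow_le_rpow_of_nonpos hroot0 hjl (by linarith)) p4) (sq_nonneg cg)
          _ = _ := by
              rw [← Real.rpow_mul hκ0.le]; congr 3; ring
      have h3 : 0 ≤ C * κ ^ (2 * β - 3 / 2) * (len j ^ 2 * ‖γ j‖ ^ 2) := by positivity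
      calc _ ≤ cg ^ 2 * (len j ^ (-4 : ℝ) * κ ^ (α + 2)) * (κ ^ (-2 : ℝ) * L) :=
            mul_le_mul h2 (hTle j) (hT0 j) (by positivity)
        _ = cg ^ 2 * L * (κ ^ (α + 2) * κ ^ (-2 : ℝ)) * len j ^ (-4 : ℝ) := by ring
        _ = cg ^ 2 * L * κ ^ α * len j ^ (-4 : ℝ) := by
            rw [← Real.rpow_add hκ0]; congr 3; ring
        _ ≤ _ := by linarith
  have hsum := ((hs4.hasSum.mul_left (cg ^ 2 * L * κ ^ α)).add
    (hs2.hasSum.mul_left (C * κ ^ (2 * β - 3 / 2))))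
  have := (hsT.hasSum.sub hBs).norm_le_of_bounded hsum hbound
  rw [Real.norm_eq_abs] at this
  refine this.trans (le_of_eq ?_)
  rw [latSum]
  ring

variable {Ω : Type*} [MeasurableSpace Ω] {P : Measure Ω}
  {V W Z : Wave → Ω → ℂ} {ς Ξ Ξg U ϖ : ℝ}

/-- The energy of the first correction in a shell, through its Fourier coefficients. -/
lemma ae_normSq_firstCorr_eq (hβ : β < -2) (hα : α ≤ β - 1) (hα' : α < -7) (hκ : 16 ≤ κg)
    (hU : 0 ≤ U) (h : IsVelocityModes P V W ς Ξ) (hZ : IsSourceFactor P V W Z Ξg)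
    (hϖ : IsConvConst β κg ϖ) (hq : 2 * U * Ξ * ϖ ≤ 1 / 2) (hcg : 0 ≤ cg)
    (hγ : IsSourceCoeff α cg κg γ) :
    ∀ᵐ ω ∂P, ∀ a b : ℝ, normSq (proj a b (firstCorr
        (velocity β U (fun k => V k ω) (fun k => W k ω)) (source fun k => γ k * Z k ω)))
      = (2 * Real.pi) ^ 3 * ∑ k ∈ shell a b, ‖transport β U (fun k => V k ω) (fun k => W k ω)
          (fun j => -(γ j * Z j ω)) k‖ ^ 2 := by
  obtain ⟨M, hM, hγM⟩ := exists_source_bound hcg hγ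
  filter_upwards [h.ae_isBoundedModes, hZ.bound] with ω hω hZω a b
  have hone : (fun _ => 1 : Wave) ≠ 0 := fun h => by simpa using congrFun h 0
  have hΞg : 0 ≤ Ξg := (norm_nonneg _).trans (hZω _ hone)
  have hN : ∀ k ≠ 0, ‖γ k * Z k ω‖ ≤ M * Ξg * len k ^ α := fun k hk => by
    have := Real.rpow_nonneg (len_nonneg k) α
    calc ‖γ k * Z k ω‖ = ‖γ k‖ * ‖Z k ω‖ := norm_mul _ _
      _ ≤ (M * len k ^ α) * Ξg :=
          mul_le_mul (hγM k hk) (hZω k hk) (norm_nonneg _) (by positivity)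
      _ = _ := by ring
  rw [normSq_proj]
  congr 1
  refine Finset.sum_congr rfl fun k _ => ?_
  rw [coeff_firstCorr hβ hα (by linarith) hκ hU hω hϖ hq (by positivity) (by simp [hγ.zero]) hN]

/-- The expected spectrum of the first correction. -/
theorem exists_abs_integral_normSq_sub_le (hβ : β < -2) :
    ∃ C₂ : ℝ, ∀ α : ℝ, α < 2 * min β (-3) - 1 → ∃ C₁ : ℝ, ∀ (cg κg : ℝ) (γ : Wave → ℂ),
      0 ≤ cg → 16 ≤ κg → IsSourceCoeff α cg κg γ →
      ∀ {Ω : Type*} [MeasurableSpace Ω] (P : Measure Ω) [IsProbabilityMeasure P]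
        (V W Z : Wave → Ω → ℂ) (ς Ξ Ξg U ϖ : ℝ), 0 ≤ U → IsVelocityModes P V W ς Ξ →
        IsSourceFactor P V W Z Ξg → IsConvConst β κg ϖ → 2 * U * Ξ * ϖ ≤ 1 / 2 →
        ∀ κ : ℝ, 4 * κg ^ 2 ≤ κ →
        Integrable (fun ω => normSq (proj κ (2 * κ) (firstCorr
          (velocity β U (fun k => V k ω) (fun k => W k ω)) (source fun k => γ k * Z k ω)))) P ∧
        |∫ ω, normSq (proj κ (2 * κ) (firstCorr
            (velocity β U (fun k => V k ω) (fun k => W k ω)) (source fun k => γ k * Z k ω))) ∂P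
            - κ ^ (2 * β - 1) * (8 * Real.pi * U ^ 2 / 3) * i₂ (2 * β - 1)
              * normSq (proj 1 (κ ^ (1 / 2 : ℝ)) (invGrad (source γ)))|
          ≤ cg ^ 2 * U ^ 2 * C₁ * κ ^ α
            + C₂ * U ^ 2 * normSq (invGrad (source γ)) * κ ^ (2 * β - 3 / 2) := by
  obtain ⟨C, hC, hdet⟩ := exists_abs_tsum_sub_le hβ
  refine ⟨C, fun α hα => ⟨(2 * Real.pi) ^ 3 * (latSum (2 * β) * latSum (-4)), ?_⟩⟩
  intro cg κg γ hcg hκg hγ Ω _ P _ V W Z ς Ξ Ξg U ϖ hU h hZ hϖ hq κ hκ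
  have hα1 : α < 2 * β - 1 := hα.trans_le (by have := min_le_left β (-3); linarith)
  have hα2 : α < -7 := hα.trans_le (by have := min_le_right β (-3); linarith)
  have hκ0 : 0 < κ := by nlinarith
  obtain ⟨M, hM, hγM⟩ := exists_source_bound hcg hγ
  have hae := ae_normSq_firstCorr_eq hβ (by linarith) hα2 hκg hU h hZ hϖ hq hcg hγ
  have hae' : (fun ω => normSq (proj κ (2 * κ) (firstCorr
      (velocity β U (fun k => V k ω) (fun k => W k ω)) (source fun k => γ k * Z k ω))))
      =ᵐ[P] fun ω => (2 * Real.pi) ^ 3 * ∑ k ∈ shell κ (2 * κ),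
        ‖transport β U (fun k => V k ω) (fun k => W k ω) (fun j => -(γ j * Z j ω)) k‖ ^ 2 := by
    filter_upwards [hae] with ω hω using hω _ _
  have hmode := fun k (hk : k ∈ shell κ (2 * κ)) => integral_norm_transport_sq hβ hU h hZ
    (show α < -3 by linarith) hγ.zero hM hγM (ne_zero_of_mem_shell hκ0 hk)
  have hint : Integrable (fun ω => (2 * Real.pi) ^ 3 * ∑ k ∈ shell κ (2 * κ),
      ‖transport β U (fun k => V k ω) (fun k => W k ω) (fun j => -(γ j * Z j ω)) k‖ ^ 2) P :=
    (integrable_finsetSum _ fun k hk => (hmode k hk).1).const_mul _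
  refine ⟨hint.congr hae'.symm, ?_⟩
  have hsum : ∑' j, ∑ k ∈ shell κ (2 * κ),
      U ^ 2 * ((len k ^ 4)⁻¹ * (‖γ j‖ ^ 2 * advVar β j (k - j)))
      = ∑ k ∈ shell κ (2 * κ), ∫ ω, ‖transport β U (fun k => V k ω) (fun k => W k ω)
        (fun j => -(γ j * Z j ω)) k‖ ^ 2 ∂P :=
    HasSum.tsum_eq (hasSum_sum fun k hk => (hmode k hk).2)
  have hval : ∫ ω, normSq (proj κ (2 * κ) (firstCorr
      (velocity β U (fun k => V k ω) (fun k => W k ω)) (source fun k => γ k * Z k ω))) ∂P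
      = (2 * Real.pi) ^ 3 * U ^ 2
        * ∑' j, ‖γ j‖ ^ 2 * ∑ k ∈ shell κ (2 * κ), (len k ^ 4)⁻¹ * advVar β j (k - j) := by
    rw [integral_congr_ae hae', integral_const_mul,
      integral_finsetSum _ fun k hk => (hmode k hk).1, ← hsum, mul_assoc,
      ← tsum_mul_left (a := U ^ 2)]
    congr 1
    refine tsum_congr fun j => ?_
    rw [Finset.mul_sum, Finset.mul_sum]
    exact Finset.sum_congr rfl fun k _ => by ring
  have hgrad := coeff_invGrad_source (show α < -4 by linarith) hM hγ.zero hγM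
  have hproj : normSq (proj 1 (κ ^ (1 / 2 : ℝ)) (invGrad (source γ)))
      = (2 * Real.pi) ^ 3 * ∑ j ∈ shell 1 (κ ^ (1 / 2 : ℝ)), len j ^ 2 * ‖γ j‖ ^ 2 := by
    rw [normSq_proj]
    congr 1
    refine Finset.sum_congr rfl fun k _ => ?_
    rw [hgrad, norm_mul, norm_neg, Complex.norm_real, Real.norm_eq_abs, mul_pow, sq_abs]
  have hfull : normSq (invGrad (source γ)) = (2 * Real.pi) ^ 3 * ∑' j, len j ^ 2 * ‖γ j‖ ^ 2 := by
    rw [← tsum_mul_left]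
    exact (hasSum_normSq_invGrad (by linarith) hM hγ.zero hγM).tsum_eq.symm
  have hfin := hdet α hα2 cg κg γ hcg hκg hγ κ hκ
  rw [hval, hproj, hfull]
  set X := ∑' j, ‖γ j‖ ^ 2 * ∑ k ∈ shell κ (2 * κ), (len k ^ 4)⁻¹ * advVar β j (k - j)
  set Y := ∑ j ∈ shell 1 (κ ^ (1 / 2 : ℝ)), len j ^ 2 * ‖γ j‖ ^ 2
  rw [show (2 * Real.pi) ^ 3 * U ^ 2 * X - κ ^ (2 * β - 1) * (8 * Real.pi * U ^ 2 / 3)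
      * i₂ (2 * β - 1) * ((2 * Real.pi) ^ 3 * Y)
      = (2 * Real.pi) ^ 3 * U ^ 2
        * (X - 8 * Real.pi / 3 * κ ^ (2 * β - 1) * i₂ (2 * β - 1) * Y) by ring, abs_mul,
    abs_of_nonneg (show 0 ≤ (2 * Real.pi) ^ 3 * U ^ 2 by positivity)]
  calc _ ≤ (2 * Real.pi) ^ 3 * U ^ 2 * _ := mul_le_mul_of_nonneg_left hfin (by positivity)
    _ = _ := by ring

end Spectrum

end BHT

namespace BHT

/-! ### The variance of a quadratic form in the velocity modes -/

section QuadForm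

variable {Ω : Type*} [MeasurableSpace Ω] {P : Measure Ω} {V W : Wave → Ω → ℂ} {ς Ξ : ℝ}

/-- A centred product of two modes. -/
noncomputable def pairVar (V W : Wave → Ω → ℂ) (p : (Wave × Bool) × (Wave × Bool)) (ω : Ω) : ℂ :=
  modeVar V W p.1 ω * conj (modeVar V W p.2 ω) - if p.1 = p.2 then 1 else 0

/-- The pair `(flip b, flip a)`: its product of modes equals that of `(a, b)` up to sign. -/
def flipPair (p : (Wave × Bool) × (Wave × Bool)) : (Wave × Bool) × (Wave × Bool) :=
  (flipMode p.2, flipMode p.1)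

@[simp] lemma flipPair_flipPair (p : (Wave × Bool) × (Wave × Bool)) :
    flipPair (flipPair p) = p := by simp [flipPair]

lemma flipMode_injective : Function.Injective flipMode := fun a b h => by
  rw [← flipMode_flipMode a, h, flipMode_flipMode]

/-- The bound for the variance of a centred product of modes. -/
noncomputable def pairBound (ς : ℝ) (p : (Wave × Bool) × (Wave × Bool)) : ℝ :=
  if p.1 = p.2 then ς - 1 else 1

lemma pairBound_flipPair (ς : ℝ) (p : (Wave × Bool) × (Wave × Bool)) :
    pairBound ς (flipPair p) = pairBound ς p := by
  simp only [pairBound, flipPair, flipMode_injective.eq_iff, eq_comm (a := p.2)]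

lemma IsVelocityModes.measurable_modeVar (h : IsVelocityModes P V W ς Ξ) {a : Wave × Bool}
    (ha : a.1 ≠ 0) : Measurable (modeVar V W a) := (h.isProper_modeVar ha).measurable

lemma IsVelocityModes.measurable_pairVar (h : IsVelocityModes P V W ς Ξ)
    {p : (Wave × Bool) × (Wave × Bool)} (h1 : p.1.1 ≠ 0) (h2 : p.2.1 ≠ 0) :
    Measurable (pairVar V W p) :=
  ((h.measurable_modeVar h1).mul
    (Complex.continuous_conj.measurable.comp (h.measurable_modeVar h2))).sub_const _

lemma IsVelocityModes.ae_norm_pairVar_le (h : IsVelocityModes P V W ς Ξ)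
    {p : (Wave × Bool) × (Wave × Bool)} (h1 : p.1.1 ≠ 0) (h2 : p.2.1 ≠ 0) :
    ∀ᵐ ω ∂P, ‖pairVar V W p ω‖ ≤ Ξ * Ξ + 1 := by
  filter_upwards [(h.isProper_modeVar h1).ae_norm_le, (h.isProper_modeVar h2).ae_norm_le]
    with ω e1 e2
  refine (norm_sub_le _ _).trans (add_le_add ?_ ?_)
  · rw [norm_mul, RCLike.norm_conj]
    exact mul_le_mul e1 e2 (norm_nonneg _) ((norm_nonneg _).trans e1)
  · split_ifs <;> simp

lemma IsVelocityModes.integral_norm_sq_mul_self (h : IsVelocityModes P V W ς Ξ)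
    {a : Wave × Bool} (ha : a.1 ≠ 0) :
    ∫ ω, ‖modeVar V W a ω‖ ^ 2 * ‖modeVar V W a ω‖ ^ 2 ∂P = ς := by
  rw [← (h.isProper_modeVar ha).fourth]
  congr 1; funext ω; ring

variable [IsProbabilityMeasure P]

lemma IsVelocityModes.integrable_mul (h : IsVelocityModes P V W ς Ξ) {a b : Wave × Bool}
    (ha : a.1 ≠ 0) (hb : b.1 ≠ 0) :
    Integrable (fun ω => modeVar V W a ω * conj (modeVar V W b ω)) P := by
  refine Integrable.of_bound (C := Ξ * Ξ) ((h.measurable_modeVar ha).mul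
    (Complex.continuous_conj.measurable.comp (h.measurable_modeVar hb))).aestronglyMeasurable ?_
  filter_upwards [(h.isProper_modeVar ha).ae_norm_le, (h.isProper_modeVar hb).ae_norm_le]
    with ω e1 e2
  rw [norm_mul, RCLike.norm_conj]
  exact mul_le_mul e1 e2 (norm_nonneg _) ((norm_nonneg _).trans e1)

lemma IsVelocityModes.integrable_mul_mul (h : IsVelocityModes P V W ς Ξ) {a b c d : Wave × Bool}
    (ha : a.1 ≠ 0) (hb : b.1 ≠ 0) (hc : c.1 ≠ 0) (hd : d.1 ≠ 0) :
    Integrable (fun ω => modeVar V W a ω * conj (modeVar V W b ω)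
      * (conj (modeVar V W c ω) * modeVar V W d ω)) P := by
  have hconj := Complex.continuous_conj.measurable
  refine Integrable.of_bound (C := Ξ * Ξ * (Ξ * Ξ)) (((h.measurable_modeVar ha).mul
    (hconj.comp (h.measurable_modeVar hb))).mul ((hconj.comp (h.measurable_modeVar hc)).mul
    (h.measurable_modeVar hd))).aestronglyMeasurable ?_
  filter_upwards [(h.isProper_modeVar ha).ae_norm_le, (h.isProper_modeVar hb).ae_norm_le,
    (h.isProper_modeVar hc).ae_norm_le, (h.isProper_modeVar hd).ae_norm_le] with ω e1 e2 e3 e4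
  have := (norm_nonneg _).trans e1
  rw [norm_mul, norm_mul, norm_mul, RCLike.norm_conj, RCLike.norm_conj]
  exact mul_le_mul (mul_le_mul e1 e2 (norm_nonneg _) this)
    (mul_le_mul e3 e4 (norm_nonneg _) this) (by positivity) (by positivity)

lemma mul_conj_eq_norm_sq (z : ℂ) : z * conj z = ((‖z‖ ^ 2 : ℝ) : ℂ) := by
  rw [Complex.mul_conj, Complex.normSq_eq_norm_sq]

lemma IsVelocityModes.integrable_norm_sq (h : IsVelocityModes P V W ς Ξ) {a : Wave × Bool}
    (ha : a.1 ≠ 0) : Integrable (fun ω => ‖modeVar V W a ω‖ ^ 2) P := by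
  refine (h.integrable_mul ha ha).re.congr (Eventually.of_forall fun ω => ?_)
  simp only [mul_conj_eq_norm_sq]
  exact Complex.ofReal_re _

lemma IsVelocityModes.integrable_norm_sq_mul (h : IsVelocityModes P V W ς Ξ) {a b : Wave × Bool}
    (ha : a.1 ≠ 0) (hb : b.1 ≠ 0) :
    Integrable (fun ω => ‖modeVar V W a ω‖ ^ 2 * ‖modeVar V W b ω‖ ^ 2) P := by
  refine (h.integrable_mul_mul ha ha hb hb).re.congr (Eventually.of_forall fun ω => ?_)
  simp only [mul_comm (conj _), mul_conj_eq_norm_sq, ← Complex.ofReal_mul]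
  exact Complex.ofReal_re _

lemma IsVelocityModes.integral_centred_mul (h : IsVelocityModes P V W ς Ξ) {a b : Wave × Bool}
    (ha : a.1 ≠ 0) (hb : b.1 ≠ 0) :
    ∫ ω, (‖modeVar V W a ω‖ ^ 2 - 1) * (‖modeVar V W b ω‖ ^ 2 - 1) ∂P
      = ∫ ω, ‖modeVar V W a ω‖ ^ 2 * ‖modeVar V W b ω‖ ^ 2 ∂P - 1 := by
  have e : ∀ ω, (‖modeVar V W a ω‖ ^ 2 - 1) * (‖modeVar V W b ω‖ ^ 2 - 1)
      = ‖modeVar V W a ω‖ ^ 2 * ‖modeVar V W b ω‖ ^ 2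
        - (‖modeVar V W a ω‖ ^ 2 + (‖modeVar V W b ω‖ ^ 2 - 1)) := fun ω => by ring
  have i1 : Integrable (fun ω => ‖modeVar V W b ω‖ ^ 2 - 1) P :=
    (h.integrable_norm_sq hb).sub (integrable_const 1)
  have i2 : Integrable (fun ω => ‖modeVar V W a ω‖ ^ 2 + (‖modeVar V W b ω‖ ^ 2 - 1)) P :=
    (h.integrable_norm_sq ha).add i1
  simp only [e]
  rw [integral_sub (h.integrable_norm_sq_mul ha hb) i2, integral_add (h.integrable_norm_sq ha) i1,
    integral_sub (h.integrable_norm_sq hb) (integrable_const 1), (h.isProper_modeVar ha).second,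
    (h.isProper_modeVar hb).second]
  simp

lemma IsVelocityModes.one_le_fourth (h : IsVelocityModes P V W ς Ξ) : 1 ≤ ς := by
  have hone : (fun _ => 1 : Wave) ≠ 0 := fun h => by simpa using congrFun h 0
  have h1 := h.integral_centred_mul (a := (_, true)) (b := (_, true)) hone hone
  rw [h.integral_norm_sq_mul_self (a := (_, true)) hone] at h1
  have h2 : 0 ≤ ς - 1 := h1 ▸ integral_nonneg fun ω => mul_self_nonneg _
  linarith

lemma IsVelocityModes.pairBound_nonneg (h : IsVelocityModes P V W ς Ξ)
    (p : (Wave × Bool) × (Wave × Bool)) : 0 ≤ pairBound ς p := by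
  have := h.one_le_fourth
  rw [pairBound]
  split_ifs <;> linarith

/-- A product of two different modes is uncorrelated with the modulus of any mode. -/
lemma IsVelocityModes.covariance_offDiag_diag (h : IsVelocityModes P V W ς Ξ)
    {a b c : Wave × Bool} (ha : a.1 ≠ 0) (hb : b.1 ≠ 0) (hc : c.1 ≠ 0) (hab : a ≠ b)
    (hab' : a ≠ flipMode b) :
    ∫ ω, pairVar V W (a, b) ω * conj (pairVar V W (c, c) ω) ∂P = 0 := by
  have e : ∀ ω, pairVar V W (a, b) ω * conj (pairVar V W (c, c) ω)
      = modeVar V W a ω * conj (modeVar V W b ω) * (conj (modeVar V W c ω) * modeVar V W c ω)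
        - modeVar V W a ω * conj (modeVar V W b ω) := by
    intro ω
    simp only [pairVar, if_true, if_neg hab, map_sub, map_one, map_mul, Complex.conj_conj,
      sub_zero]
    ring
  simp only [e]
  rw [integral_sub (h.integrable_mul_mul ha hb hc hc) (h.integrable_mul ha hb),
    h.moment_diag_eq_zero ha hb hc hab hab', h.covariance_eq_zero ha hb hab, sub_zero]

/-- Apart from a pair of modes itself and the flipped pair, all centred products of two modes that
are not opposite are uncorrelated. -/
lemma IsVelocityModes.norm_covariance_pairVar_le (h : IsVelocityModes P V W ς Ξ)
    {p q : (Wave × Bool) × (Wave × Bool)} (hp1 : p.1.1 ≠ 0) (hp2 : p.2.1 ≠ 0) (hq1 : q.1.1 ≠ 0)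
    (hq2 : q.2.1 ≠ 0) (hp : p.1 ≠ flipMode p.2) (hq : q.1 ≠ flipMode q.2) :
    ‖∫ ω, pairVar V W p ω * conj (pairVar V W q ω) ∂P‖
      ≤ pairBound ς p * ((if q = p then 1 else 0) + if q = flipPair p then 1 else 0) := by
  have hK0 := h.pairBound_nonneg p
  obtain ⟨a, b⟩ := p
  obtain ⟨c, d⟩ := q
  simp only at hp1 hp2 hq1 hq2 hp hq
  have hrhs : ∀ s t : Prop, ∀ [Decidable s] [Decidable t],
      0 ≤ pairBound ς (a, b) * ((if s then (1 : ℝ) else 0) + if t then 1 else 0) := by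
    intro s t _ _
    refine mul_nonneg hK0 ?_
    split_ifs <;> norm_num
  by_cases hs : (c, d) = (a, b) ∨ (c, d) = flipPair (a, b)
  -- the pair itself, or the flipped pair
  · have hone : pairBound ς (a, b) ≤ pairBound ς (a, b)
        * ((if (c, d) = (a, b) then 1 else 0) + if (c, d) = flipPair (a, b) then 1 else 0) := by
      refine le_mul_of_one_le_right hK0 ?_
      rcases hs with hs | hs <;> rw [if_pos hs] <;> split_ifs <;> norm_num
    refine le_trans ?_ hone
    have hnorm : ∀ᵐ ω ∂P, ‖modeVar V W c ω‖ ^ 2 * ‖modeVar V W d ω‖ ^ 2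
        = ‖modeVar V W a ω‖ ^ 2 * ‖modeVar V W b ω‖ ^ 2 := by
      filter_upwards [h.ae_norm_flip hp1, h.ae_norm_flip hp2] with ω f1 f2
      rcases hs with hs | hs
      · simp only [Prod.mk.injEq] at hs
        rw [hs.1, hs.2]
      · simp only [flipPair, Prod.mk.injEq] at hs
        rw [hs.1, hs.2, f1, f2]; ring
    by_cases hab : a = b
    · subst hab
      have hcd : c = d := by
        rcases hs with hs | hs <;> simp only [flipPair, Prod.mk.injEq] at hs <;> rw [hs.1, hs.2]
      subst hcd
      have e : ∀ᵐ ω ∂P, pairVar V W (a, a) ω * conj (pairVar V W (c, c) ω)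
          = (((‖modeVar V W a ω‖ ^ 2 - 1) * (‖modeVar V W a ω‖ ^ 2 - 1) : ℝ) : ℂ) := by
        filter_upwards [hnorm] with ω hω
        have hω' : ‖modeVar V W c ω‖ ^ 2 = ‖modeVar V W a ω‖ ^ 2 := by
          refine (pow_left_inj₀ (by positivity) (by positivity) two_ne_zero).mp ?_
          linear_combination hω
        simp only [pairVar, if_true, mul_conj_eq_norm_sq, hω', map_sub, map_one, Complex.conj_ofReal]
        push_cast; ring
      rw [integral_congr_ae e, integral_complex_ofReal, h.integral_centred_mul hp1 hp1,
        h.integral_norm_sq_mul_self hp1, Complex.norm_real, Real.norm_eq_abs,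
        abs_of_nonneg (by linarith [h.one_le_fourth])]
      simp [pairBound]
    · have hcd : c ≠ d := by
        rintro rfl
        rcases hs with hs | hs <;> simp only [flipPair, Prod.mk.injEq] at hs
        · exact hab (hs.1.symm.trans hs.2)
        · exact hab (flipMode_injective (hs.2.symm.trans hs.1))
      have hK : pairBound ς (a, b) = 1 := by simp [pairBound, hab]
      rw [hK, ← h.integral_norm_sq_mul hp1 hp2 hab hp]
      refine (norm_integral_le_integral_norm _).trans (le_of_eq (integral_congr_ae ?_))
      filter_upwards [hnorm] with ω hω
      have hω' : ‖modeVar V W c ω‖ * ‖modeVar V W d ω‖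
          = ‖modeVar V W a ω‖ * ‖modeVar V W b ω‖ := by
        refine (pow_left_inj₀ (by positivity) (by positivity) two_ne_zero).mp ?_
        rw [mul_pow, mul_pow, hω]
      simp only [pairVar, if_neg hab, if_neg hcd, sub_zero, norm_mul, RCLike.norm_conj, hω']
      ring
  · refine le_trans (le_of_eq ?_) (hrhs _ _)
    push Not at hs
    rw [norm_eq_zero]
    by_cases hcd : c = d
    · subst hcd
      by_cases hab : a = b
      · subst hab
        have e : ∀ ω, pairVar V W (a, a) ω * conj (pairVar V W (c, c) ω)
            = (((‖modeVar V W a ω‖ ^ 2 - 1) * (‖modeVar V W c ω‖ ^ 2 - 1) : ℝ) : ℂ) := by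
          intro ω
          simp only [pairVar, if_true, mul_conj_eq_norm_sq, map_sub, map_one, Complex.conj_ofReal]
          push_cast; ring
        simp only [e]
        rw [integral_complex_ofReal, h.integral_centred_mul hp1 hq1,
          h.integral_norm_sq_mul hp1 hq1 (fun e => hs.1 (by rw [e]))
            fun e => hs.2 (by rw [e]; simp [flipPair])]
        simp
      · exact h.covariance_offDiag_diag hp1 hp2 hq1 hab hp
    · by_cases hab : a = b
      · subst hab
        have := congrArg conj (h.covariance_offDiag_diag hq1 hq2 hp1 hcd hq)
        rw [← integral_conj, map_zero] at this
        rw [← this]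
        congr 1; funext ω
        simp only [map_mul, Complex.conj_conj, mul_comm]
      · have e : ∀ ω, pairVar V W (a, b) ω * conj (pairVar V W (c, d) ω)
            = modeVar V W a ω * conj (modeVar V W b ω)
              * (conj (modeVar V W c ω) * modeVar V W d ω) := by
          intro ω
          simp only [pairVar, if_neg hab, if_neg hcd, map_mul, Complex.conj_conj, sub_zero]
        simp only [e]
        exact h.moment_eq_zero_of_ne hp1 hp2 hq1 hq2 hab hp hcd hq
          (fun e => hs.1 (by rw [e.1, e.2])) fun e => hs.2 (by rw [e.1, e.2]; rfl)

/-- The matrix of the quadratic form `∑ₖ |∑ₐ bₖₐ ξₐ|²`. -/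
noncomputable def gram (K : Finset Wave) (b : Wave → Wave × Bool → ℂ)
    (p : (Wave × Bool) × (Wave × Bool)) : ℂ := ∑ k ∈ K, b k p.1 * conj (b k p.2)

lemma quadForm_sub_eq {Ω' : Type*} {V W : Wave → Ω' → ℂ} (K : Finset Wave)
    (A : Finset (Wave × Bool)) (b : Wave → Wave × Bool → ℂ) (ω : Ω') :
    ((∑ k ∈ K, ‖∑ a ∈ A, b k a * modeVar V W a ω‖ ^ 2 - ∑ a ∈ A, ∑ k ∈ K, ‖b k a‖ ^ 2 : ℝ) : ℂ)
      = ∑ p ∈ A ×ˢ A, gram K b p * pairVar V W p ω := by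
  have e1 : ((∑ k ∈ K, ‖∑ a ∈ A, b k a * modeVar V W a ω‖ ^ 2 : ℝ) : ℂ)
      = ∑ p ∈ A ×ˢ A, gram K b p * (modeVar V W p.1 ω * conj (modeVar V W p.2 ω)) := by
    simp only [gram, Finset.sum_mul]
    rw [Finset.sum_comm, Complex.ofReal_sum]
    refine Finset.sum_congr rfl fun k _ => ?_
    rw [← mul_conj_eq_norm_sq, map_sum, Finset.sum_mul_sum, Finset.sum_product]
    refine Finset.sum_congr rfl fun a _ => Finset.sum_congr rfl fun c _ => ?_
    rw [map_mul]; ring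
  have e2 : ((∑ a ∈ A, ∑ k ∈ K, ‖b k a‖ ^ 2 : ℝ) : ℂ)
      = ∑ p ∈ A ×ˢ A, gram K b p * (if p.1 = p.2 then 1 else 0) := by
    rw [Finset.sum_product, Complex.ofReal_sum]
    refine Finset.sum_congr rfl fun a ha => ?_
    simp only [mul_ite, mul_one, mul_zero, Finset.sum_ite_eq, ha, if_true, gram, mul_conj_eq_norm_sq,
      Complex.ofReal_sum]
  rw [Complex.ofReal_sub, e1, e2, ← Finset.sum_sub_distrib]
  exact Finset.sum_congr rfl fun p _ => by rw [pairVar]; ring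

lemma IsVelocityModes.memLp_quadForm (h : IsVelocityModes P V W ς Ξ) (K : Finset Wave)
    {A : Finset (Wave × Bool)} (b : Wave → Wave × Bool → ℂ) (hA : ∀ a ∈ A, a.1 ≠ 0) :
    MemLp (fun ω => ∑ k ∈ K, ‖∑ a ∈ A, b k a * modeVar V W a ω‖ ^ 2) 2 P := by
  have hYm : Measurable fun ω => ∑ k ∈ K, ‖∑ a ∈ A, b k a * modeVar V W a ω‖ ^ 2 := by
    refine Finset.measurable_sum _ fun k _ => Measurable.pow_const (Measurable.norm ?_) 2
    exact Finset.measurable_sum _ fun a ha => (h.measurable_modeVar (hA a ha)).const_mul _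
  refine MemLp.of_bound hYm.aestronglyMeasurable (∑ k ∈ K, (∑ a ∈ A, ‖b k a‖ * Ξ) ^ 2) ?_
  filter_upwards [h.ae_isBoundedModes] with ω hω
  rw [Real.norm_eq_abs, abs_of_nonneg (by positivity)]
  refine Finset.sum_le_sum fun k _ => pow_le_pow_left₀ (norm_nonneg _) ?_ 2
  refine (norm_sum_le _ _).trans (Finset.sum_le_sum fun a ha => ?_)
  rw [norm_mul]
  refine mul_le_mul_of_nonneg_left ?_ (norm_nonneg _)
  rw [modeVar]
  split_ifs
  · exact hω.boundV _ (hA a ha)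
  · exact hω.boundW _ (hA a ha)

/-- The variance of a quadratic form that does not couple opposite modes: the fourth moments that
survive are those of a pair of modes with itself and with the flipped pair. -/
lemma IsVelocityModes.variance_quadForm_le (h : IsVelocityModes P V W ς Ξ) {K : Finset Wave}
    {A : Finset (Wave × Bool)} {b : Wave → Wave × Bool → ℂ} (hA : ∀ a ∈ A, a.1 ≠ 0)
    (hflip : ∀ a ∈ A, flipMode a ∈ A)
    (hb : ∀ k ∈ K, ∀ a ∈ A, b k (flipMode a) * conj (b k a) = 0) :
    Var[fun ω => ∑ k ∈ K, ‖∑ a ∈ A, b k a * modeVar V W a ω‖ ^ 2; P]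
      ≤ 2 * ∑ p ∈ A ×ˢ A, pairBound ς p * ‖gram K b p‖ ^ 2 := by
  set Y : Ω → ℝ := fun ω => ∑ k ∈ K, ‖∑ a ∈ A, b k a * modeVar V W a ω‖ ^ 2 with hY
  set H := gram K b with hH
  set B := A ×ˢ A with hB
  set m : ℝ := ∑ a ∈ A, ∑ k ∈ K, ‖b k a‖ ^ 2 with hm
  have hmem : ∀ p ∈ B, p.1.1 ≠ 0 ∧ p.2.1 ≠ 0 := fun p hp =>
    ⟨hA _ (Finset.mem_product.mp hp).1, hA _ (Finset.mem_product.mp hp).2⟩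
  have hflipB : ∀ p ∈ B, flipPair p ∈ B := fun p hp =>
    Finset.mem_product.mpr ⟨hflip _ (Finset.mem_product.mp hp).2,
      hflip _ (Finset.mem_product.mp hp).1⟩
  have hH0 : ∀ p ∈ B, p.1 = flipMode p.2 → H p = 0 := by
    intro p hp e
    refine Finset.sum_eq_zero fun k hk => ?_
    rw [e]
    exact hb k hk _ (Finset.mem_product.mp hp).2
  have hYL := h.memLp_quadForm K b hA
  have hvar : Var[Y; P] ≤ ∫ ω, (Y ω - m) ^ 2 ∂P := by
    rw [← variance_sub_const hYL.1 m]
    exact variance_le_expectation_sq (hYL.1.sub aestronglyMeasurable_const)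
  have hint : ∀ p ∈ B, ∀ q ∈ B, Integrable (fun ω => H p * conj (H q)
      * (pairVar V W p ω * conj (pairVar V W q ω))) P := by
    intro p hp q hq
    refine Integrable.const_mul ?_ _
    refine Integrable.of_bound (C := (Ξ * Ξ + 1) * (Ξ * Ξ + 1)) (Measurable.aestronglyMeasurable
      ((h.measurable_pairVar (hmem p hp).1 (hmem p hp).2).mul
      (Complex.continuous_conj.measurable.comp
        (h.measurable_pairVar (hmem q hq).1 (hmem q hq).2)))) ?_
    filter_upwards [h.ae_norm_pairVar_le (hmem p hp).1 (hmem p hp).2,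
      h.ae_norm_pairVar_le (hmem q hq).1 (hmem q hq).2] with ω e1 e2
    rw [norm_mul, RCLike.norm_conj]
    exact mul_le_mul e1 e2 (norm_nonneg _) ((norm_nonneg _).trans e1)
  have hsq : ((∫ ω, (Y ω - m) ^ 2 ∂P : ℝ) : ℂ)
      = ∑ p ∈ B, ∑ q ∈ B, H p * conj (H q)
        * ∫ ω, pairVar V W p ω * conj (pairVar V W q ω) ∂P := by
    have e : ∀ ω, (((Y ω - m) ^ 2 : ℝ) : ℂ) = ∑ p ∈ B, ∑ q ∈ B, H p * conj (H q)
        * (pairVar V W p ω * conj (pairVar V W q ω)) := by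
      intro ω
      have h1 : ((Y ω - m : ℝ) : ℂ) = ∑ p ∈ B, H p * pairVar V W p ω := quadForm_sub_eq K A b ω
      have h2 : (((Y ω - m) ^ 2 : ℝ) : ℂ) = ((Y ω - m : ℝ) : ℂ) * conj ((Y ω - m : ℝ) : ℂ) := by
        rw [Complex.conj_ofReal]; push_cast; ring
      rw [h2, h1, map_sum, Finset.sum_mul_sum]
      refine Finset.sum_congr rfl fun p _ => Finset.sum_congr rfl fun q _ => ?_
      rw [map_mul]; ring
    rw [← integral_complex_ofReal]
    simp only [e]
    rw [integral_finsetSum _ fun p hp => integrable_finsetSum _ fun q hq => hint p hp q hq]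
    refine Finset.sum_congr rfl fun p hp => ?_
    rw [integral_finsetSum _ fun q hq => hint p hp q hq]
    exact Finset.sum_congr rfl fun q _ => integral_const_mul _ _
  have hK0 := h.pairBound_nonneg
  have hpair : ∀ p ∈ B, ∀ q ∈ B, ‖H p * conj (H q)
      * ∫ ω, pairVar V W p ω * conj (pairVar V W q ω) ∂P‖
      ≤ pairBound ς p * ‖H p‖ * (‖H q‖ * ((if q = p then 1 else 0)
        + if q = flipPair p then 1 else 0)) := by
    intro p hp q hq
    rw [norm_mul, norm_mul, RCLike.norm_conj]
    by_cases hp' : p.1 = flipMode p.2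
    · rw [hH0 p hp hp']; simp
    by_cases hq' : q.1 = flipMode q.2
    · rw [hH0 q hq hq']; simp
    calc _ ≤ ‖H p‖ * ‖H q‖ * (pairBound ς p * ((if q = p then 1 else 0)
          + if q = flipPair p then 1 else 0)) :=
          mul_le_mul_of_nonneg_left (h.norm_covariance_pairVar_le (hmem p hp).1 (hmem p hp).2
            (hmem q hq).1 (hmem q hq).2 hp' hq') (by positivity)
      _ = _ := by ring
  have hswap : ∑ p ∈ B, pairBound ς p * ‖H (flipPair p)‖ ^ 2
      = ∑ p ∈ B, pairBound ς p * ‖H p‖ ^ 2 := by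
    refine Finset.sum_nbij' flipPair flipPair hflipB hflipB (fun p _ => flipPair_flipPair p)
      (fun p _ => flipPair_flipPair p) fun p _ => ?_
    rw [pairBound_flipPair]
  calc Var[Y; P] ≤ ∫ ω, (Y ω - m) ^ 2 ∂P := hvar
    _ ≤ ‖((∫ ω, (Y ω - m) ^ 2 ∂P : ℝ) : ℂ)‖ := by
        rw [Complex.norm_real]; exact le_abs_self _
    _ ≤ ∑ p ∈ B, ∑ q ∈ B, pairBound ς p * ‖H p‖ * (‖H q‖ * ((if q = p then 1 else 0)
        + if q = flipPair p then 1 else 0)) := by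
        rw [hsq]
        refine (norm_sum_le _ _).trans (Finset.sum_le_sum fun p hp => ?_)
        exact (norm_sum_le _ _).trans (Finset.sum_le_sum fun q hq => hpair p hp q hq)
    _ = ∑ p ∈ B, pairBound ς p * ‖H p‖ * (‖H p‖ + ‖H (flipPair p)‖) := by
        refine Finset.sum_congr rfl fun p hp => ?_
        rw [← Finset.mul_sum]
        congr 1
        simp only [mul_add, mul_ite, mul_one, mul_zero, Finset.sum_add_distrib,
          Finset.sum_ite_eq', hp, hflipB p hp, if_true]
    _ ≤ ∑ p ∈ B, (3 / 2 * (pairBound ς p * ‖H p‖ ^ 2)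
        + 1 / 2 * (pairBound ς p * ‖H (flipPair p)‖ ^ 2)) := by
        refine Finset.sum_le_sum fun p _ => ?_
        nlinarith [mul_nonneg (hK0 p) (sq_nonneg (‖H p‖ - ‖H (flipPair p)‖))]
    _ = _ := by
        rw [Finset.sum_add_distrib, ← Finset.mul_sum, ← Finset.mul_sum, hswap]; ring

end QuadForm

/-! ### Convolution estimates for the matrix of the quadratic form -/

lemma sum_comp_le_of_injective {F : Wave → ℝ} (hF : ∀ j, 0 ≤ F j) {J : Finset Wave}
    (hJ : ∀ j ∉ J, F j = 0) {e : Wave → Wave} (he : Function.Injective e) (K : Finset Wave) :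
    ∑ k ∈ K, F (e k) ≤ ∑ j ∈ J, F j := by
  rw [← Finset.sum_image (f := F) fun x _ y _ h => he h,
    ← Finset.sum_filter_of_ne (p := fun j => j ∈ J) fun j _ hj => by
      by_contra h; exact hj (hJ j h)]
  exact Finset.sum_le_sum_of_subset_of_nonneg (fun j hj => (Finset.mem_filter.mp hj).2)
    fun j _ _ => hF j

section Convolution

variable {K M J : Finset Wave} {h v : Wave → ℝ} {b : Wave → Wave × Bool → ℂ}

lemma sum_mul_shift_le (hJ : ∀ j ∉ J, h j = 0) (m n : Wave) :
    ∑ k ∈ K, h (k - m) * h (k - n) ≤ ∑ j ∈ J, h j ^ 2 := by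
  have key : ∀ m : Wave, ∑ k ∈ K, h (k - m) ^ 2 ≤ ∑ j ∈ J, h j ^ 2 := fun m =>
    sum_comp_le_of_injective (fun j => sq_nonneg (h j)) (fun j hj => by simp [hJ j hj])
      (sub_left_injective (b := m)) K
  calc ∑ k ∈ K, h (k - m) * h (k - n)
      ≤ ∑ k ∈ K, (1 / 2 * h (k - m) ^ 2 + 1 / 2 * h (k - n) ^ 2) :=
        Finset.sum_le_sum fun k _ => by nlinarith [sq_nonneg (h (k - m) - h (k - n))]
    _ ≤ _ := by
        rw [Finset.sum_add_distrib, ← Finset.mul_sum, ← Finset.mul_sum]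
        linarith [key m, key n]

lemma sq_sum_shift_le (hh : ∀ j, 0 ≤ h j) (hJ : ∀ j ∉ J, h j = 0) (m n : Wave) :
    (∑ k ∈ K, v k ^ 2 * (h (k - m) * h (k - n))) ^ 2
      ≤ (∑ k ∈ K, v k ^ 4 * (h (k - m) * h (k - n))) * ∑ j ∈ J, h j ^ 2 := by
  have hmn : ∀ k, 0 ≤ h (k - m) * h (k - n) := fun k => mul_nonneg (hh _) (hh _)
  refine (Finset.sum_sq_le_sum_mul_sum_of_sq_le_mul K
    (f := fun k => v k ^ 4 * (h (k - m) * h (k - n))) (g := fun k => h (k - m) * h (k - n))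
    (fun k _ => mul_nonneg (by positivity) (hmn k)) (fun k _ => hmn k)
    fun k _ => le_of_eq (by ring)).trans ?_
  exact mul_le_mul_of_nonneg_left (sum_mul_shift_le hJ m n)
    (Finset.sum_nonneg fun k _ => mul_nonneg (by positivity) (hmn k))

lemma norm_gram_le (hv : ∀ k ∈ K, 0 ≤ v k) (hh : ∀ j, 0 ≤ h j)
    (hb : ∀ k ∈ K, ∀ m ∈ M, ∀ s, ‖b k (m, s)‖ ≤ v k * h (k - m)) {m n : Wave} (hm : m ∈ M)
    (hn : n ∈ M) (s t : Bool) :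
    ‖gram K b ((m, s), (n, t))‖ ≤ ∑ k ∈ K, v k ^ 2 * (h (k - m) * h (k - n)) := by
  refine (norm_sum_le _ _).trans (Finset.sum_le_sum fun k hk => ?_)
  rw [norm_mul, RCLike.norm_conj]
  calc _ ≤ (v k * h (k - m)) * (v k * h (k - n)) :=
        mul_le_mul (hb k hk m hm s) (hb k hk n hn t) (norm_nonneg _)
          (mul_nonneg (hv k hk) (hh _))
    _ = _ := by ring

/-- The Hilbert-Schmidt norm of the matrix. -/
lemma sum_norm_gram_sq_le (hv : ∀ k ∈ K, 0 ≤ v k) (hh : ∀ j, 0 ≤ h j) (hJ : ∀ j ∉ J, h j = 0)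
    (hb : ∀ k ∈ K, ∀ m ∈ M, ∀ s, ‖b k (m, s)‖ ≤ v k * h (k - m)) :
    ∑ p ∈ (M ×ˢ (Finset.univ : Finset Bool)) ×ˢ (M ×ˢ (Finset.univ : Finset Bool)),
        ‖gram K b p‖ ^ 2
      ≤ 4 * ((∑ j ∈ J, h j) ^ 2 * ∑ j ∈ J, h j ^ 2) * ∑ k ∈ K, v k ^ 4 := by
  set g := ∑ j ∈ J, h j ^ 2 with hg
  have hg0 : 0 ≤ g := Finset.sum_nonneg fun j _ => sq_nonneg _
  have hrow : ∀ k : Wave, ∑ m ∈ M, h (k - m) ≤ ∑ j ∈ J, h j := fun k =>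
    sum_comp_le_of_injective hh hJ (sub_right_injective (b := k)) M
  have hterm : ∀ m ∈ M, ∀ n ∈ M, ∀ s t : Bool, ‖gram K b ((m, s), (n, t))‖ ^ 2
      ≤ (∑ k ∈ K, v k ^ 4 * (h (k - m) * h (k - n))) * g := fun m hm n hn s t =>
    (pow_le_pow_left₀ (norm_nonneg _) (norm_gram_le hv hh hb hm hn s t) 2).trans
      (sq_sum_shift_le hh hJ m n)
  simp only [Finset.sum_product, Fintype.sum_bool]
  calc _ ≤ ∑ m ∈ M, ∑ n ∈ M, 4 * ((∑ k ∈ K, v k ^ 4 * (h (k - m) * h (k - n))) * g) := by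
        refine Finset.sum_le_sum fun m hm => ?_
        rw [← Finset.sum_add_distrib]
        refine Finset.sum_le_sum fun n hn => ?_
        have := hterm m hm n hn
        linarith [this true true, this true false, this false true, this false false]
    _ = 4 * g * ∑ k ∈ K, v k ^ 4 * (∑ m ∈ M, h (k - m)) ^ 2 := by
        have e : ∀ k ∈ K, v k ^ 4 * (∑ m ∈ M, h (k - m)) ^ 2
            = ∑ m ∈ M, ∑ n ∈ M, v k ^ 4 * (h (k - m) * h (k - n)) := fun k _ => by
          rw [sq, Finset.sum_mul_sum, Finset.mul_sum]
          exact Finset.sum_congr rfl fun m _ => Finset.mul_sum _ _ _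
        have e2 : ∑ k ∈ K, ∑ m ∈ M, ∑ n ∈ M, v k ^ 4 * (h (k - m) * h (k - n))
            = ∑ m ∈ M, ∑ n ∈ M, ∑ k ∈ K, v k ^ 4 * (h (k - m) * h (k - n)) := by
          rw [Finset.sum_comm]
          exact Finset.sum_congr rfl fun m _ => Finset.sum_comm
        rw [Finset.sum_congr rfl e, e2, Finset.mul_sum]
        refine Finset.sum_congr rfl fun m _ => ?_
        rw [Finset.mul_sum]
        exact Finset.sum_congr rfl fun n _ => by ring
    _ ≤ 4 * g * ∑ k ∈ K, v k ^ 4 * (∑ j ∈ J, h j) ^ 2 := by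
        gcongr with k hk
        · exact Finset.sum_nonneg fun m _ => hh _
        · exact hrow k
    _ = _ := by rw [← Finset.sum_mul]; ring

/-- The diagonal of the matrix. -/
lemma sum_norm_gram_diag_sq_le (hv : ∀ k ∈ K, 0 ≤ v k) (hh : ∀ j, 0 ≤ h j)
    (hJ : ∀ j ∉ J, h j = 0)
    (hb : ∀ k ∈ K, ∀ m ∈ M, ∀ s, ‖b k (m, s)‖ ≤ v k * h (k - m)) :
    ∑ a ∈ M ×ˢ (Finset.univ : Finset Bool), ‖gram K b (a, a)‖ ^ 2
      ≤ 2 * (∑ j ∈ J, h j ^ 2) ^ 2 * ∑ k ∈ K, v k ^ 4 := by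
  set g := ∑ j ∈ J, h j ^ 2 with hg
  have hg0 : 0 ≤ g := Finset.sum_nonneg fun j _ => sq_nonneg _
  have hrow : ∀ k : Wave, ∑ m ∈ M, h (k - m) * h (k - m) ≤ g := fun k => by
    have := sum_comp_le_of_injective (fun j => sq_nonneg (h j)) (fun j hj => by simp [hJ j hj])
      (sub_right_injective (b := k)) M (J := J)
    rw [hg]
    simpa only [sq] using this
  simp only [Finset.sum_product, Fintype.sum_bool]
  calc _ ≤ ∑ m ∈ M, 2 * ((∑ k ∈ K, v k ^ 4 * (h (k - m) * h (k - m))) * g) := by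
        refine Finset.sum_le_sum fun m hm => ?_
        have := fun s => (pow_le_pow_left₀ (norm_nonneg _) (norm_gram_le hv hh hb hm hm s s)
          2).trans (sq_sum_shift_le (v := v) (K := K) hh hJ m m)
        linarith [this true, this false]
    _ = 2 * g * ∑ k ∈ K, v k ^ 4 * ∑ m ∈ M, h (k - m) * h (k - m) := by
        simp only [Finset.mul_sum, Finset.sum_mul]
        rw [Finset.sum_comm]
        exact Finset.sum_congr rfl fun k _ => Finset.sum_congr rfl fun m _ => by ring
    _ ≤ 2 * g * ∑ k ∈ K, v k ^ 4 * g := by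
        gcongr with k hk
        exact hrow k
    _ = _ := by rw [← Finset.sum_mul]; ring

end Convolution

end BHT

namespace BHT

/-! ### The variance of the spectrum for a source with finitely many modes -/

/-- The factor of the mode `a` in the Fourier coefficient `k` of the first correction. -/
noncomputable def corrCoeff (β U : ℝ) (γ : Wave → ℂ) (k : Wave) (a : Wave × Bool) : ℂ :=
  ((U * len a.1 ^ β * (if a.2 then edot (k - a.1) a.1 else fdot (k - a.1) a.1)
    / len k ^ 2 : ℝ) : ℂ) * (Complex.I * γ (k - a.1))

/-- The velocity modes that couple source modes with `|j| < κ_g` to wave vectors in the shell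
`[κ, 2κ)`. -/
noncomputable def couplingModes (κg κ : ℝ) : Finset (Wave × Bool) :=
  shell (κ - κg) (2 * κ + κg) ×ˢ Finset.univ

section FiniteSource

variable {β U κg κ : ℝ} {γ : Wave → ℂ}

lemma mem_couplingShell {k m : Wave} (hk : k ∈ shell κ (2 * κ)) (h : len (k - m) < κg) :
    m ∈ shell (κ - κg) (2 * κ + κg) := by
  obtain ⟨h1, h2⟩ := mem_shell.mp hk
  have e1 := len_le_add_sub m k
  have e2 := len_le_add_sub k m
  rw [len_sub_comm] at e2
  rw [mem_shell]
  constructor <;> linarith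

lemma transport_eq_sum {Ω' : Type*} {V W : Wave → Ω' → ℂ} (hκ : 0 < κ)
    (hγ : ∀ k, κg ≤ len k → γ k = 0) {k : Wave} (hk : k ∈ shell κ (2 * κ)) (ω : Ω') :
    transport β U (fun k => V k ω) (fun k => W k ω) (fun j => -γ j) k
      = ∑ a ∈ couplingModes κg κ, corrCoeff β U γ k a * modeVar V W a ω := by
  have hk0 := ne_zero_of_mem_shell hκ hk
  have hL : (len k : ℂ) ≠ 0 := by exact_mod_cast (len_pos hk0).ne'
  have e1 : ∑' j, Complex.I * modeAdv β U (fun k => V k ω) (fun k => W k ω) j (k - j) * -γ j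
      = ∑' m, Complex.I * modeAdv β U (fun k => V k ω) (fun k => W k ω) (k - m) m
        * -γ (k - m) := by
    rw [← (Equiv.subLeft k).tsum_eq]
    exact tsum_congr fun m => by simp [Equiv.subLeft_apply]
  rw [transport, if_neg hk0, e1, tsum_eq_sum (s := shell (κ - κg) (2 * κ + κg)) fun m hm => ?_,
    couplingModes, Finset.sum_product, Finset.sum_div, ← Finset.sum_neg_distrib]
  · refine Finset.sum_congr rfl fun m _ => ?_
    rw [Fintype.sum_bool, modeAdv_eq]
    simp only [corrCoeff, if_true, Bool.false_eq_true, if_false]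
    push_cast
    field_simp
  · rw [hγ (k - m) (not_lt.mp fun h => hm (mem_couplingShell hk h))]
    simp

lemma len_pos_of_mem_couplingModes (hκ : κg < κ) {a : Wave × Bool}
    (ha : a ∈ couplingModes κg κ) : a.1 ≠ 0 :=
  ne_zero_of_mem_shell (sub_pos.mpr hκ) (Finset.mem_product.mp ha).1

lemma flipMode_mem_couplingModes {a : Wave × Bool} (ha : a ∈ couplingModes κg κ) :
    flipMode a ∈ couplingModes κg κ := by
  simp only [couplingModes, Finset.mem_product, mem_shell, Finset.mem_univ, and_true, flipMode,
    len_neg] at ha ⊢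
  exact ha

/-- Opposite modes do not couple source modes of long wavelength to the same wave vector. -/
lemma corrCoeff_flip_mul (hκ : 2 * κg ≤ κ) (hκg : 0 < κg) (hγ : ∀ k, κg ≤ len k → γ k = 0)
    {k : Wave} (hk : k ∈ shell κ (2 * κ)) (a : Wave × Bool) :
    corrCoeff β U γ k (flipMode a) * conj (corrCoeff β U γ k a) = 0 := by
  by_cases h1 : κg ≤ len (k - a.1)
  · simp [corrCoeff, hγ _ h1]
  have h2 : κg ≤ len (k - -a.1) := by
    by_contra h2
    push Not at h1 h2
    have hpar : len (k - -a.1) ^ 2 + len (k - a.1) ^ 2 = 2 * len k ^ 2 + 2 * len a.1 ^ 2 := by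
      simp only [len_sq', Pi.sub_apply, Pi.neg_apply]
      push_cast; ring
    have := (mem_shell.mp hk).1
    nlinarith [sq_nonneg (len a.1), len_nonneg (k - a.1), len_nonneg (k - -a.1)]
  have h3 : γ (k - (flipMode a).1) = 0 := hγ _ h2
  rw [corrCoeff, h3]
  simp

lemma norm_corrCoeff_le (hβ : β < 0) (hU : 0 ≤ U) (hκ : κg < κ) (hκg : 0 < κg)
    (hγ : ∀ k, κg ≤ len k → γ k = 0) {k m : Wave} (hk : k ∈ shell κ (2 * κ))
    (hm : m ∈ shell (κ - κg) (2 * κ + κg)) (s : Bool) :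
    ‖corrCoeff β U γ k (m, s)‖
      ≤ U * (1 - κg / κ) ^ β * len k ^ (β - 2) * (len (k - m) * ‖γ (k - m)‖) := by
  have hκ0 : 0 < κ := by linarith
  have hk0 := ne_zero_of_mem_shell hκ0 hk
  have hm0 : m ≠ 0 := ne_zero_of_mem_shell (sub_pos.mpr hκ) hm
  have hL := len_pos hk0
  have hμ : 0 < 1 - κg / κ := by rw [sub_pos, div_lt_one hκ0]; exact hκ
  by_cases h : κg ≤ len (k - m)
  · simp [corrCoeff, hγ _ h]
  push Not at h
  have hc : |if s then edot (k - m) m else fdot (k - m) m| ≤ len (k - m) := by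
    split_ifs
    · exact abs_edot_le _ hm0
    · exact abs_fdot_le _ hm0
  have hlow : len k * (1 - κg / κ) ≤ len m := by
    have e1 := len_le_add_sub m k
    have e2 : κg ≤ len k * (κg / κ) := by
      rw [mul_div_assoc', le_div_iff₀ hκ0, mul_comm]
      exact mul_le_mul_of_nonneg_right (mem_shell.mp hk).1 hκg.le
    linarith
  have hp : len m ^ β ≤ len k ^ β * (1 - κg / κ) ^ β := by
    rw [← Real.mul_rpow hL.le hμ.le]
    exact Real.rpow_le_rpow_of_nonpos (mul_pos hL hμ) hlow hβ.le
  have hm' := Real.rpow_nonneg (len_nonneg m) β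
  rw [corrCoeff, norm_mul, norm_mul, Complex.norm_I, one_mul, Complex.norm_real, Real.norm_eq_abs,
    abs_div, abs_mul, abs_of_nonneg (mul_nonneg hU hm'), abs_of_nonneg (sq_nonneg (len k))]
  calc _ ≤ U * (len k ^ β * (1 - κg / κ) ^ β) * len (k - m) / len k ^ 2 * ‖γ (k - m)‖ := by gcongr
    _ = _ := by
        rw [Real.rpow_sub hL, Real.rpow_two]
        ring

variable {Ω : Type*} [MeasurableSpace Ω] {P : Measure Ω} [IsProbabilityMeasure P]
  {V W : Wave → Ω → ℂ} {ς Ξ : ℝ}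

/-- The energy of the first correction in a shell. -/
noncomputable def corrEnergy (β U κg κ : ℝ) (γ : Wave → ℂ) (V W : Wave → Ω → ℂ) (ω : Ω) : ℝ :=
  ∑ k ∈ shell κ (2 * κ), ‖∑ a ∈ couplingModes κg κ, corrCoeff β U γ k a * modeVar V W a ω‖ ^ 2

lemma variance_corrEnergy_le (hβ : β < 0) (hU : 0 ≤ U) (hκg : 0 < κg) (hκ : 2 * κg ≤ κ)
    (hγ : ∀ k, κg ≤ len k → γ k = 0) (h : IsVelocityModes P V W ς Ξ) :
    Var[corrEnergy β U κg κ γ V W; P]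
      ≤ U ^ 4 * ((1 - κg / κ) ^ β) ^ 4 * (∑ k ∈ shell κ (2 * κ), len k ^ (4 * β - 8))
        * (8 * (∑ j ∈ shell 0 κg, len j * ‖γ j‖) ^ 2 * ∑ j ∈ shell 0 κg, (len j * ‖γ j‖) ^ 2
          + 4 * (ς - 1) * (∑ j ∈ shell 0 κg, (len j * ‖γ j‖) ^ 2) ^ 2) := by
  have hκ' : κg < κ := by linarith
  have hμ : 0 < 1 - κg / κ := by rw [sub_pos, div_lt_one (by linarith)]; exact hκ'
  have hς := h.one_le_fourth
  set A := couplingModes κg κ with hA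
  set b := corrCoeff β U γ with hb
  set v : Wave → ℝ := fun k => U * (1 - κg / κ) ^ β * len k ^ (β - 2) with hv
  set f : Wave → ℝ := fun j => len j * ‖γ j‖ with hf
  have hv0 : ∀ k ∈ shell κ (2 * κ), 0 ≤ v k := fun k _ => by
    have := Real.rpow_nonneg (len_nonneg k) (β - 2)
    positivity
  have hf0 : ∀ j, 0 ≤ f j := fun j => mul_nonneg (len_nonneg j) (norm_nonneg _)
  have hfJ : ∀ j ∉ shell 0 κg, f j = 0 := fun j hj => by
    have : κg ≤ len j := by
      by_contra hlt
      exact hj (mem_shell.mpr ⟨len_nonneg j, not_le.mp hlt⟩)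
    simp [hf, hγ j this]
  have hbv : ∀ k ∈ shell κ (2 * κ), ∀ m ∈ shell (κ - κg) (2 * κ + κg), ∀ s,
      ‖b k (m, s)‖ ≤ v k * f (k - m) := fun k hk m hm s =>
    norm_corrCoeff_le hβ hU hκ' hκg hγ hk hm s
  have h1 := h.variance_quadForm_le (K := shell κ (2 * κ)) (A := A) (b := b)
    (fun a ha => len_pos_of_mem_couplingModes hκ' ha)
    (fun a ha => flipMode_mem_couplingModes ha)
    fun k hk a _ => corrCoeff_flip_mul hκ hκg hγ hk a
  have h2 := sum_norm_gram_sq_le hv0 hf0 hfJ hbv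
  have h3 := sum_norm_gram_diag_sq_le hv0 hf0 hfJ hbv
  have h4 : ∑ p ∈ A ×ˢ A, pairBound ς p * ‖gram (shell κ (2 * κ)) b p‖ ^ 2
      ≤ ∑ p ∈ A ×ˢ A, ‖gram (shell κ (2 * κ)) b p‖ ^ 2
        + (ς - 1) * ∑ a ∈ A, ‖gram (shell κ (2 * κ)) b (a, a)‖ ^ 2 := by
    have e : ∑ a ∈ A, ‖gram (shell κ (2 * κ)) b (a, a)‖ ^ 2
        = ∑ p ∈ A ×ˢ A, if p.1 = p.2 then ‖gram (shell κ (2 * κ)) b p‖ ^ 2 else 0 := by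
      rw [Finset.sum_product]
      refine Finset.sum_congr rfl fun a ha => ?_
      simp only [Finset.sum_ite_eq, ha, if_true]
    rw [e, Finset.mul_sum, ← Finset.sum_add_distrib]
    refine Finset.sum_le_sum fun p _ => ?_
    rw [pairBound]
    split_ifs
    · nlinarith [sq_nonneg ‖gram (shell κ (2 * κ)) b p‖]
    · simp
  have hv4 : ∑ k ∈ shell κ (2 * κ), v k ^ 4
      = U ^ 4 * ((1 - κg / κ) ^ β) ^ 4 * ∑ k ∈ shell κ (2 * κ), len k ^ (4 * β - 8) := by
    rw [Finset.mul_sum]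
    refine Finset.sum_congr rfl fun k _ => ?_
    rw [show 4 * β - 8 = (β - 2) * (4 : ℕ) by push_cast; ring, Real.rpow_mul (len_nonneg k),
      Real.rpow_natCast]
    simp only [hv]; ring
  rw [hv4] at h2 h3
  have h5 := mul_le_mul_of_nonneg_left h3 (show 0 ≤ ς - 1 by linarith)
  calc Var[corrEnergy β U κg κ γ V W; P] ≤ _ := h1
    _ ≤ 2 * (_ + _) := mul_le_mul_of_nonneg_left (h4.trans (add_le_add h2 h5)) zero_le_two
    _ = _ := by ring

/-- The lattice sum over a shell and the shift of the velocity modes by a source mode cost a factor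
that tends to `1`. -/
lemma eventually_sum_shell_le (hβ : β < -2) (κg : ℝ) {η : ℝ} (hη : 0 < η) :
    ∀ᶠ κ : ℝ in atTop, ((1 - κg / κ) ^ β) ^ 4 * ∑ k ∈ shell κ (2 * κ), len k ^ (4 * β - 8)
      ≤ (1 + η) * (4 * Real.pi * κ ^ (4 * β - 5) * i₂ (4 * β - 5)) := by
  set s : ℝ := 4 * β - 8 with hs
  set R : ℝ := Real.pi * 4 / 3 * (16 * |s| + 68) with hR
  set I : ℝ := 4 * Real.pi * i₂ (4 * β - 5) with hI
  have hi : 0 < i₂ (4 * β - 5) := by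
    have h1 : (2 : ℝ) ^ (4 * β - 5) < 1 := Real.rpow_lt_one_of_one_lt_of_neg one_lt_two (by linarith)
    rw [i₂]
    exact div_pos_of_neg_of_neg (by linarith) (by linarith)
  have hI0 : 0 < I := by positivity
  have hlim : Tendsto (fun κ : ℝ => ((1 - κg / κ) ^ β) ^ 4 * (I + R / κ)) atTop (𝓝 I) := by
    have l1 : Tendsto (fun κ : ℝ => κg / κ) atTop (𝓝 0) :=
      tendsto_const_nhds.div_atTop tendsto_id
    have l2 : Tendsto (fun κ : ℝ => R / κ) atTop (𝓝 0) := tendsto_const_nhds.div_atTop tendsto_id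
    have l3 : Tendsto (fun κ : ℝ => (1 - κg / κ) ^ β) atTop (𝓝 ((1 - 0) ^ β)) :=
      (l1.const_sub 1).rpow_const (Or.inl (by norm_num))
    have := (l3.pow 4).mul (l2.const_add I)
    simpa using this
  have hev := hlim.eventually_le_const (show I < (1 + η) * I by nlinarith)
  filter_upwards [hev, eventually_ge_atTop 2] with κ h1 h2
  have hκ0 : 0 < κ := by linarith
  have hsum := (abs_le.mp (abs_sum_shell_rpow_sub_le (s := s) (by linarith) h2)).2
  have e : κ ^ (s + 2) = κ ^ (4 * β - 5) / κ := by
    rw [← Real.rpow_sub_one hκ0.ne']; congr 1; rw [hs]; ring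
  rw [e, show s + 3 = 4 * β - 5 by rw [hs]; ring, ← hR] at hsum
  have hp := Real.rpow_pos_of_pos hκ0 (4 * β - 5)
  calc _ ≤ ((1 - κg / κ) ^ β) ^ 4 * (κ ^ (4 * β - 5) * (I + R / κ)) := by
        refine mul_le_mul_of_nonneg_left ?_ (by positivity)
        calc _ ≤ 4 * Real.pi * κ ^ (4 * β - 5) * i₂ (4 * β - 5) + R * (κ ^ (4 * β - 5) / κ) := by
              linarith
          _ = _ := by rw [hI]; ring
    _ = κ ^ (4 * β - 5) * (((1 - κg / κ) ^ β) ^ 4 * (I + R / κ)) := by ring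
    _ ≤ κ ^ (4 * β - 5) * ((1 + η) * I) := mul_le_mul_of_nonneg_left h1 hp.le
    _ = _ := by rw [hI]; ring

/-- The variance of the spectrum of the first correction, for a source with finitely many
modes. -/
theorem variance_normSq_le {α ϖ : ℝ} (hβ : β < -2) (hα : α < 2 * min β (-3) - 1)
    (hκg : 16 ≤ κg) (hγ : IsSourceCoeff α 0 κg γ) (h : IsVelocityModes P V W ς Ξ) (hU : 0 ≤ U)
    (hϖ : IsConvConst β κg ϖ) (hq : 2 * U * Ξ * ϖ ≤ 1 / 2) :
    (∀ κ : ℝ, 4 * κg ^ 2 ≤ κ → MemLp (fun ω => normSq (proj κ (2 * κ)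
      (firstCorr (velocity β U (fun k => V k ω) (fun k => W k ω)) (source γ)))) 2 P) ∧
    ∀ η : ℝ, 0 < η → ∀ᶠ κ : ℝ in atTop,
      Var[fun ω => normSq (proj κ (2 * κ)
          (firstCorr (velocity β U (fun k => V k ω) (fun k => W k ω)) (source γ))); P]
        ≤ (1 + η) * (κ ^ (4 * β - 5) * (16 * Real.pi * U ^ 4) * i₂ (4 * β - 5)
          * normSq (invGrad (source γ))
          * (16 * Real.pi ^ 3 * wienerNorm (invGrad (source γ)) ^ 2
            + (ς - 1) * normSq (invGrad (source γ)))) := by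
  have hα1 : α < 2 * β - 1 := hα.trans_le (by have := min_le_left β (-3); linarith)
  have hα2 : α < -7 := hα.trans_le (by have := min_le_right β (-3); linarith)
  have hγ0 : ∀ k, κg ≤ len k → γ k = 0 := fun k hk => by
    have := hγ.decay k hk
    rw [zero_mul] at this
    exact norm_le_zero_iff.mp this
  have hς := h.one_le_fourth
  obtain ⟨M, hM, hγM⟩ := exists_source_bound le_rfl hγ
  have hX : ∀ κ : ℝ, 0 < κ → (fun ω => normSq (proj κ (2 * κ)
      (firstCorr (velocity β U (fun k => V k ω) (fun k => W k ω)) (source γ))))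
      =ᵐ[P] fun ω => (2 * Real.pi) ^ 3 * corrEnergy β U κg κ γ V W ω := by
    intro κ hκ
    have hZ : IsSourceFactor P V W (fun _ _ => 1) 1 :=
      isSourceFactor_of (Or.inl ⟨fun _ _ => rfl, rfl⟩)
    filter_upwards [ae_normSq_firstCorr_eq hβ (by linarith) hα2 hκg hU h hZ hϖ hq le_rfl hγ]
      with ω hω
    have := hω κ (2 * κ)
    simp only [mul_one] at this
    rw [this, corrEnergy]
    congr 1
    exact Finset.sum_congr rfl fun k hk => by rw [transport_eq_sum hκ hγ0 hk]
  have hgrad := coeff_invGrad_source (show α < -4 by linarith) hM hγ.zero hγM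
  have hnorm : ∀ k, ‖coeff (invGrad (source γ)) k‖ = len k * ‖γ k‖ := fun k => by
    rw [hgrad, norm_mul, norm_neg, Complex.norm_real, Real.norm_eq_abs,
      abs_of_nonneg (len_nonneg k)]
  have hout : ∀ k ∉ shell 0 κg, len k * ‖γ k‖ = 0 := fun k hk => by
    have : κg ≤ len k := by
      by_contra hlt
      exact hk (mem_shell.mpr ⟨len_nonneg k, not_le.mp hlt⟩)
    simp [hγ0 k this]
  set S := ∑ j ∈ shell 0 κg, len j * ‖γ j‖ with hS
  set g := ∑ j ∈ shell 0 κg, (len j * ‖γ j‖) ^ 2 with hg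
  have hwiener : wienerNorm (invGrad (source γ)) = S := by
    rw [wienerNorm]
    simp only [hnorm]
    exact tsum_eq_sum hout
  have hnormSq : normSq (invGrad (source γ)) = (2 * Real.pi) ^ 3 * g := by
    rw [normSq, norm_sq_eq_tsum]
    simp only [hnorm]
    rw [tsum_eq_sum fun k hk => by rw [hout k hk, zero_pow two_ne_zero]]
  have hg0 : 0 ≤ g := Finset.sum_nonneg fun j _ => sq_nonneg _
  constructor
  · intro κ hκ
    have hκ1 : 2 * κg ≤ κ := by nlinarith
    refine MemLp.ae_eq (hX κ (by linarith)).symm (MemLp.const_mul ?_ _)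
    exact h.memLp_quadForm _ _ fun a ha => len_pos_of_mem_couplingModes (by linarith) ha
  · intro η hη
    filter_upwards [eventually_sum_shell_le hβ κg hη, eventually_ge_atTop (2 * κg)] with κ h1 h2
    rw [variance_congr (hX κ (by linarith)), variance_const_mul, hwiener, hnormSq]
    have h3 := variance_corrEnergy_le (by linarith) hU (by linarith) h2 hγ0 h (β := β)
    set T := ∑ k ∈ shell κ (2 * κ), len k ^ (4 * β - 8)
    have hG : 0 ≤ 8 * S ^ 2 * g + 4 * (ς - 1) * g ^ 2 :=
      add_nonneg (by positivity) (mul_nonneg (by linarith) (sq_nonneg g))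
    calc _ ≤ ((2 * Real.pi) ^ 3) ^ 2 * (U ^ 4 * ((1 - κg / κ) ^ β) ^ 4 * T
          * (8 * S ^ 2 * g + 4 * (ς - 1) * g ^ 2)) := by gcongr
      _ = ((2 * Real.pi) ^ 3) ^ 2 * (U ^ 4 * (((1 - κg / κ) ^ β) ^ 4 * T)
          * (8 * S ^ 2 * g + 4 * (ς - 1) * g ^ 2)) := by ring
      _ ≤ ((2 * Real.pi) ^ 3) ^ 2 * (U ^ 4 * ((1 + η)
          * (4 * Real.pi * κ ^ (4 * β - 5) * i₂ (4 * β - 5)))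
          * (8 * S ^ 2 * g + 4 * (ς - 1) * g ^ 2)) := by gcongr
      _ = _ := by ring

end FiniteSource

end BHT

open BHT in
theorem theorem1 (β : ℝ) (hβ : β < -2) :
    -- the constant `c(β)`
    ∃ C₂ : ℝ, ∀ α : ℝ, α < 2 * min β (-3) - 1 →
    -- the constant `c(α, β)`
    ∃ C₁ : ℝ, ∀ cg κg : ℝ, 0 ≤ cg → 16 ≤ κg →
    -- the constant `ϖ` that defines `U_max = 1 / (4 Ξ ϖ)` exists
    (∃ ϖ : ℝ, IsConvConst β κg ϖ) ∧
    ∀ γ : Wave → ℂ, IsSourceCoeff α cg κg γ →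
    -- the constant `c(g, α, β)`
    ∃ C₃ : ℝ, ∀ (Ω : Type*) [MeasurableSpace Ω] (P : Measure Ω) [IsProbabilityMeasure P]
      (V W : Wave → Ω → ℂ) (ς Ξ : ℝ), IsVelocityModes P V W ς Ξ →
    ∀ U ϖ ε : ℝ, 0 ≤ U → IsConvConst β κg ϖ → ε = 4 * U * Ξ * ϖ → ε < 1 →
    -- the source is deterministic, or random with factors `Z k`
    (∀ (Z : Wave → Ω → ℂ) (Ξg : ℝ),
      ((∀ k ω, Z k ω = 1) ∧ Ξg = 1 ∨ ∃ ϱ : ℝ, IsRandomSource P V W Z ϱ Ξg) →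
      let u : Ω → Fin 3 → L2 := fun ω => velocity β U (fun k => V k ω) (fun k => W k ω)
      let g : Ω → L2 := fun ω => source fun k => γ k * Z k ω
      -- almost surely there is a unique solution, the limit of the iteration
      (∀ᵐ ω ∂P, ∃ θ δθ : L2,
        IsStaticSolution (u ω) (g ω) θ ∧
        (∀ θ' : L2, IsStaticSolution (u ω) (g ω) θ' → θ' = θ) ∧
        (∀ᵐ x, (θ x).im = 0) ∧
        (∀ n, MemH1 (iter (u ω) (g ω) n)) ∧
        Tendsto (iter (u ω) (g ω)) atTop (𝓝 θ) ∧
        (∀ i, Tendsto (fun n => partialD i (iter (u ω) (g ω) n)) atTop (𝓝 (partialD i θ))) ∧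
        θ = -invLap (g ω) + firstCorr (u ω) (g ω) + δθ ∧
        ∀ κ : ℝ, 4 * κg ^ 2 ≤ κ →
          normSq (proj κ (2 * κ) δθ)
            ≤ ε ^ 2 * C₃ * U ^ 2 * Ξ ^ 2 * Ξg ^ 2 * κ ^ (2 * β - 1)) ∧
      -- the expected spectrum of the first correction
      ∀ κ : ℝ, 4 * κg ^ 2 ≤ κ →
        Integrable (fun ω => normSq (proj κ (2 * κ) (firstCorr (u ω) (g ω)))) P ∧
        |∫ ω, normSq (proj κ (2 * κ) (firstCorr (u ω) (g ω))) ∂P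
            - κ ^ (2 * β - 1) * (8 * Real.pi * U ^ 2 / 3) * i₂ (2 * β - 1)
              * normSq (proj 1 (κ ^ (1 / 2 : ℝ)) (invGrad (source γ)))|
          ≤ cg ^ 2 * U ^ 2 * C₁ * κ ^ α
            + C₂ * U ^ 2 * normSq (invGrad (source γ)) * κ ^ (2 * β - 3 / 2)) ∧
    -- the variance, for a deterministic finite-mode source
    (cg = 0 →
      let X : ℝ → Ω → ℝ := fun κ ω => normSq (proj κ (2 * κ)
        (firstCorr (velocity β U (fun k => V k ω) (fun k => W k ω)) (source γ)))
      (∀ κ : ℝ, 4 * κg ^ 2 ≤ κ → MemLp (X κ) 2 P) ∧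
      ∀ η : ℝ, 0 < η → ∀ᶠ κ : ℝ in atTop,
        Var[X κ; P] ≤ (1 + η) * (κ ^ (4 * β - 5) * (16 * Real.pi * U ^ 4) * i₂ (4 * β - 5)
          * normSq (invGrad (source γ))
          * (16 * Real.pi ^ 3 * wienerNorm (invGrad (source γ)) ^ 2
            + (ς - 1) * normSq (invGrad (source γ))))) := by
  obtain ⟨C₂, hC₂⟩ := exists_abs_integral_normSq_sub_le hβ
  refine ⟨C₂, fun α hα => ?_⟩
  obtain ⟨C₁, hC₁⟩ := hC₂ α hα
  refine ⟨C₁, fun cg κg hcg hκg => ⟨exists_isConvConst hβ hκg, fun γ hγ => ?_⟩⟩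
  obtain ⟨C₃, hC₃⟩ := exists_static_solution hβ hα hcg hκg hγ
  refine ⟨C₃, fun Ω _ P _ V W ς Ξ h U ϖ ε hU hϖ hε hε1 => ⟨fun Z Ξg hZ => ⟨?_, ?_⟩, ?_⟩⟩
  · have hZ' := isSourceFactor_of hZ
    filter_upwards [h.ae_isBoundedModes, hZ'.bound, hZ'.real] with ω hω h1 h2
    exact hC₃ U Ξ ϖ ε _ _ (fun k => Z k ω) Ξg hU hϖ hε hε1 hω h1 h2
  · intro κ hκ
    exact hC₁ cg κg γ hcg hκg hγ P V W Z ς Ξ Ξg U ϖ hU h (isSourceFactor_of hZ) hϖ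
      (by linarith) κ hκ
  · rintro rfl
    exact variance_normSq_le hβ hα hκg hγ h hU hϖ (by linarith)
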